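/- Let $\mathfrak g$ be a finite-dimensional complex reductive Lie algebra, $\mathfrak t\subseteq\mathfrak g$ a Cartan subalgebra, and $(\cdot\mid\cdot)$ a nondegenerate invariant symmetric bilinear form on $\mathfrak g$. Let $\Phi\subseteq\mathfrak t^\vee$ be the root system and $\mathfrak g=\mathfrak t\oplus\bigoplus_{\alpha\in\Phi}\mathfrak g_\alpha$ the root-space decomposition. Let $\widehat{\mathfrak g}=\mathfrak g((z))\oplus\mathbb CK$ be the affine Lie algebra, with $K$ central and $$[X\otimes f,Y\otimes f']=[X,Y]\otimes ff'+(X\mid Y)\operatorname{Res}_{z=0}(f'\,df)\,K ,$$ and for $r\ge1$ let $\mathfrak g_r=\mathfrak g\otimes\mathbb C[[z]]/(z^r)$, with $\varepsilon$ the class of $z$. For a Lie algebra $S$ write $S_{\mathrm{ab}}=S/[S,S]$; a character of $S$ is a Lie algebra morphism $S\to\mathbb C$. For subspaces $U,V$, $[U,V]$ denotes the span of all brackets. A subalgebra of $\mathfrak g$ is parabolic if it contains a Borel (i.e. maximal solvable) subalgebra. A subset $\psi\subseteq\Phi$ is parabolic if $(\psi+\psi)\cap\Phi\subseteq\psi$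 and $\psi\cup(-\psi)=\Phi$; put $\mathfrak p_\psi=\mathfrak t\oplus\bigoplus_{\alpha\in\psi}\mathfrak g_\alpha$. A parabolic filtration is a sequence $\boldsymbol\psi=(\psi_i)_{i\ge0}$ of parabolic subsets with $\psi_i\subseteq\psi_{i+1}$ and $\bigcup_i\psi_i=\Phi$; its depth is the least $r$ with $\psi_i=\Phi$ for all $i\ge r$. Its Levi factor is $\phi_i=\psi_i\cap(-\psi_i)$, and $\mathfrak Z_{\phi_i}$ denotes the centre of $\mathfrak l_{\phi_i}=\mathfrak t\oplus\bigoplus_{\alpha\in\phi_i}\mathfrak g_\alpha$. Let $\widehat{\mathfrak S}^{\boldsymbol\psi}\subseteq\mathfrak g[[z]]\oplus\mathbb CK\subseteq\widehat{\mathfrak g}$ be the affine singularity algebra of all $\sum_{i\ge0}X_iz^i+cK$ with $X_i\in\mathfrak p_{\psi_i}$ (formal power series), and let $\widehat{\mathfrak Z}_{\boldsymbol\phi}\subseteq\mathfrak g[[z]]$ consist of the formal power series $\sum_{i\ge 0} X_iz^i$ with $X_i\in\mathfrak Z_{\phi_i}$. Let $\widehat{\mathfrak S}^{\boldsymbol\psi}_{\mathrm{pol}}$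 and $\widehat{\mathfrak Z}_{\boldsymbol\phi,\mathrm{pol}}$ be the variants in which only polynomials in $z$ (algebraic direct sums) are allowed. For $r\ge1$ at least the depth of $\boldsymbol\psi$, let $\mathfrak S^{\boldsymbol\psi}=\bigoplus_{i=0}^{r-1}\mathfrak p_{\psi_i}\varepsilon^i\subseteq\mathfrak g_r$ be the finite singularity algebra and $\mathfrak Z_{\boldsymbol\phi}=\bigoplus_{i=0}^{r-1}\mathfrak Z_{\phi_i}\varepsilon^i$. Then: 1. If $\mathfrak p\subseteq\tilde{\mathfrak p}$ are parabolic subalgebras of $\mathfrak g$ with $\mathfrak t\subseteq\mathfrak p$, then $[\mathfrak p,\tilde{\mathfrak p}]=[\tilde{\mathfrak p},\tilde{\mathfrak p}]$. 2. For every parabolic filtration $\boldsymbol\psi$ and every $i\ge0$, $\mathfrak Z_{\phi_i}=\ker(\phi_i)=\{X\in\mathfrak t:\alpha(X)=0\ \text{for all}\ \alpha\in\phi_i\}$. 3. For every parabolic filtration $\boldsymbol\psi$ there are isomorphisms of abelian Lie algebras $$\widehat{\mathfrak S}^{\boldsymbol\psi}_{\mathrm{ab}}\simeq\widehat{\mathfrak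 Z}_{\boldsymbol\phi}\oplus\mathbb CK,\qquad (\widehat{\mathfrak S}^{\boldsymbol\psi}_{\mathrm{pol}})_{\mathrm{ab}}\simeq\widehat{\mathfrak Z}_{\boldsymbol\phi,\mathrm{pol}}\oplus\mathbb CK=\bigoplus_{i\ge0}\mathfrak Z_{\phi_i}z^i\oplus\mathbb CK,$$ and, for every $r\ge1$ at least the depth of $\boldsymbol\psi$, $\mathfrak S^{\boldsymbol\psi}_{\mathrm{ab}}\simeq\mathfrak Z_{\boldsymbol\phi}$. Each of them sends the class of an element of the right-hand side (seen inside the singularity algebra) to that element. 4. Consequently, restriction gives the following bijections. The characters of $\widehat{\mathfrak S}^{\boldsymbol\psi}$ correspond to the linear functionals on $\widehat{\mathfrak Z}_{\boldsymbol\phi}\oplus\mathbb CK$; for $r\ge1$ at least the depth, those that vanish on $z^r\mathfrak g[[z]]$ correspond to the sequences $(\lambda_0,\dots,\lambda_{r-1})\in\prod_{i<r}\mathfrak Z_{\phi_i}^\vee$ together with a level $\kappa\in\mathbb C$ (the value at $K$). The characters of $\widehat{\mathfrak S}^{\boldsymbol\psi}_{\mathrm{pol}}$ correspond to the sequences $(\lambda_i)_{i\ge0}\in\prod_{i\ge0}\mathfrak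 Z_{\phi_i}^\vee$ together with a level $\kappa\in\mathbb C$. The characters of $\mathfrak S^{\boldsymbol\psi}$ correspond to the sequences $(\lambda_0,\dots,\lambda_{r-1})\in\prod_{i<r}\mathfrak Z_{\phi_i}^\vee$. -/

import Mathlib

open scoped TensorProduct LaurentSeries PowerSeries

noncomputable section

namespace SingularityAlgebra

section General

variable {g : Type*} [LieRing g] [LieAlgebra ℂ g]

/-- The abelianisation `S / [S, S]` of a complex Lie algebra. -/
abbrev Abelianization (S : Type*) [LieRing S] [LieAlgebra ℂ S] : Type _ :=
  S ⧸ ⁅(⊤ : LieIdeal ℂ S), (⊤ : LieIdeal ℂ S)⁆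

/-- The canonical projection of a complex Lie algebra onto its abelianisation. -/
def toAb {S : Type*} [LieRing S] [LieAlgebra ℂ S] (x : S) : Abelianization S :=
  LieSubmodule.Quotient.mk x

/-- The subspace `[U, V]` spanned by the brackets of elements of two subspaces. -/
def bracketSpan (U V : Submodule ℂ g) : Submodule ℂ g :=
  Submodule.span ℂ {w | ∃ x ∈ U, ∃ y ∈ V, ⁅x, y⁆ = w}

/-- Borel subalgebras: the maximal solvable Lie subalgebras. -/
def IsBorel (b : LieSubalgebra ℂ g) : Prop :=
  LieAlgebra.IsSolvable b ∧
    ∀ c : LieSubalgebra ℂ g, LieAlgebra.IsSolvable c → b ≤ c → c = b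

/-- Parabolic subalgebras: those containing a Borel subalgebra. -/
def IsParabolicSubalgebra (p : LieSubalgebra ℂ g) : Prop :=
  ∃ b : LieSubalgebra ℂ g, IsBorel b ∧ b ≤ p

/-- A sequence of subspaces of `g` such that `[V i, V j] ⊆ V (i + j)`. -/
def IsMultiplicative (V : ℕ → Submodule ℂ g) : Prop :=
  ∀ i j, ∀ x ∈ V i, ∀ y ∈ V j, ⁅x, y⁆ ∈ V (i + j)

end General

section Roots

variable {g : Type*} [LieRing g] [LieAlgebra ℂ g] (t : LieSubalgebra ℂ g)

/-- `g_α`, the space of all `Y` with `[X, Y] = α(X) Y` for `X ∈ t`. -/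
def rootSpace (α : Module.Dual ℂ t) : Submodule ℂ g where
  carrier := {Y | ∀ X : t, ⁅(X : g), Y⁆ = α X • Y}
  add_mem' := by
    intro a b ha hb X
    rw [lie_add, ha X, hb X, smul_add]
  zero_mem' := by intro X; simp
  smul_mem' := by
    intro c a ha X
    rw [lie_smul, ha X, smul_comm]

/-- The root system `Φ` of `(g, t)`, a subset of the dual of `t`. -/
def roots : Set (Module.Dual ℂ t) := {α | α ≠ 0 ∧ rootSpace t α ≠ ⊥}

/-- `t ⊕ ⨁_{α ∈ S} g_α`. -/
def rootSubspace (S : Set (Module.Dual ℂ t)) : Submodule ℂ g :=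
  t.toSubmodule ⊔ ⨆ α ∈ S, rootSpace t α

/-- Closed sets of roots: a root that is a sum of two elements of `S` lies in `S`. -/
def IsClosedRoots (S : Set (Module.Dual ℂ t)) : Prop :=
  S ⊆ roots t ∧ ∀ α ∈ S, ∀ β ∈ S, α + β ∈ roots t → α + β ∈ S

variable {t}

lemma lie_mem_rootSpace {α β : Module.Dual ℂ t} {x y : g} (hx : x ∈ rootSpace t α)
    (hy : y ∈ rootSpace t β) : ⁅x, y⁆ ∈ rootSpace t (α + β) := by
  intro X
  rw [leibniz_lie, hx X, hy X, smul_lie, lie_smul, LinearMap.add_apply, add_smul]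

lemma rootSpace_zero_le [t.IsCartanSubalgebra] : rootSpace t 0 ≤ t.toSubmodule := by
  intro y hy
  have h : y ∈ t.normalizer := by
    rw [LieSubalgebra.mem_normalizer_iff']
    intro X hX
    have := hy ⟨X, hX⟩
    simp only [LinearMap.zero_apply, zero_smul] at this
    rw [this]
    exact t.zero_mem
  rw [LieSubalgebra.IsCartanSubalgebra.self_normalizing] at h
  exact h

lemma lie_mem_rootSubspace [t.IsCartanSubalgebra] {S : Set (Module.Dual ℂ t)}
    (hS : IsClosedRoots t S) {x y : g} (hx : x ∈ rootSubspace t S)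
    (hy : y ∈ rootSubspace t S) : ⁅x, y⁆ ∈ rootSubspace t S := by
  have ht : t.toSubmodule ≤ rootSubspace t S := le_sup_left
  have hr : ∀ α ∈ S, rootSpace t α ≤ rootSubspace t S := fun α hα =>
    le_trans (le_iSup₂ (f := fun α (_ : α ∈ S) => rootSpace t α) α hα) le_sup_right
  have key : ∀ P : Submodule ℂ g, (t.toSubmodule ≤ P) → (∀ α ∈ S, rootSpace t α ≤ P) →
      rootSubspace t S ≤ P := fun P h1 h2 => sup_le h1 (iSup₂_le h2)
  -- the set of elements that bracket a given subspace into the target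
  let Q : g → Submodule ℂ g := fun a =>
    (rootSubspace t S).comap (LieModule.toEnd ℂ g g a : g →ₗ[ℂ] g)
  have hQ : ∀ a b, b ∈ Q a ↔ ⁅a, b⁆ ∈ rootSubspace t S := fun a b => Iff.rfl
  have swap : ∀ a b : g, ⁅a, b⁆ ∈ rootSubspace t S → ⁅b, a⁆ ∈ rootSubspace t S := by
    intro a b h
    rw [← lie_skew]
    exact neg_mem h
  have h1 : ∀ X ∈ t, rootSubspace t S ≤ Q X := by
    intro X hX
    refine key _ ?_ ?_
    · intro Y hY
      exact ht (t.lie_mem hX hY)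
    · intro α hα Y hY
      rw [hQ, show ⁅X, Y⁆ = _ from hY ⟨X, hX⟩]
      exact Submodule.smul_mem _ _ (hr α hα hY)
  have h2 : ∀ α ∈ S, ∀ X ∈ rootSpace t α, rootSubspace t S ≤ Q X := by
    intro α hα X hX
    refine key _ ?_ ?_
    · intro Y hY
      rw [hQ]
      exact swap _ _ (h1 Y hY (hr α hα hX))
    · intro β hβ Y hY
      rw [hQ]
      have hm := lie_mem_rootSpace hX hY
      by_cases h0 : α + β = 0
      · rw [h0] at hm
        exact ht (rootSpace_zero_le hm)
      · by_cases hb : rootSpace t (α + β) = ⊥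
        · rw [hb, Submodule.mem_bot] at hm
          rw [hm]
          exact zero_mem _
        · exact hr _ (hS.2 α hα β hβ ⟨h0, hb⟩) hm
  have h3 : rootSubspace t S ≤ Q y := by
    refine key _ ?_ ?_
    · intro X hX
      exact swap _ _ (h1 X hX hy)
    · intro α hα X hX
      exact swap _ _ (h2 α hα X hX hy)
  exact swap _ _ (h3 hx)

variable (t) in
/-- The Lie subalgebra `t ⊕ ⨁_{α ∈ S} g_α` attached to a closed set `S` of roots. -/
def rootSubalgebra [t.IsCartanSubalgebra] (S : Set (Module.Dual ℂ t))
    (hS : IsClosedRoots t S) : LieSubalgebra ℂ g where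
  __ := rootSubspace t S
  lie_mem' := fun hx hy => lie_mem_rootSubspace hS hx hy

variable (t) in
/-- Parabolic subsets `ψ` of `Φ`: closed, and such that `ψ ∪ (-ψ) = Φ`. -/
def IsParabolicSubset (ψ : Set (Module.Dual ℂ t)) : Prop :=
  IsClosedRoots t ψ ∧ ψ ∪ {α | -α ∈ ψ} = roots t

/-- The Levi factor `ψ ∩ (-ψ)` of a set of roots. -/
def leviFactor (ψ : Set (Module.Dual ℂ t)) : Set (Module.Dual ℂ t) := ψ ∩ {α | -α ∈ ψ}

lemma isClosedRoots_leviFactor {ψ : Set (Module.Dual ℂ t)} (h : IsParabolicSubset t ψ) :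
    IsClosedRoots t (leviFactor ψ) := by
  refine ⟨fun α hα => h.1.1 hα.1, fun α hα β hβ hab => ⟨h.1.2 α hα.1 β hβ.1 hab, ?_⟩⟩
  have hab' : α + β ∈ ψ := h.1.2 α hα.1 β hβ.1 hab
  have hn : -(α + β) ∈ roots t := by
    -- roots are stable under negation because `ψ` covers `Φ` up to sign
    have : ∀ γ ∈ roots t, -γ ∈ roots t := by
      intro γ hγ
      have hγ' := hγ
      rw [← h.2] at hγ'
      rcases hγ' with h1 | h1
      · rw [← h.2]
        right
        simpa using h1
      · exact h.1.1 h1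
    exact this _ hab
  have e : -α + -β = -(α + β) := by abel
  have := h.1.2 (-α) hα.2 (-β) hβ.2 (by rw [e]; exact hn)
  rw [e] at this
  exact this

variable (t) in
/-- Parabolic filtrations of `Φ`: nondecreasing exhaustive sequences of parabolic subsets. -/
structure ParabolicFiltration where
  /-- the terms of the filtration -/
  term : ℕ → Set (Module.Dual ℂ t)
  parabolic : ∀ i, IsParabolicSubset t (term i)
  mono : ∀ i, term i ⊆ term (i + 1)
  exhaustive : ⋃ i, term i = roots t

namespace ParabolicFiltration

variable (ψ : ParabolicFiltration t)

/-- The depth of `ψ`: the least `r` such that `ψ_i = Φ` for all `i ≥ r`. -/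
def depth : ℕ := sInf {r | ∀ i, r ≤ i → ψ.term i = roots t}

lemma monotone : Monotone ψ.term := monotone_nat_of_le_succ ψ.mono

/-- The parabolic subalgebra `p_{ψ_i} = t ⊕ ⨁_{α ∈ ψ_i} g_α`. -/
def parabolicAt [t.IsCartanSubalgebra] (i : ℕ) : LieSubalgebra ℂ g :=
  rootSubalgebra t (ψ.term i) (ψ.parabolic i).1

/-- The Levi factor `φ_i = ψ_i ∩ (-ψ_i)`. -/
def levi (i : ℕ) : Set (Module.Dual ℂ t) := leviFactor (ψ.term i)

/-- The Levi subalgebra `l_{φ_i} = t ⊕ ⨁_{α ∈ φ_i} g_α`. -/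
def leviAt [t.IsCartanSubalgebra] (i : ℕ) : LieSubalgebra ℂ g :=
  rootSubalgebra t (ψ.levi i) (isClosedRoots_leviFactor (ψ.parabolic i))

/-- The Levi centre `Z_{φ_i}`, the centre of the Lie algebra `l_{φ_i}`, as a subspace of `g`. -/
def leviCentre [t.IsCartanSubalgebra] (i : ℕ) : Submodule ℂ g :=
  (LieAlgebra.center ℂ (ψ.leviAt i)).toSubmodule.map (ψ.leviAt i).toSubmodule.subtype

variable [t.IsCartanSubalgebra]

lemma mem_leviCentre {i : ℕ} {x : g} :
    x ∈ ψ.leviCentre i ↔ x ∈ ψ.leviAt i ∧ ∀ y ∈ ψ.leviAt i, ⁅y, x⁆ = 0 := by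
  constructor
  · rintro ⟨z, hz, rfl⟩
    refine ⟨z.2, fun y hy => ?_⟩
    have := (LieModule.mem_maxTrivSubmodule (R := ℂ) (L := ψ.leviAt i) (M := ψ.leviAt i) z).1 hz
      ⟨y, hy⟩
    exact congrArg Subtype.val this
  · rintro ⟨hx, h⟩
    refine ⟨⟨x, hx⟩, ?_, rfl⟩
    refine (LieModule.mem_maxTrivSubmodule (R := ℂ) (L := ψ.leviAt i) (M := ψ.leviAt i) _).2 ?_
    intro y
    exact Subtype.ext (h y y.2)

lemma le_leviAt (i : ℕ) : t ≤ ψ.leviAt i :=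
  fun _ hx => (le_sup_left : t.toSubmodule ≤ rootSubspace t (ψ.levi i)) hx

lemma leviCentre_le_cartan (i : ℕ) : ψ.leviCentre i ≤ t.toSubmodule := by
  intro x hx
  apply rootSpace_zero_le
  intro X
  rw [(ψ.mem_leviCentre.1 hx).2 X (ψ.le_leviAt i X.2)]
  simp

lemma leviCentre_le_parabolicAt (i : ℕ) : ψ.leviCentre i ≤ (ψ.parabolicAt i).toSubmodule :=
  (ψ.leviCentre_le_cartan i).trans
    (le_sup_left : t.toSubmodule ≤ rootSubspace t (ψ.term i))

lemma parabolicAt_mono {i j : ℕ} (h : i ≤ j) :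
    (ψ.parabolicAt i).toSubmodule ≤ (ψ.parabolicAt j).toSubmodule :=
  sup_le_sup le_rfl (biSup_mono fun _ hα => ψ.monotone h hα)

lemma isMultiplicative_parabolicAt :
    IsMultiplicative fun i => (ψ.parabolicAt i).toSubmodule := by
  intro i j x hx y hy
  exact (ψ.parabolicAt (i + j)).lie_mem (ψ.parabolicAt_mono (Nat.le_add_right i j) hx)
    (ψ.parabolicAt_mono (Nat.le_add_left j i) hy)

lemma isMultiplicative_leviCentre : IsMultiplicative ψ.leviCentre := by
  intro i j x hx y hy
  have h : ⁅x, y⁆ = 0 := (ψ.mem_leviCentre.1 hy).2 x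
    (ψ.le_leviAt j (ψ.leviCentre_le_cartan i hx))
  rw [h]
  exact zero_mem _

end ParabolicFiltration

end Roots

section Affine

/-- The field `ℂ((z))` of formal Laurent series. This is Mathlib's `LaurentSeries ℂ`; the synonym
fixes its `ℂ`-algebra structure (coefficientwise scalar multiplication). -/
def Laurent : Type := ℂ⸨X⸩

namespace Laurent

instance : CommRing Laurent := inferInstanceAs (CommRing ℂ⸨X⸩)

instance : Algebra ℂ Laurent := (HahnSeries.instAlgebra : Algebra ℂ ℂ⸨X⸩)

/-- The coefficient of `z^n`. -/
def coeff (n : ℤ) : Laurent →ₗ[ℂ] ℂ where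
  toFun f := HahnSeries.coeff (show ℂ⸨X⸩ from f) n
  map_add' _ _ := rfl
  map_smul' _ _ := rfl

/-- The derivative with respect to `z`. -/
def deriv : Laurent →ₗ[ℂ] Laurent where
  toFun f := LaurentSeries.derivative ℂ (show ℂ⸨X⸩ from f)
  map_add' f h := (LaurentSeries.derivative ℂ).map_add (show ℂ⸨X⸩ from f) (show ℂ⸨X⸩ from h)
  map_smul' c f := (LaurentSeries.derivative ℂ).map_smul c (show ℂ⸨X⸩ from f)

/-- The monomial `z^n`. -/
def mono (n : ℤ) : Laurent := HahnSeries.single n (1 : ℂ)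

@[ext]
lemma ext {f h : Laurent} (H : ∀ n, coeff n f = coeff n h) : f = h :=
  HahnSeries.ext (funext H)

lemma coeff_mono (m n : ℤ) : coeff m (mono n) = if m = n then 1 else 0 := by
  have h := HahnSeries.coeff_single (R := ℂ) (a := n) (b := m) (r := 1)
  refine Eq.trans h ?_
  split_ifs <;> rfl

lemma coeff_deriv (f : Laurent) (n : ℤ) :
    coeff n (deriv f) = ((n : ℂ) + 1) * coeff (n + 1) f := by
  have h := LaurentSeries.hasseDeriv_coeff (R := ℂ) 1 (show ℂ⸨X⸩ from f) n
  simp only [Nat.cast_one, Ring.choose_one_right, zsmul_eq_mul] at h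
  push_cast at h
  exact h

lemma coeff_bddBelow (f : Laurent) : ∃ N : ℤ, ∀ n < N, coeff n f = 0 :=
  ⟨HahnSeries.order (show ℂ⸨X⸩ from f), fun _ hn => HahnSeries.coeff_eq_zero_of_lt_order hn⟩

lemma finite_support_mul (f h : Laurent) (n : ℤ) :
    (Function.support fun i : ℤ => coeff i f * coeff (n - i) h).Finite := by
  obtain ⟨N, hN⟩ := coeff_bddBelow f
  obtain ⟨M, hM⟩ := coeff_bddBelow h
  refine (Set.finite_Icc N (n - M)).subset fun i hi => ?_
  simp only [Function.mem_support] at hi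
  constructor
  · by_contra hlt
    exact hi (by rw [hN i (not_le.1 hlt), zero_mul])
  · by_contra hlt
    exact hi (by rw [hM (n - i) (by omega), mul_zero])

lemma coeff_mul (f h : Laurent) (n : ℤ) :
    coeff n (f * h) = ∑ᶠ i : ℤ, coeff i f * coeff (n - i) h := by
  rw [finsum_eq_sum_of_support_subset (s := (finite_support_mul f h n).toFinset) _ (by simp)]
  refine (HahnSeries.coeff_mul (x := (show ℂ⸨X⸩ from f)) (y := (show ℂ⸨X⸩ from h))).trans ?_
  refine Finset.sum_bij_ne_zero (fun a _ _ => a.1) ?_ ?_ ?_ ?_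
  · intro a ha hne
    rw [Finset.mem_antidiagonal] at ha
    simp only [Set.Finite.mem_toFinset, Function.mem_support]
    rw [show n - a.1 = a.2 by omega]
    exact hne
  · intro a ha _ b hb _ hab
    rw [Finset.mem_antidiagonal] at ha hb
    exact Prod.ext hab (by omega)
  · intro i _ hne
    refine ⟨(i, n - i), ?_, hne, rfl⟩
    rw [Finset.mem_antidiagonal]
    exact ⟨left_ne_zero_of_mul hne, right_ne_zero_of_mul hne, by omega⟩
  · intro a ha _
    rw [Finset.mem_antidiagonal] at ha
    rw [show n - a.1 = a.2 by omega]
    rfl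

lemma deriv_mul (f h : Laurent) : deriv (f * h) = f * deriv h + h * deriv f := by
  ext n
  rw [mul_comm h, map_add, coeff_deriv, coeff_mul, coeff_mul, coeff_mul,
    ← finsum_comp_equiv (Equiv.subRight (1 : ℤ)) (f := fun i =>
      coeff i (deriv f) * coeff (n - i) h)]
  rw [← finsum_add_distrib (finite_support_mul _ _ _)]
  · rw [mul_finsum' _ _ (finite_support_mul _ _ _)]
    refine finsum_congr fun i => ?_
    simp only [Equiv.subRight_apply, coeff_deriv]
    rw [show n - i + 1 = n + 1 - i by ring, show n - (i - 1) = n + 1 - i by ring,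
      show i - 1 + 1 = i by ring]
    push_cast
    ring
  · exact (finite_support_mul (deriv f) h n).preimage
      (f := fun i : ℤ => i - 1) (fun a _ b _ hab => by simpa using hab)

end Laurent

/-- The bilinear map `(f, f') ↦ Res_{z = 0} (f' df)` on Laurent series. -/
def residuePairing : LinearMap.BilinForm ℂ Laurent :=
  LinearMap.mk₂ ℂ (fun f f' => Laurent.coeff (-1) (f' * Laurent.deriv f))
    (by intro a b c; simp only [map_add, mul_add])
    (by intro c a b; simp only [map_smul, mul_smul_comm])
    (by intro a b c; simp only [map_add, add_mul])
    (by intro c a b; simp only [map_smul, smul_mul_assoc])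

lemma residuePairing_apply (f f' : Laurent) :
    residuePairing f f' = Laurent.coeff (-1) (f' * Laurent.deriv f) := rfl

lemma residuePairing_skew (f f' : Laurent) : residuePairing f f' = -residuePairing f' f := by
  have h : Laurent.coeff (-1) (Laurent.deriv (f * f')) = 0 := by
    rw [Laurent.coeff_deriv]; simp
  rw [Laurent.deriv_mul, map_add] at h
  rw [residuePairing_apply, residuePairing_apply]
  linear_combination h

variable {g : Type*} [LieRing g] [LieAlgebra ℂ g]

variable (g) in
/-- A nondegenerate invariant symmetric bilinear form on `g`. -/
structure InvariantForm where
  /-- the underlying bilinear form -/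
  form : LinearMap.BilinForm ℂ g
  symm : form.IsSymm
  invariant : ∀ x y z : g, form x ⁅y, z⁆ = form ⁅x, y⁆ z
  nondegenerate : form.Nondegenerate

variable (g) in
/-- The formal loop algebra `g((z))`, with bracket `[X ⊗ f, Y ⊗ f'] = [X, Y] ⊗ f f'`
(the series is written on the left). -/
abbrev Loop : Type _ := Laurent ⊗[ℂ] g

open LieModule LieModule.Cohomology

/-- The bilinear form `(X ⊗ f, Y ⊗ f') ↦ (X | Y) Res_{z = 0} (f' df)` on `g((z))`. -/
def loopForm (B : InvariantForm g) : LinearMap.BilinForm ℂ (Loop g) :=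
  LinearMap.BilinForm.tmul residuePairing B.form

lemma loopForm_tmul (B : InvariantForm g) (f f' : Laurent) (x y : g) :
    loopForm B (f ⊗ₜ x) (f' ⊗ₜ y) =
      B.form x y * Laurent.coeff (-1) (f' * Laurent.deriv f) := by
  rw [loopForm, LinearMap.BilinForm.tmul, LinearMap.BilinForm.tensorDistrib_tmul]
  simp [residuePairing_apply]

lemma loopForm_skew (B : InvariantForm g) (u v : Loop g) :
    loopForm B u v = -loopForm B v u := by
  induction u using TensorProduct.induction_on with
  | zero => simp
  | add a b ha hb => rw [map_add, LinearMap.add_apply, map_add, ha, hb]; ring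
  | tmul f x =>
    induction v using TensorProduct.induction_on with
    | zero => simp
    | add a b ha hb => rw [map_add, map_add, LinearMap.add_apply, ha, hb]; ring
    | tmul f' y =>
      have h := residuePairing_skew f f'
      rw [residuePairing_apply, residuePairing_apply] at h
      rw [loopForm_tmul, loopForm_tmul, h, B.symm.eq y x]
      simp

lemma loopForm_cocycle (B : InvariantForm g) (u v w : Loop g) :
    loopForm B u ⁅v, w⁆ = loopForm B ⁅u, v⁆ w + loopForm B v ⁅u, w⁆ := by
  induction u using TensorProduct.induction_on with
  | zero => simp
  | add a b ha hb =>
    simp only [map_add, LinearMap.add_apply, add_lie] at ha hb ⊢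
    rw [ha, hb]; ring
  | tmul f x =>
    induction v using TensorProduct.induction_on with
    | zero => simp
    | add a b ha hb =>
      simp only [map_add, LinearMap.add_apply, add_lie, lie_add] at ha hb ⊢
      rw [ha, hb]; ring
    | tmul f' y =>
      induction w using TensorProduct.induction_on with
      | zero => simp
      | add a b ha hb =>
        simp only [map_add, lie_add] at ha hb ⊢
        rw [ha, hb]; ring
      | tmul f'' z =>
        simp only [LieAlgebra.ExtendScalars.bracket_tmul, loopForm_tmul]
        have h1 : B.form x ⁅y, z⁆ = B.form ⁅x, y⁆ z := B.invariant x y z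
        have h2 : B.form y ⁅x, z⁆ = -B.form ⁅x, y⁆ z := by
          rw [B.invariant y x z, ← lie_skew, map_neg, LinearMap.neg_apply]
        rw [h1, h2, Laurent.deriv_mul]
        have h3 : f'' * (f * Laurent.deriv f' + f' * Laurent.deriv f) =
            f * f'' * Laurent.deriv f' +
              f' * f'' * Laurent.deriv f := by ring
        rw [h3, map_add]
        ring

/-- The 2-cocycle on `g((z))` that defines the affine Lie algebra. -/
def affineCocycle (B : InvariantForm g) :
    twoCocycle ℂ (Loop g) (TrivialLieModule ℂ (Loop g) ℂ) where
  val :=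
    { val := (loopForm B).compr₂ (TrivialLieModule.equiv ℂ (Loop g) ℂ).symm.toLinearMap
      property := by
        intro u
        have h : loopForm B u u = 0 := by
          have := loopForm_skew B u u
          exact self_eq_neg.1 this
        simp [h] }
  property := by
    rw [mem_twoCocycle_iff_of_trivial]
    intro u v w
    change (TrivialLieModule.equiv ℂ (Loop g) ℂ).symm (loopForm B u ⁅v, w⁆) =
      (TrivialLieModule.equiv ℂ (Loop g) ℂ).symm (loopForm B ⁅u, v⁆ w) +
      (TrivialLieModule.equiv ℂ (Loop g) ℂ).symm (loopForm B v ⁅u, w⁆)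
    rw [loopForm_cocycle, map_add]

/-- The affine Lie algebra of `(g, B)`: the central extension of `g((z))` by `ℂ K` with
`[X ⊗ f, Y ⊗ f'] = [X, Y] ⊗ f f' + (X | Y) Res_{z = 0} (f' df) K`. -/
abbrev AffineLieAlgebra (B : InvariantForm g) : Type _ :=
  LieAlgebra.ofTwoCocycle (affineCocycle B)

/-- The element `u + c K` of the affine Lie algebra. -/
def affineMk (B : InvariantForm g) (u : Loop g) (c : ℂ) : AffineLieAlgebra B :=
  LieAlgebra.ofProd _ (u, (TrivialLieModule.equiv ℂ (Loop g) ℂ).symm c)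

/-- The image in `g((z))` of an element of the affine Lie algebra. -/
def loopPart {B : InvariantForm g} (x : AffineLieAlgebra B) : Loop g :=
  ((LieAlgebra.ofProd (affineCocycle B)).symm x).1

lemma lie_affineMk (B : InvariantForm g) (u v : Loop g) (c d : ℂ) :
    ⁅affineMk B u c, affineMk B v d⁆ = affineMk B ⁅u, v⁆ (loopForm B u v) := by
  simp only [affineMk]
  rw [LieAlgebra.bracket_ofTwoCocycle]
  simp only [Equiv.symm_apply_apply, trivial_lie_zero, add_zero, sub_zero]
  rfl

lemma loopPart_lie {B : InvariantForm g} (x y : AffineLieAlgebra B) :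
    loopPart ⁅x, y⁆ = ⁅loopPart x, loopPart y⁆ := rfl

/-- The coefficient of `z^n` of an element of `g((z))`. -/
def loopCoeff (n : ℤ) : Loop g →ₗ[ℂ] g :=
  TensorProduct.lift (LinearMap.mk₂ ℂ (fun (f : Laurent) (x : g) => Laurent.coeff n f • x)
    (by intro a b c; simp [add_smul]) (by intro c a b; simp [smul_smul])
    (by intro a b c; simp) (by intro c a b; exact smul_comm _ _ _))

lemma loopCoeff_tmul (n : ℤ) (f : Laurent) (x : g) :
    loopCoeff n (f ⊗ₜ[ℂ] x) = Laurent.coeff n f • x := rfl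

lemma loopCoeff_bddBelow (u : Loop g) : ∃ N : ℤ, ∀ n < N, loopCoeff n u = 0 := by
  induction u using TensorProduct.induction_on with
  | zero => exact ⟨0, fun n _ => map_zero _⟩
  | add a b ha hb =>
    obtain ⟨N, hN⟩ := ha
    obtain ⟨M, hM⟩ := hb
    refine ⟨min N M, fun n hn => ?_⟩
    rw [map_add, hN n (by omega), hM n (by omega), add_zero]
  | tmul f x =>
    obtain ⟨N, hN⟩ := Laurent.coeff_bddBelow f
    exact ⟨N, fun n hn => by rw [loopCoeff_tmul, hN n hn, zero_smul]⟩

lemma finite_support_lie (u v : Loop g) (n : ℤ) :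
    (Function.support fun i : ℤ => ⁅loopCoeff i u, loopCoeff (n - i) v⁆).Finite := by
  obtain ⟨N, hN⟩ := loopCoeff_bddBelow u
  obtain ⟨M, hM⟩ := loopCoeff_bddBelow v
  refine (Set.finite_Icc N (n - M)).subset fun i hi => ?_
  simp only [Function.mem_support] at hi
  constructor
  · by_contra hlt
    exact hi (by rw [hN i (not_le.1 hlt), zero_lie])
  · by_contra hlt
    exact hi (by rw [hM (n - i) (by omega), lie_zero])

lemma loopCoeff_lie (u v : Loop g) (n : ℤ) :
    loopCoeff n ⁅u, v⁆ = ∑ᶠ i : ℤ, ⁅loopCoeff i u, loopCoeff (n - i) v⁆ := by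
  induction u using TensorProduct.induction_on with
  | zero => simp
  | add a b ha hb =>
    simp only [add_lie, map_add, ha, hb]
    exact (finsum_add_distrib (finite_support_lie a v n) (finite_support_lie b v n)).symm
  | tmul f x =>
    induction v using TensorProduct.induction_on with
    | zero => simp
    | add a b ha hb =>
      simp only [lie_add, map_add, ha, hb]
      exact (finsum_add_distrib (finite_support_lie (f ⊗ₜ x) a n)
        (finite_support_lie (f ⊗ₜ x) b n)).symm
    | tmul f' y =>
      rw [LieAlgebra.ExtendScalars.bracket_tmul, loopCoeff_tmul, Laurent.coeff_mul,
        finsum_smul' (Laurent.finite_support_mul _ _ _)]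
      refine finsum_congr fun i => ?_
      rw [loopCoeff_tmul, loopCoeff_tmul, smul_lie, lie_smul, smul_smul]

/-- For a sequence with `[V i, V j] ⊆ V (i + j)`, the Lie subalgebra of the affine Lie algebra
consisting of all `∑_{i ≥ 0} X_i z^i + c K` with `X_i ∈ V i` (formal power series in `z`). -/
def affineSeries (B : InvariantForm g) (V : ℕ → Submodule ℂ g) (hV : IsMultiplicative V) :
    LieSubalgebra ℂ (AffineLieAlgebra B) where
  carrier := {x | (∀ n < (0 : ℤ), loopCoeff n (loopPart x) = 0) ∧
    ∀ i : ℕ, loopCoeff (i : ℤ) (loopPart x) ∈ V i}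
  add_mem' := by
    rintro a b ⟨ha, ha'⟩ ⟨hb, hb'⟩
    have e : loopPart (a + b) = loopPart a + loopPart b := rfl
    refine ⟨fun n hn => ?_, fun i => ?_⟩
    · rw [e, map_add, ha n hn, hb n hn, add_zero]
    · rw [e, map_add]
      exact add_mem (ha' i) (hb' i)
  zero_mem' := by
    have e : loopPart (0 : AffineLieAlgebra B) = 0 := rfl
    refine ⟨fun n hn => ?_, fun i => ?_⟩
    · rw [e, map_zero]
    · rw [e, map_zero]
      exact zero_mem _
  smul_mem' := by
    rintro c a ⟨ha, ha'⟩
    have e : loopPart (c • a) = c • loopPart a := rfl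
    refine ⟨fun n hn => ?_, fun i => ?_⟩
    · rw [e, map_smul, ha n hn, smul_zero]
    · rw [e, map_smul]
      exact Submodule.smul_mem _ _ (ha' i)
  lie_mem' := by
    rintro a b ⟨ha, ha'⟩ ⟨hb, hb'⟩
    refine ⟨fun n hn => ?_, fun n => ?_⟩
    · rw [loopPart_lie, loopCoeff_lie]
      refine (finsum_congr fun i => ?_).trans finsum_zero
      by_cases hi : i < 0
      · rw [ha i hi, zero_lie]
      · rw [hb (n - i) (by omega), lie_zero]
    · rw [loopPart_lie, loopCoeff_lie]
      refine finsum_induction (fun x => x ∈ V n) (zero_mem _)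
        (fun _ _ => add_mem) fun i => ?_
      by_cases hi : i < 0
      · rw [ha i hi, zero_lie]
        exact zero_mem _
      by_cases hj : (n : ℤ) - i < 0
      · rw [hb _ hj, lie_zero]
        exact zero_mem _
      obtain ⟨k, rfl⟩ := Int.eq_ofNat_of_zero_le (not_lt.1 hi)
      obtain ⟨l, hl⟩ := Int.eq_ofNat_of_zero_le (not_lt.1 hj)
      have hn : n = k + l := by omega
      rw [hl, hn]
      exact hV k l _ (ha' k) _ (hb' l)

/-- For a sequence with `[V i, V j] ⊆ V (i + j)`, the Lie subalgebra of the affine Lie algebra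
consisting of all finite sums `∑_{i ≥ 0} X_i z^i + c K` with `X_i ∈ V i` (polynomials in `z`). -/
def affinePoly (B : InvariantForm g) (V : ℕ → Submodule ℂ g) (hV : IsMultiplicative V) :
    LieSubalgebra ℂ (AffineLieAlgebra B) where
  carrier := {x | x ∈ affineSeries B V hV ∧
    ∃ N : ℤ, ∀ n, N ≤ n → loopCoeff n (loopPart x) = 0}
  add_mem' := by
    rintro a b ⟨ha, N, hN⟩ ⟨hb, M, hM⟩
    have e : loopPart (a + b) = loopPart a + loopPart b := rfl
    refine ⟨add_mem ha hb, max N M, fun n hn => ?_⟩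
    rw [e, map_add, hN n (by omega), hM n (by omega), add_zero]
  zero_mem' := by
    have e : loopPart (0 : AffineLieAlgebra B) = 0 := rfl
    exact ⟨zero_mem _, 0, fun n _ => by rw [e, map_zero]⟩
  smul_mem' := by
    rintro c a ⟨ha, N, hN⟩
    have e : loopPart (c • a) = c • loopPart a := rfl
    refine ⟨(affineSeries B V hV).toSubmodule.smul_mem c ha, N, fun n hn => ?_⟩
    rw [e, map_smul, hN n hn, smul_zero]
  lie_mem' := by
    rintro a b ⟨ha, N, hN⟩ ⟨hb, M, hM⟩
    refine ⟨(affineSeries B V hV).lie_mem ha hb, N + M, fun n hn => ?_⟩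
    rw [loopPart_lie, loopCoeff_lie]
    refine (finsum_congr fun i => ?_).trans finsum_zero
    by_cases hi : N ≤ i
    · rw [hN i hi, zero_lie]
    · rw [hM (n - i) (by omega), lie_zero]

/-- The element `X z^i` of the affine Lie algebra. -/
def affineMono (B : InvariantForm g) (i : ℕ) (x : g) : AffineLieAlgebra B :=
  affineMk B (Laurent.mono i ⊗ₜ[ℂ] x) 0

/-- The central element `K`. -/
def affineK (B : InvariantForm g) : AffineLieAlgebra B := affineMk B 0 1

variable {B : InvariantForm g} {V W : ℕ → Submodule ℂ g} {hV : IsMultiplicative V}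
  {hW : IsMultiplicative W}

lemma affinePoly_le_affineSeries : affinePoly B V hV ≤ affineSeries B V hV := fun _ h => h.1

lemma affineSeries_mono (h : ∀ i, V i ≤ W i) : affineSeries B V hV ≤ affineSeries B W hW :=
  fun _ hx => ⟨hx.1, fun i => h i (hx.2 i)⟩

lemma affinePoly_mono (h : ∀ i, V i ≤ W i) : affinePoly B V hV ≤ affinePoly B W hW :=
  fun _ hx => ⟨affineSeries_mono h hx.1, hx.2⟩

lemma loopCoeff_single (i : ℕ) (x : g) (n : ℤ) :
    loopCoeff n (Laurent.mono i ⊗ₜ[ℂ] x) = if n = i then x else 0 := by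
  rw [loopCoeff_tmul, Laurent.coeff_mono]
  split_ifs <;> simp

lemma affineMono_mem_affinePoly {i : ℕ} {x : g} (hx : x ∈ V i) :
    affineMono B i x ∈ affinePoly B V hV := by
  have e : loopPart (affineMono B i x) = Laurent.mono i ⊗ₜ[ℂ] x := rfl
  refine ⟨⟨fun n hn => ?_, fun j => ?_⟩, i + 1, fun n hn => ?_⟩
  · rw [e, loopCoeff_single, if_neg (by omega)]
  · rw [e, loopCoeff_single]
    split_ifs with h
    · obtain rfl : j = i := by exact_mod_cast h
      exact hx
    · exact zero_mem _
  · rw [e, loopCoeff_single, if_neg (by omega)]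

lemma affineMono_mem_affineSeries {i : ℕ} {x : g} (hx : x ∈ V i) :
    affineMono B i x ∈ affineSeries B V hV := (affineMono_mem_affinePoly (hV := hV) hx).1

lemma affineK_mem_affinePoly : affineK B ∈ affinePoly B V hV := by
  have e : loopPart (affineK B) = 0 := rfl
  refine ⟨⟨fun n _ => ?_, fun j => ?_⟩, 0, fun n _ => ?_⟩
  · rw [e, map_zero]
  · rw [e, map_zero]
    exact zero_mem _
  · rw [e, map_zero]

lemma affineK_mem_affineSeries : affineK B ∈ affineSeries B V hV :=
  (affineK_mem_affinePoly (hV := hV)).1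

end Affine

section Truncated

/-- The truncated polynomial algebra `ℂ_r = ℂ[[z]] / z^r ℂ[[z]]`. -/
def TruncatedRing (r : ℕ) : Type := ℂ⟦X⟧ ⧸ Ideal.span {(PowerSeries.X : ℂ⟦X⟧) ^ r}

instance (r : ℕ) : CommRing (TruncatedRing r) :=
  inferInstanceAs (CommRing (ℂ⟦X⟧ ⧸ Ideal.span {(PowerSeries.X : ℂ⟦X⟧) ^ r}))

instance (r : ℕ) : Algebra ℂ (TruncatedRing r) :=
  inferInstanceAs (Algebra ℂ (ℂ⟦X⟧ ⧸ Ideal.span {(PowerSeries.X : ℂ⟦X⟧) ^ r}))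

/-- The quotient map `ℂ[[z]] → ℂ_r`. -/
def truncate (r : ℕ) : ℂ⟦X⟧ →ₐ[ℂ] TruncatedRing r :=
  Ideal.Quotient.mkₐ ℂ (Ideal.span {(PowerSeries.X : ℂ⟦X⟧) ^ r})

/-- The class `ε` of `z` in `ℂ_r`. -/
def eps (r : ℕ) : TruncatedRing r := truncate r PowerSeries.X

lemma eps_pow_eq_zero {r n : ℕ} (h : r ≤ n) : eps r ^ n = 0 := by
  rw [eps, ← map_pow]
  exact Ideal.Quotient.eq_zero_iff_mem.2 (Ideal.mem_span_singleton.2 (pow_dvd_pow _ h))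

variable (g : Type*) [LieRing g] [LieAlgebra ℂ g]

/-- The truncated current Lie algebra `g_r = g ⊗ ℂ_r` (the scalar is written on the left). -/
abbrev TruncatedCurrent (r : ℕ) : Type _ := TruncatedRing r ⊗[ℂ] g

variable {g}

/-- The linear map `X ↦ X ε^i`. -/
def truncMono (r i : ℕ) : g →ₗ[ℂ] TruncatedCurrent g r :=
  TensorProduct.mk ℂ (TruncatedRing r) g (eps r ^ i)

lemma lie_truncMono (r i j : ℕ) (x y : g) :
    ⁅truncMono r i x, truncMono r j y⁆ = truncMono r (i + j) ⁅x, y⁆ := by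
  simp [truncMono, pow_add]

/-- For a sequence with `[V i, V j] ⊆ V (i + j)`, the Lie subalgebra
`⨁_{0 ≤ i < r} V_i ε^i` of `g_r`. -/
def truncSum (r : ℕ) (V : ℕ → Submodule ℂ g) (hV : IsMultiplicative V) :
    LieSubalgebra ℂ (TruncatedCurrent g r) where
  __ := ⨆ i : Fin r, (V i).map (truncMono r (i : ℕ))
  lie_mem' := by
    intro a b ha hb
    have hm : ∀ (n : ℕ) (x : g), x ∈ V n →
        truncMono r n x ∈ ⨆ i : Fin r, (V i).map (truncMono r (i : ℕ)) := by
      intro n x hx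
      by_cases h : n < r
      · exact Submodule.mem_iSup_of_mem (⟨n, h⟩ : Fin r) ⟨x, hx, rfl⟩
      · have : truncMono r n x = 0 := by
          simp [truncMono, eps_pow_eq_zero (not_lt.1 h)]
        rw [this]
        exact zero_mem _
    change a ∈ ⨆ i : Fin r, (V i).map (truncMono r (i : ℕ)) at ha
    change b ∈ ⨆ i : Fin r, (V i).map (truncMono r (i : ℕ)) at hb
    change ⁅a, b⁆ ∈ ⨆ i : Fin r, (V i).map (truncMono r (i : ℕ))
    induction ha using Submodule.iSup_induction' with
    | zero => rw [zero_lie]; exact zero_mem _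
    | add x y _ _ hx hy => rw [add_lie]; exact add_mem hx hy
    | mem i x hx =>
      induction hb using Submodule.iSup_induction' with
      | zero => rw [lie_zero]; exact zero_mem _
      | add x y _ _ hx hy => rw [lie_add]; exact add_mem hx hy
      | mem j y hy =>
        obtain ⟨x, hx, rfl⟩ := hx
        obtain ⟨y, hy, rfl⟩ := hy
        rw [lie_truncMono]
        exact hm _ _ (hV i j x hx y hy)

variable {r : ℕ} {V W : ℕ → Submodule ℂ g} {hV : IsMultiplicative V} {hW : IsMultiplicative W}

lemma truncMono_mem_truncSum (i : Fin r) {x : g} (hx : x ∈ V i) :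
    truncMono r i x ∈ truncSum r V hV := by
  change truncMono r (i : ℕ) x ∈ ⨆ i : Fin r, (V i).map (truncMono r (i : ℕ))
  exact Submodule.mem_iSup_of_mem i ⟨x, hx, rfl⟩

lemma truncSum_mono (h : ∀ i, V i ≤ W i) : truncSum r V hV ≤ truncSum r W hW := by
  intro x hx
  have : (⨆ i : Fin r, (V i).map (truncMono r (i : ℕ))) ≤
      ⨆ i : Fin r, (W i).map (truncMono r (i : ℕ)) :=
    iSup_mono fun i => Submodule.map_mono (h i)
  exact this hx

end Truncated

namespace ParabolicFiltration

variable {g : Type*} [LieRing g] [LieAlgebra ℂ g] {t : LieSubalgebra ℂ g}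
  [t.IsCartanSubalgebra] (ψ : ParabolicFiltration t) (B : InvariantForm g)

/-- The affine singularity algebra of polarisation `ψ`: all `∑_{i ≥ 0} X_i z^i + c K` with
`X_i ∈ p_{ψ_i}`, where the sum is a formal power series. -/
def affineSingularityAlgebra : LieSubalgebra ℂ (AffineLieAlgebra B) :=
  affineSeries B (fun i => (ψ.parabolicAt i).toSubmodule) ψ.isMultiplicative_parabolicAt

/-- The Lie algebra of all `∑_{i ≥ 0} X_i z^i + c K` with `X_i ∈ Z_{φ_i}`, where the sum is a
formal power series. -/
def affineLeviCentre : LieSubalgebra ℂ (AffineLieAlgebra B) :=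
  affineSeries B ψ.leviCentre ψ.isMultiplicative_leviCentre

/-- The variant of the affine singularity algebra made of polynomials in `z`. -/
def affineSingularityAlgebraPoly : LieSubalgebra ℂ (AffineLieAlgebra B) :=
  affinePoly B (fun i => (ψ.parabolicAt i).toSubmodule) ψ.isMultiplicative_parabolicAt

/-- The variant of `affineLeviCentre` made of polynomials in `z`. -/
def affineLeviCentrePoly : LieSubalgebra ℂ (AffineLieAlgebra B) :=
  affinePoly B ψ.leviCentre ψ.isMultiplicative_leviCentre

/-- The finite singularity algebra `⨁_{0 ≤ i < r} p_{ψ_i} ε^i`. -/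
def finiteSingularityAlgebra (r : ℕ) : LieSubalgebra ℂ (TruncatedCurrent g r) :=
  truncSum r (fun i => (ψ.parabolicAt i).toSubmodule) ψ.isMultiplicative_parabolicAt

/-- The Lie algebra `⨁_{0 ≤ i < r} Z_{φ_i} ε^i`. -/
def finiteLeviCentre (r : ℕ) : LieSubalgebra ℂ (TruncatedCurrent g r) :=
  truncSum r ψ.leviCentre ψ.isMultiplicative_leviCentre

lemma affineLeviCentre_le : ψ.affineLeviCentre B ≤ ψ.affineSingularityAlgebra B :=
  affineSeries_mono ψ.leviCentre_le_parabolicAt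

lemma affineLeviCentrePoly_le :
    ψ.affineLeviCentrePoly B ≤ ψ.affineSingularityAlgebraPoly B :=
  affinePoly_mono ψ.leviCentre_le_parabolicAt

lemma finiteLeviCentre_le (r : ℕ) : ψ.finiteLeviCentre r ≤ ψ.finiteSingularityAlgebra r :=
  truncSum_mono ψ.leviCentre_le_parabolicAt

/-- `X z^i`, for `X ∈ Z_{φ_i}`, as an element of the affine singularity algebra. -/
def affineCentral (i : ℕ) (x : ψ.leviCentre i) : ψ.affineSingularityAlgebra B :=
  ⟨affineMono B i x, affineMono_mem_affineSeries (ψ.leviCentre_le_parabolicAt i x.2)⟩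

/-- `K` as an element of the affine singularity algebra. -/
def centralK : ψ.affineSingularityAlgebra B := ⟨affineK B, affineK_mem_affineSeries⟩

/-- `X z^i`, for `X ∈ Z_{φ_i}`, as an element of the polynomial variant. -/
def affineCentralPoly (i : ℕ) (x : ψ.leviCentre i) : ψ.affineSingularityAlgebraPoly B :=
  ⟨affineMono B i x, affineMono_mem_affinePoly (ψ.leviCentre_le_parabolicAt i x.2)⟩

/-- `K` as an element of the polynomial variant. -/
def centralKPoly : ψ.affineSingularityAlgebraPoly B := ⟨affineK B, affineK_mem_affinePoly⟩

/-- `X ε^i`, for `X ∈ Z_{φ_i}`, as an element of the finite singularity algebra. -/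
def finiteCentral (r : ℕ) (i : Fin r) (x : ψ.leviCentre i) : ψ.finiteSingularityAlgebra r :=
  ⟨truncMono r i x, truncMono_mem_truncSum i (ψ.leviCentre_le_parabolicAt i x.2)⟩

/-- A character of the affine singularity algebra that vanishes on `z^r g[[z]]`, i.e. on all of
its elements whose component along `K` is zero and whose coefficients of `z^n` are zero for
`n < r`. -/
def VanishesFrom (r : ℕ)
    (χ : LieAlgebra.LieCharacter ℂ (ψ.affineSingularityAlgebra B)) : Prop :=
  ∀ x : ψ.affineSingularityAlgebra B, ∀ u : Loop g, (x : AffineLieAlgebra B) = affineMk B u 0 →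
    (∀ n < (r : ℤ), loopCoeff n u = 0) → χ x = 0

end ParabolicFiltration

end SingularityAlgebra

end

open scoped TensorProduct LaurentSeries PowerSeries

noncomputable section

namespace SingularityAlgebra

/-! ### Reductive Lie algebras and their quotient by the centre -/

section Reductive

open LieAlgebra LieModule

section

variable {g : Type*} [LieRing g] [LieAlgebra ℂ g]

/-! Write `p_i` for the parabolic subalgebra attached to `ψ_i`, and `Z_i` for the common kernel in
`t` of the Levi factor `φ_i`. Everything rests on a linear projection `q_i` of `g` onto `Z_i`, taken
along the root spaces and the brackets `[g_α, g_{-α}]` with `α ∈ φ_i`. It has two properties.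

(a) `q_i` kills `[p_i, p_i]` (`leviProj_lie`). A bracket of vectors of weights `α` and `β` in `ψ_i`
has weight `α + β`. If `α + β ≠ 0`, it is killed. Otherwise `α` and `-α` both lie in `ψ_i`, so `α ∈
φ_i` and the bracket is killed again.

(b) An element of `p_i` killed by `q_i` lies in `[p_0, p_i]` (`sub_leviProj_mem_bracketSpan`). A
root vector is a multiple of its bracket with an element of `t`. For `α ∈ φ_i`, a bracket `[e, f]`
with `e ∈ g_α` and `f ∈ g_{-α}` has `e` or `f` in `p_0`, because `ψ_0` contains `α` or `-α`.

Apply `q_i` coefficientwise to a singularity algebra. By (a) and monotonicity of the filtration, the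
result kills all brackets. By (b), its kernel consists of sums of brackets whose first entry is
constant in `z`. For power series a single finite sum of brackets has to serve infinitely many
coefficients. Expanding along a fixed basis `a_j` of `p_0` makes this possible: the kernel element
becomes `∑_j [a_j, Y_j]` with series `Y_j`. The cocycle vanishes on series without polar part, so
`K` survives in the abelianisation. Characters are then the linear functionals on the image of the
retraction.

The existence of `q_i` amounts to the splitting of `t` in `isCompl_commonKer`. All weights are real
on suitably normalised generators of `[g_α, g_{-α}]`, so for `u` in their span, with conjugate `v`,
the Killing form gives `κ(v, u) = ∑ dim · |χ(u)|²`. This positivity shows that the span of the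
brackets and the common kernel generate `t` and meet only inside the centre. The Killing form does
not see the centre; there the nondegenerate form `B` is needed, for which the centre is orthogonal
to `[g, g]`.

The equality `[p, q] = [q, q]` for abstract parabolic subalgebras follows the pattern of (b). It
requires that a parabolic subalgebra containing `t` contain `g_α` or `g_{-α}` for each root. This
holds because a Borel subalgebra contains its Killing orthogonal (`mem_of_isBorel`), a consequence
of Lie's theorem and Cartan's criterion. -/

lemma mem_center_iff {x : g} : x ∈ center ℂ g ↔ ∀ y : g, ⁅y, x⁆ = 0 :=
  LieModule.mem_maxTrivSubmodule ℂ g g x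

variable (t : LieSubalgebra ℂ g) [t.IsCartanSubalgebra]

lemma center_le_cartan {x : g} (hx : x ∈ center ℂ g) : x ∈ t := by
  have h : x ∈ t.normalizer := by
    rw [LieSubalgebra.mem_normalizer_iff']
    intro y _
    rw [mem_center_iff.1 hx]
    exact t.zero_mem
  rwa [LieSubalgebra.IsCartanSubalgebra.self_normalizing] at h

/-- The projection onto the quotient by the centre. -/
def centerQuotient (g : Type*) [LieRing g] [LieAlgebra ℂ g] : g →ₗ⁅ℂ⁆ g ⧸ center ℂ g where
  __ := LieSubmodule.Quotient.mk' (center ℂ g)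
  map_lie' := fun {x y} => LieSubmodule.Quotient.mk_bracket (center ℂ g) x y

lemma centerQuotient_eq_zero {x : g} : centerQuotient g x = 0 ↔ x ∈ center ℂ g :=
  LieSubmodule.Quotient.mk_eq_zero'

lemma centerQuotient_surjective : Function.Surjective (centerQuotient g) :=
  LieSubmodule.Quotient.surjective_mk' _

/-- The image of a Cartan subalgebra in the quotient by the centre. -/
abbrev cartanImage : LieSubalgebra ℂ (g ⧸ center ℂ g) := t.map (centerQuotient g)

lemma mem_of_centerQuotient_mem {x : g} (h : centerQuotient g x ∈ cartanImage t) : x ∈ t := by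
  obtain ⟨y, hy, e⟩ := h
  have : x - y ∈ center ℂ g := by
    rw [← centerQuotient_eq_zero, map_sub, sub_eq_zero]
    exact e.symm
  simpa using t.add_mem (center_le_cartan t this) hy

instance isCartanSubalgebra_cartanImage : (cartanImage t).IsCartanSubalgebra where
  nilpotent := by
    let f : t →ₗ⁅ℂ⁆ cartanImage t :=
      { toFun := fun x => ⟨centerQuotient g x, x, x.2, rfl⟩
        map_add' := fun x y => Subtype.ext (map_add (centerQuotient g) (x : g) y)
        map_smul' := fun c x => Subtype.ext (map_smul (centerQuotient g) c (x : g))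
        map_lie' := fun {x y} => Subtype.ext (LieHom.map_lie (centerQuotient g) (x : g) y) }
    have hf : Function.Surjective f := by
      rintro ⟨_, x, hx, rfl⟩
      exact ⟨⟨x, hx⟩, rfl⟩
    exact hf.lieAlgebra_isNilpotent
  self_normalizing := by
    refine le_antisymm (fun x hx => ?_) (LieSubalgebra.le_normalizer _)
    obtain ⟨x, rfl⟩ := centerQuotient_surjective x
    have hx' : x ∈ t.normalizer := by
      rw [LieSubalgebra.mem_normalizer_iff']
      intro y hy
      apply mem_of_centerQuotient_mem
      rw [LieHom.map_lie]
      exact (LieSubalgebra.mem_normalizer_iff' _ _).1 hx _ ⟨y, hy, rfl⟩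
    rw [LieSubalgebra.IsCartanSubalgebra.self_normalizing] at hx'
    exact ⟨x, hx', rfl⟩

end

variable {g : Type*} [LieRing g] [LieAlgebra ℂ g] [FiniteDimensional ℂ g]
  [HasCentralRadical ℂ g]

/-- The quotient of a reductive Lie algebra by its centre is semisimple. -/
lemma hasTrivialRadical_quotient_center : HasTrivialRadical ℂ (g ⧸ center ℂ g) := by
  rw [hasTrivialRadical_iff_no_abelian_ideals]
  intro I hI
  have hIZ : ∀ x y : g, LieSubmodule.Quotient.mk x ∈ I → LieSubmodule.Quotient.mk y ∈ I →
      ⁅x, y⁆ ∈ center ℂ g := by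
    intro x y hx hy
    rw [← LieSubmodule.Quotient.mk_eq_zero', LieSubmodule.Quotient.mk_bracket]
    have h := hI.trivial ⟨_, hx⟩ ⟨_, hy⟩
    exact congrArg Subtype.val h
  let J : LieIdeal ℂ g :=
    { carrier := {x | (LieSubmodule.Quotient.mk x : g ⧸ center ℂ g) ∈ I}
      add_mem' := fun {a b} ha hb => I.add_mem ha hb
      zero_mem' := I.zero_mem
      smul_mem' := fun c x hx => I.smul_mem c hx
      lie_mem := fun {x m} hm => by
        change LieSubmodule.Quotient.mk ⁅x, m⁆ ∈ I
        rw [LieSubmodule.Quotient.mk_bracket]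
        exact I.lie_mem hm }
  -- The ideal `[J, J]` is central, so `[[J, J], [J, J]] = 0`; hence the derived length 2.
  have hJ : IsSolvable J := by
    refine IsSolvable.mk (R := ℂ) (k := 2) ((LieIdeal.derivedSeries_eq_bot_iff J 2).2 ?_)
    rw [derivedSeriesOfIdeal_succ, derivedSeriesOfIdeal_succ, derivedSeriesOfIdeal_zero]
    have h1 : ⁅J, J⁆ ≤ center ℂ g := (LieSubmodule.lie_le_iff _ _ _).2 fun x hx y hy => hIZ x y hx hy
    rw [LieSubmodule.lie_eq_bot_iff]
    intro x _ y hy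
    exact (LieModule.mem_maxTrivSubmodule ℂ g g y).1 (h1 hy) x
  have hle : J ≤ center ℂ g := by
    rw [← radical_eq_center]
    exact (LieIdeal.solvable_iff_le_radical ℂ g J).1 hJ
  rw [LieSubmodule.eq_bot_iff]
  intro x hx
  obtain ⟨x, rfl⟩ := LieSubmodule.Quotient.surjective_mk' _ x
  exact (LieSubmodule.Quotient.mk_eq_zero').2 (hle hx)

/-- The kernel of the Killing form of a reductive Lie algebra is its centre. -/
lemma mem_center_of_killingForm_eq_zero {x : g} (h : ∀ y, killingForm ℂ g x y = 0) :
    x ∈ center ℂ g := by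
  rw [← radical_eq_center]
  refine killingCompl_top_le_radical ℂ g ((LieIdeal.mem_killingCompl ℂ g ⊤).2 fun y _ => ?_)
  rw [traceForm_comm]
  exact h y

variable {t : LieSubalgebra ℂ g} [t.IsCartanSubalgebra]

/-- Nonzero generalised weight spaces are genuine ones. The defect `w = [h, y] - α(h) y` keeps the
weight `α`. It dies modulo the centre, where the Cartan subalgebra acts semisimply. So `w` is
central, hence in `t`, which is the generalised weight space of `0`, and the two weight spaces are
disjoint. -/
lemma lie_eq_smul_of_mem_genWeightSpace {α : t → ℂ} (hα : α ≠ 0) {y : g}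
    (hy : y ∈ genWeightSpace g α) (h : t) : ⁅(h : g), y⁆ = α h • y := by
  have _i := hasTrivialRadical_quotient_center (g := g)
  set w : g := ⁅(h : g), y⁆ - α h • y with hw
  have hwα : w ∈ genWeightSpace g α :=
    sub_mem (LieSubmodule.lie_mem _ (x := h) hy) (SMulMemClass.smul_mem _ hy)
  have hπ : centerQuotient g w = 0 := by
    have h1 : y ∈ (ad ℂ g (h : g)).maxGenEigenspace (α h) :=
      genWeightSpace_le_genWeightSpaceOf g h α hy
    have hss : (ad ℂ (g ⧸ center ℂ g) (centerQuotient g h)).IsSemisimple :=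
      IsKilling.isSemisimple_ad_of_mem_isCartanSubalgebra (H := cartanImage t) ⟨h, h.2, rfl⟩
    have h2 : centerQuotient g y ∈
        (ad ℂ (g ⧸ center ℂ g) (centerQuotient g h)).maxGenEigenspace (α h) := by
      rw [Module.End.mem_maxGenEigenspace] at h1 ⊢
      obtain ⟨k, hk⟩ := h1
      refine ⟨k, ?_⟩
      have key : ∀ (k : ℕ) (v : g), centerQuotient g (((ad ℂ g (h : g) - α h • 1) ^ k) v) =
          ((ad ℂ (g ⧸ center ℂ g) (centerQuotient g h) - α h • 1) ^ k) (centerQuotient g v) := by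
        intro k
        induction k with
        | zero => intro v; simp
        | succ k ih => intro v; rw [pow_succ, pow_succ, Module.End.mul_apply, ih]; simp
      rw [← key, hk, map_zero]
    rw [hss.isFinitelySemisimple.maxGenEigenspace_eq_eigenspace,
      Module.End.mem_eigenspace_iff, ad_apply] at h2
    rw [hw, map_sub, map_smul, LieHom.map_lie, h2, sub_self]
  have hw0 : w ∈ genWeightSpace g (0 : t → ℂ) := by
    have : w ∈ LieAlgebra.rootSpace t (0 : t → ℂ) := by
      rw [rootSpace_zero_eq]
      exact center_le_cartan t (centerQuotient_eq_zero.1 hπ)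
    exact this
  have hd := disjoint_genWeightSpace ℂ t g hα
  have : w = 0 := by
    have := hd.le_bot ⟨hwα, hw0⟩
    simpa using this
  exact sub_eq_zero.1 this

end Reductive

/-! ### Root spaces of a reductive Lie algebra -/

section RootSpaces

set_option linter.unusedSectionVars false

open LieAlgebra LieModule

variable {g : Type*} [LieRing g] [LieAlgebra ℂ g] {t : LieSubalgebra ℂ g}

lemma eq_zero_of_mem_center_of_mem_rootSpace {α : Module.Dual ℂ t} (hα : α ≠ 0) {x : g}
    (hx : x ∈ center ℂ g) (hxα : x ∈ rootSpace t α) : x = 0 := by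
  obtain ⟨h, hh⟩ : ∃ h, α h ≠ 0 := by
    by_contra! hc
    exact hα (LinearMap.ext hc)
  have := hxα h
  rw [mem_center_iff.1 hx] at this
  exact (smul_eq_zero.1 this.symm).resolve_left hh

variable [FiniteDimensional ℂ g] [HasCentralRadical ℂ g] [t.IsCartanSubalgebra]

lemma mem_rootSpace_iff {α : Module.Dual ℂ t} (hα : α ≠ 0) {y : g} :
    y ∈ rootSpace t α ↔ y ∈ genWeightSpace g α := by
  constructor
  · intro hy
    exact weightSpace_le_genWeightSpace g α ((mem_weightSpace (χ := (α : t → ℂ)) (m := y)).2 fun h => hy h)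
  · intro hy h
    refine lie_eq_smul_of_mem_genWeightSpace (fun h0 => hα ?_) hy h
    exact LinearMap.ext fun x => congrFun h0 x

lemma mem_cartan_iff {y : g} : y ∈ t ↔ y ∈ genWeightSpace g (0 : t → ℂ) := by
  have := rootSpace_zero_eq ℂ g t
  have h2 : y ∈ LieAlgebra.rootSpace t (0 : t → ℂ) ↔ y ∈ t.toLieSubmodule := by rw [this]
  exact h2.symm

/-- Root spaces are at most one-dimensional. -/
lemma exists_smul_eq_of_mem_rootSpace {α : Module.Dual ℂ t} (hα : α ≠ 0) {x y : g}
    (hx : x ∈ rootSpace t α) (hx0 : x ≠ 0) (hy : y ∈ rootSpace t α) : ∃ c : ℂ, y = c • x := by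
  have _i := hasTrivialRadical_quotient_center (g := g)
  -- A central `h` kills `x` and also multiplies it by `α(h)`, so `α` vanishes on the centre and
  -- descends to the image of `t`.
  have hker : ∀ h h' : t, centerQuotient g h = centerQuotient g h' → α h = α h' := by
    intro h h' e
    have hz : ((h - h' : t) : g) ∈ center ℂ g := by
      rw [← centerQuotient_eq_zero, AddSubgroupClass.coe_sub, map_sub, e, sub_self]
    have h1 := hx (h - h')
    rw [← lie_skew, mem_center_iff.1 hz, neg_zero] at h1
    have := (smul_eq_zero.1 h1.symm).resolve_right hx0
    rwa [map_sub, sub_eq_zero] at this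
  -- The value does not depend on the chosen lift, by `hker`. A bare function is enough, since
  -- generalised weight spaces are indexed by functions.
  let α' : cartanImage t → ℂ := fun H => α ⟨H.2.choose, H.2.choose_spec.1⟩
  have hα' : ∀ (h : t) (H : cartanImage t), (H : g ⧸ center ℂ g) = centerQuotient g h →
      α' H = α h := by
    intro h H e
    refine hker _ _ ?_
    exact H.2.choose_spec.2.trans e
  have hmem : ∀ v ∈ rootSpace t α, centerQuotient g v ∈ genWeightSpace (g ⧸ center ℂ g) α' := by
    intro v hv
    refine weightSpace_le_genWeightSpace _ α' ((mem_weightSpace (χ := α') (m := centerQuotient g v)).2 fun H => ?_)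
    obtain ⟨H, h, hh, rfl⟩ := H
    rw [hα' ⟨h, hh⟩ _ rfl]
    change ⁅centerQuotient g h, centerQuotient g v⁆ = _
    rw [← LieHom.map_lie, ← map_smul]
    exact congrArg _ (hv ⟨h, hh⟩)
  have hx1 : centerQuotient g x ≠ 0 := fun h =>
    hx0 (eq_zero_of_mem_center_of_mem_rootSpace hα (centerQuotient_eq_zero.1 h) hx)
  let χ : Weight ℂ (cartanImage t) (g ⧸ center ℂ g) := ⟨α', fun hbot => by
    have := hmem x hx
    rw [hbot] at this
    exact hx1 (by simpa using this)⟩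
  have hχ : χ.IsNonZero := by
    intro h0
    apply hα
    ext h
    rw [← hα' h ⟨centerQuotient g h, h, h.2, rfl⟩ rfl]
    exact congrFun h0 _
  have h1 := IsKilling.finrank_rootSpace_eq_one χ hχ
  obtain ⟨c, hc⟩ := (finrank_eq_one_iff_of_nonzero' (⟨centerQuotient g x, hmem x hx⟩ :
    LieAlgebra.rootSpace (cartanImage t) χ) (fun h => hx1 (congrArg Subtype.val h))).1 h1
      ⟨centerQuotient g y, hmem y hy⟩
  have hc' : c • centerQuotient g x = centerQuotient g y := congrArg Subtype.val hc
  refine ⟨c, sub_eq_zero.1 (eq_zero_of_mem_center_of_mem_rootSpace hα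
    (centerQuotient_eq_zero.1 ?_) (sub_mem hy (Submodule.smul_mem _ c hx)))⟩
  rw [map_sub, map_smul, hc', sub_self]

/-- Over `ℂ` the generalised weight spaces of `t` span `g`. The one of weight `0` is `t`, and the
others are root spaces by `mem_rootSpace_iff`. -/
lemma iSup_rootSpace_eq_top : rootSubspace t (roots t) = ⊤ := by
  rw [eq_top_iff, ← LieSubmodule.top_toSubmodule (R := ℂ) (L := t),
    ← iSup_genWeightSpace_eq_top' ℂ t g, LieSubmodule.iSup_toSubmodule]
  refine iSup_le fun χ => ?_
  by_cases h0 : χ.IsZero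
  · intro y hy
    refine Submodule.mem_sup_left (mem_cartan_iff.2 ?_)
    rw [← h0.eq]
    exact hy
  · refine le_sup_of_le_right (le_iSup₂_of_le (χ : Module.Dual ℂ t) ⟨?_, ?_⟩ ?_)
    · simpa using h0
    · obtain ⟨x, hx, hx0⟩ := χ.exists_ne_zero
      intro hbot
      have : x ∈ rootSpace t (χ : Module.Dual ℂ t) := (mem_rootSpace_iff (by simpa using h0)).2 hx
      rw [hbot] at this
      exact hx0 (by simpa using this)
    · intro y hy
      exact (mem_rootSpace_iff (by simpa using h0)).2 hy

/-- An induction principle for the root space decomposition. -/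
lemma root_induction {P : Submodule ℂ g} (ht : t.toSubmodule ≤ P)
    (hr : ∀ α ∈ roots t, rootSpace t α ≤ P) (x : g) : x ∈ P := by
  have : rootSubspace t (roots t) ≤ P := sup_le ht (iSup₂_le hr)
  rw [iSup_rootSpace_eq_top] at this
  exact this trivial

lemma isCompl_cartan : IsCompl t.toSubmodule (⨆ α ∈ roots t, rootSpace t α) := by
  refine ⟨?_, codisjoint_iff.2 iSup_rootSpace_eq_top⟩
  have hind := (LieSubmodule.iSupIndep_toSubmodule.2 (iSupIndep_genWeightSpace ℂ t g)) 0
  refine hind.mono ?_ ?_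
  · intro y hy
    exact mem_cartan_iff.1 hy
  · refine iSup₂_le fun α hα => ?_
    refine le_iSup₂_of_le (α : t → ℂ) (fun h => hα.1 (LinearMap.ext fun x => congrFun h x)) ?_
    intro y hy
    exact (mem_rootSpace_iff hα.1).1 hy

lemma mem_roots_iff {α : Module.Dual ℂ t} : α ∈ roots t ↔
    α ≠ 0 ∧ ∃ x ∈ rootSpace t α, x ≠ 0 :=
  and_congr_right fun _ => Submodule.ne_bot_iff _

lemma killingForm_eq_zero_of_mem_rootSpace {α β : t → ℂ} {x y : g}
    (hx : x ∈ genWeightSpace g α) (hy : y ∈ genWeightSpace g β) (hαβ : α + β ≠ 0) :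
    killingForm ℂ g x y = 0 :=
  killingForm_apply_eq_zero_of_mem_rootSpace_of_add_ne_zero ℂ g t hx hy hαβ

lemma killingForm_cartan (x y : t) : killingForm ℂ g x y =
    ∑ χ : Weight ℂ t g, Module.finrank ℂ (genWeightSpace g χ) • (χ x * χ y) :=
  traceForm_eq_sum_finrank_nsmul_mul ℂ t g x y

lemma killingForm_cartan_rootSpace {α : Module.Dual ℂ t} (hα : α ≠ 0) {x y : g} (hx : x ∈ t)
    (hy : y ∈ rootSpace t α) : killingForm ℂ g x y = 0 := by
  refine killingForm_eq_zero_of_mem_rootSpace (mem_cartan_iff.1 hx) ((mem_rootSpace_iff hα).1 hy)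
    fun h => hα (LinearMap.ext fun x => ?_)
  simpa using congrFun h x

lemma finrank_genWeightSpace_pos (χ : Weight ℂ t g) :
    0 < Module.finrank ℂ (genWeightSpace g χ) := by
  have := (LieSubmodule.nontrivial_iff_ne_bot ℂ t g).2 χ.genWeightSpace_ne_bot
  exact Module.finrank_pos

/-- For every root there is a triple `e ∈ g_α`, `f ∈ g_{-α}`, `k = [e, f] ∈ t` with `α(k) = 1`,
such that all weights are real on `k`. -/
lemma exists_rootTriple {α : Module.Dual ℂ t} (hα : α ∈ roots t) :
    ∃ e ∈ rootSpace t α, ∃ f ∈ rootSpace t (-α), ∃ k : t, ⁅e, f⁆ = (k : g) ∧ α k = 1 ∧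
      (∃ c : ℂ, c ≠ 0 ∧ ∀ h : t, killingForm ℂ g k h = c * α h) ∧
      ∀ χ : Weight ℂ t g, (starRingEnd ℂ) (χ k) = χ k := by
  obtain ⟨hα0, e, he, he0⟩ := mem_roots_iff.1 hα
  have hne : -α ≠ 0 := neg_ne_zero.2 hα0
  -- Otherwise `e` would be in the kernel of the Killing form, hence central, and a central root
  -- vector is zero.
  obtain ⟨f, hf, hef⟩ : ∃ f ∈ rootSpace t (-α), killingForm ℂ g e f ≠ 0 := by
    by_contra! hc
    have h1 : e ∈ LinearMap.ker (killingForm ℂ g) :=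
      mem_ker_killingForm_of_mem_rootSpace_of_forall_rootSpace_neg ℂ g t
        (α := α) ((mem_rootSpace_iff hα0).1 he) fun y hy => hc y ((mem_rootSpace_iff hne).2 hy)
    refine he0 (eq_zero_of_mem_center_of_mem_rootSpace hα0
      (mem_center_of_killingForm_eq_zero fun y => ?_) he)
    rw [LinearMap.mem_ker.1 h1, LinearMap.zero_apply]
  have hk : ⁅e, f⁆ ∈ t := by
    have := lie_mem_rootSpace he hf
    rw [add_neg_cancel] at this
    exact rootSpace_zero_le this
  obtain ⟨k, hk'⟩ : ∃ k : t, (k : g) = ⁅e, f⁆ := ⟨⟨_, hk⟩, rfl⟩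
  have hκ : ∀ h : t, killingForm ℂ g k h = killingForm ℂ g e f * α h := by
    intro h
    rw [hk', traceForm_apply_lie_apply, ← lie_skew, hf h, LinearMap.neg_apply, neg_smul, neg_neg,
      map_smul, smul_eq_mul, mul_comm]
  -- Trace argument along the `α`-string through `χ`: elements of `[g_α, g_{-α}]` act on it with
  -- trace zero, which gives an integral relation `a α + b χ = 0` on them, with `b > 0`.
  have hrat : ∀ χ : Weight ℂ t g, ∃ q : ℚ, χ k = q * α k := by
    intro χ
    obtain ⟨a, b, hb, hab⟩ := exists_forall_mem_corootSpace_smul_add_eq_zero g (α : t → ℂ) χ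
      (fun h => hα0 (LinearMap.ext fun x => congrFun h x)) χ.genWeightSpace_ne_bot
    have hkc : k ∈ corootSpace (α : t → ℂ) := by
      rw [mem_corootSpace, hk']
      exact Submodule.subset_span ⟨e, (mem_rootSpace_iff hα0).1 he, f,
        (mem_rootSpace_iff hne).1 hf, rfl⟩
    have h1 := hab k hkc
    have hb' : (b : ℂ) ≠ 0 := by exact_mod_cast hb.ne'
    refine ⟨-a / b, ?_⟩
    simp only [Pi.add_apply, Pi.smul_apply] at h1
    rw [zsmul_eq_mul, zsmul_eq_mul] at h1
    push_cast
    field_simp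
    linear_combination h1
  -- If `α(k) = 0`, all weights vanish at `k` by `hrat`, so `k` is Killing orthogonal to `t`, while
  -- `κ(k, h) = κ(e, f) α(h)` is not identically zero.
  have hαk : α k ≠ 0 := by
    intro h0
    apply hα0
    ext h
    have h1 := hκ h
    rw [killingForm_cartan, Finset.sum_eq_zero] at h1
    · simpa [hef] using h1.symm
    · intro χ _
      obtain ⟨q, hq⟩ := hrat χ
      rw [hq, h0]
      simp
  -- Dividing by `α(k)` turns `χ(k) = q α(k)` into the rational number `q`, which conjugation fixes.
  refine ⟨(α k)⁻¹ • e, Submodule.smul_mem _ _ he, f, hf, (α k)⁻¹ • k, ?_, ?_,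
    ⟨(α k)⁻¹ * killingForm ℂ g e f, mul_ne_zero (inv_ne_zero hαk) hef, fun h => ?_⟩, fun χ => ?_⟩
  · rw [smul_lie, ← hk']
    rfl
  · rw [map_smul, smul_eq_mul, inv_mul_cancel₀ hαk]
  · rw [SetLike.val_smul, map_smul, LinearMap.smul_apply, hκ, smul_eq_mul, mul_assoc]
  · obtain ⟨q, hq⟩ := hrat χ
    rw [map_smul, hq, smul_eq_mul, mul_comm (q : ℂ), inv_mul_cancel_left₀ hαk]
    simp

lemma neg_mem_roots {α : Module.Dual ℂ t} (hα : α ∈ roots t) : -α ∈ roots t := by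
  obtain ⟨e, he, f, hf, k, hk, h1, -⟩ := exists_rootTriple hα
  refine mem_roots_iff.2 ⟨neg_ne_zero.2 hα.1, f, hf, ?_⟩
  rintro rfl
  rw [lie_zero] at hk
  have : k = 0 := Subtype.ext hk.symm
  rw [this] at h1
  simp at h1

end RootSpaces

/-! ### The splitting of the Cartan subalgebra by a set of roots -/

section Coroots

open LieAlgebra LieModule

set_option linter.unusedSectionVars false

variable {g : Type*} [LieRing g] [LieAlgebra ℂ g]

/-- The span of the brackets `[g_α, g_{-α}]`, for `α ∈ φ`, inside `t`. -/
def corootSpan (t : LieSubalgebra ℂ g) (φ : Set (Module.Dual ℂ t)) : Submodule ℂ t :=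
  Submodule.span ℂ {k | ∃ α ∈ φ, ∃ e ∈ rootSpace t α, ∃ f ∈ rootSpace t (-α), ⁅e, f⁆ = (k : g)}

/-- The common kernel in `t` of the elements of `φ`. -/
def commonKer {t : LieSubalgebra ℂ g} (φ : Set (Module.Dual ℂ t)) : Submodule ℂ t :=
  (Submodule.span ℂ φ).dualCoannihilator

lemma mem_commonKer {t : LieSubalgebra ℂ g} {φ : Set (Module.Dual ℂ t)} {x : t} :
    x ∈ commonKer φ ↔ ∀ α ∈ φ, α x = 0 := by
  rw [commonKer, Submodule.mem_dualCoannihilator]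
  refine ⟨fun h α hα => h α (Submodule.subset_span hα), fun h α hα => ?_⟩
  induction hα using Submodule.span_induction with
  | mem α hα => exact h α hα
  | zero => rfl
  | add α β _ _ ha hb => rw [LinearMap.add_apply, ha, hb, add_zero]
  | smul c α _ ha => rw [LinearMap.smul_apply, ha, smul_zero]

variable [FiniteDimensional ℂ g] [HasCentralRadical ℂ g] {t : LieSubalgebra ℂ g}
  [t.IsCartanSubalgebra] {φ : Set (Module.Dual ℂ t)}

/-- Root spaces are lines, so every generator `[e', f']` is a multiple of the normalised `k` of
`exists_rootTriple`. Inclusions need only be tested on these `k`. -/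
lemma corootSpan_le (hφ : φ ⊆ roots t) {P : Submodule ℂ t}
    (h : ∀ α ∈ φ, ∀ k : t, k ∈ corootSpan t φ → α k = 1 →
      (∃ c : ℂ, c ≠ 0 ∧ ∀ h : t, killingForm ℂ g k h = c * α h) →
      (∀ χ : Weight ℂ t g, (starRingEnd ℂ) (χ k) = χ k) → k ∈ P) : corootSpan t φ ≤ P := by
  refine Submodule.span_le.2 ?_
  rintro k ⟨α, hα, e', he', f', hf', hk⟩
  obtain ⟨e, he, f, hf, k₀, hk₀, h1, h2, h3⟩ := exists_rootTriple (hφ hα)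
  have hk0 : (k₀ : g) ≠ 0 := by
    intro h0
    have : k₀ = 0 := Subtype.ext h0
    rw [this] at h1
    simp at h1
  have he0 : e ≠ 0 := by
    rintro rfl
    exact hk0 (by rw [← hk₀, zero_lie])
  have hf0 : f ≠ 0 := by
    rintro rfl
    exact hk0 (by rw [← hk₀, lie_zero])
  obtain ⟨c, rfl⟩ := exists_smul_eq_of_mem_rootSpace (hφ hα).1 he he0 he'
  obtain ⟨d, rfl⟩ := exists_smul_eq_of_mem_rootSpace (neg_mem_roots (hφ hα)).1 hf hf0 hf'
  have hkk : k = c • d • k₀ := by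
    apply Subtype.ext
    rw [← hk, smul_lie, lie_smul, hk₀]
    rfl
  rw [hkk]
  exact P.smul_mem _ (P.smul_mem _ (h α hα k₀ (Submodule.subset_span ⟨α, hα, e, he, f, hf, hk₀⟩)
    h1 h2 h3))

/-- The span is generated by vectors at which all weights are real, so conjugating the scalars of a
combination conjugates the value of every weight. -/
lemma exists_conj_mem_corootSpan (hφ : φ ⊆ roots t) {u : t} (hu : u ∈ corootSpan t φ) :
    ∃ v ∈ corootSpan t φ, ∀ χ : Weight ℂ t g, χ v = (starRingEnd ℂ) (χ u) := by
  let P : Submodule ℂ t :=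
    { carrier := {u | ∃ v ∈ corootSpan t φ, ∀ χ : Weight ℂ t g, χ v = (starRingEnd ℂ) (χ u)}
      add_mem' := by
        rintro a b ⟨v, hv, h⟩ ⟨w, hw, h'⟩
        exact ⟨v + w, add_mem hv hw, fun χ => by rw [map_add, map_add, h, h', map_add]⟩
      zero_mem' := ⟨0, zero_mem _, fun χ => by rw [map_zero, map_zero]⟩
      smul_mem' := by
        rintro c a ⟨v, hv, h⟩
        exact ⟨(starRingEnd ℂ) c • v, Submodule.smul_mem _ _ hv, fun χ => by
          rw [map_smul, map_smul, h, smul_eq_mul, smul_eq_mul, map_mul]⟩ }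
  exact corootSpan_le (P := P) hφ (fun α _ k hk _ _ h => ⟨k, hk, fun χ => (h χ).symm⟩) hu

lemma killingForm_corootSpan_eq_zero (hφ : φ ⊆ roots t) {u v : t} (hu : u ∈ commonKer φ)
    (hv : v ∈ corootSpan t φ) : killingForm ℂ g v u = 0 := by
  let P : Submodule ℂ t := LinearMap.ker
    (((killingForm ℂ g).flip (u : g)).comp t.toSubmodule.subtype)
  refine corootSpan_le (P := P) hφ (fun α hα k _ _ ⟨c, _, hc⟩ _ => ?_) hv
  change killingForm ℂ g k u = 0
  rw [hc, mem_commonKer.1 hu α hα, mul_zero]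

/-- Positivity: if `v` is the conjugate of `u`, then `κ(v, u)` is the sum of the `|χ(u)|²` with
positive multiplicities. It is zero because `v` is in the span and `u` in the common kernel. -/
lemma weight_eq_zero_of_mem_corootSpan (hφ : φ ⊆ roots t) {u : t} (hu : u ∈ commonKer φ)
    (hu' : u ∈ corootSpan t φ) (χ : Weight ℂ t g) : χ u = 0 := by
  obtain ⟨v, hv, h⟩ := exists_conj_mem_corootSpan hφ hu'
  have h0 := killingForm_corootSpan_eq_zero hφ hu hv
  rw [killingForm_cartan] at h0
  have h1 : ∑ χ : Weight ℂ t g, (Module.finrank ℂ (genWeightSpace g χ) : ℝ) *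
      Complex.normSq (χ u) = 0 := by
    rw [← Complex.ofReal_eq_zero, ← h0]
    push_cast
    refine Finset.sum_congr rfl fun χ _ => ?_
    rw [h, ← Complex.normSq_eq_conj_mul_self, nsmul_eq_mul]
  have h2 := (Finset.sum_eq_zero_iff_of_nonneg fun χ _ =>
    mul_nonneg (Nat.cast_nonneg _) (Complex.normSq_nonneg _)).1 h1 χ (Finset.mem_univ _)
  rcases mul_eq_zero.1 h2 with h3 | h3
  · exact absurd (Nat.cast_eq_zero.1 h3) (finrank_genWeightSpace_pos χ).ne'
  · exact Complex.normSq_eq_zero.1 h3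

/-- The Killing form on `t` is a sum of products of weights, and `t` is orthogonal to the root
spaces; so `u` is in the kernel of the form. -/
lemma mem_center_of_weight_eq_zero {u : t} (hu : ∀ χ : Weight ℂ t g, χ u = 0) :
    (u : g) ∈ center ℂ g := by
  refine mem_center_of_killingForm_eq_zero fun y => ?_
  refine root_induction (t := t) (P := LinearMap.ker (killingForm ℂ g (u : g))) ?_ ?_ y
  · intro h hh
    change killingForm ℂ g u ((⟨h, hh⟩ : t) : g) = 0
    rw [killingForm_cartan]
    exact Finset.sum_eq_zero fun χ _ => by rw [hu, zero_mul, smul_zero]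
  · intro α hα y hy
    exact killingForm_cartan_rootSpace hα.1 u.2 hy

lemma exists_corootSpan_of_mem_span (hφ : φ ⊆ roots t) {l : Module.Dual ℂ t}
    (hl : l ∈ Submodule.span ℂ φ) :
    ∃ u ∈ corootSpan t φ, ∀ h : t, killingForm ℂ g u h = l h := by
  induction hl using Submodule.span_induction with
  | mem α hα =>
    obtain ⟨e, he, f, hf, k, hk, -, ⟨c, hc0, hc⟩, -⟩ := exists_rootTriple (hφ hα)
    refine ⟨c⁻¹ • k, Submodule.smul_mem _ _ (Submodule.subset_span ⟨α, hα, e, he, f, hf, hk⟩),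
      fun h => ?_⟩
    rw [SetLike.val_smul, map_smul, LinearMap.smul_apply, hc, smul_eq_mul,
      inv_mul_cancel_left₀ hc0]
  | zero => exact ⟨0, zero_mem _, fun h => by simp⟩
  | add l l' _ _ hl hl' =>
    obtain ⟨u, hu, h⟩ := hl
    obtain ⟨u', hu', h'⟩ := hl'
    exact ⟨u + u', add_mem hu hu', fun x => by
      rw [LinearMap.add_apply, ← h, ← h', AddMemClass.coe_add, map_add, LinearMap.add_apply]⟩
  | smul c l _ hl =>
    obtain ⟨u, hu, h⟩ := hl
    exact ⟨c • u, Submodule.smul_mem _ _ hu, fun x => by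
      rw [LinearMap.smul_apply, ← h, SetLike.val_smul, map_smul, LinearMap.smul_apply]⟩

/-- Duality. A functional `l ≠ 0` vanishing on both summands lies in the span of `φ`, hence equals
`κ(u, ·)` for some `u` in the first summand. Since `l` kills the first summand, all `α ∈ φ` vanish
at `u`. By positivity all weights vanish at `u`, and then `l = 0`. -/
lemma corootSpan_sup_commonKer (hφ : φ ⊆ roots t) : corootSpan t φ ⊔ commonKer φ = ⊤ := by
  by_contra hne
  obtain ⟨l, hl0, hl⟩ := Submodule.exists_le_ker_of_lt_top _ (lt_top_iff_ne_top.2 hne)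
  have hspan : l ∈ Submodule.span ℂ φ := by
    rw [← Subspace.dualCoannihilator_dualAnnihilator_eq (W := Submodule.span ℂ φ),
      Submodule.mem_dualAnnihilator]
    intro w hw
    exact hl (Submodule.mem_sup_right hw)
  obtain ⟨u, hu, h⟩ := exists_corootSpan_of_mem_span hφ hspan
  have hu' : u ∈ commonKer φ := by
    rw [mem_commonKer]
    intro α hα
    obtain ⟨e, he, f, hf, k, hk, -, ⟨c, hc0, hc⟩, -⟩ := exists_rootTriple (hφ hα)
    have h1 : killingForm ℂ g u k = 0 := by
      rw [h]
      exact hl (Submodule.mem_sup_left (Submodule.subset_span ⟨α, hα, e, he, f, hf, hk⟩))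
    rw [traceForm_comm, hc] at h1
    exact (mul_eq_zero.1 h1).resolve_left hc0
  apply hl0
  ext x
  rw [← h, killingForm_cartan]
  exact Finset.sum_eq_zero fun χ _ => by
    rw [weight_eq_zero_of_mem_corootSpan hφ hu' hu, zero_mul, smul_zero]

lemma mem_center_of_mem_commonKer_roots {u : t} (hu : u ∈ commonKer (roots t)) :
    (u : g) ∈ center ℂ g := by
  refine mem_center_of_weight_eq_zero fun χ => ?_
  by_cases h0 : χ.IsZero
  · exact congrFun h0.eq u
  · obtain ⟨x, hx, hx0⟩ := χ.exists_ne_zero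
    have hne : (χ : Module.Dual ℂ t) ≠ 0 := by simpa using h0
    exact mem_commonKer.1 hu (χ : Module.Dual ℂ t)
      (mem_roots_iff.2 ⟨hne, x, (mem_rootSpace_iff hne).2 hx, hx0⟩)

/-- A Cartan subalgebra of a reductive Lie algebra is abelian. -/
lemma lie_cartan_eq_zero {x y : g} (hx : x ∈ t) (hy : y ∈ t) : ⁅x, y⁆ = 0 := by
  let P : Submodule ℂ t :=
    (LinearMap.ker (LieModule.toEnd ℂ g g x : g →ₗ[ℂ] g)).comap t.toSubmodule.subtype
  have hP : ∀ y : t, y ∈ P ↔ ⁅x, (y : g)⁆ = 0 := fun y => Iff.rfl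
  suffices h : (⊤ : Submodule ℂ t) ≤ P from (hP ⟨y, hy⟩).1 (h trivial)
  -- In this splitting of `t` the second summand is central, and on `[e, f]` the two contributions
  -- `α(x)` and `-α(x)` cancel.
  rw [← corootSpan_sup_commonKer (φ := roots t) subset_rfl]
  refine sup_le (Submodule.span_le.2 ?_) fun u hu => ?_
  · rintro k ⟨α, _, e, he, f, hf, hk⟩
    change ⁅x, (k : g)⁆ = 0
    have h1 := he ⟨x, hx⟩
    have h2 := hf ⟨x, hx⟩
    simp only at h1 h2
    rw [← hk, leibniz_lie, h1, h2, smul_lie, lie_smul, LinearMap.neg_apply, neg_smul,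
      add_neg_cancel]
  · rw [hP]
    exact mem_center_iff.1 (mem_center_of_mem_commonKer_roots hu) x

/-- Positivity only shows that `u` is central. For `B`, the centre is orthogonal to all brackets. As
`u` is both central and a sum of brackets, it is orthogonal to the root vectors, to the span of the
`[g_α, g_{-α}]` and to the centre, hence to all of `g`. -/
lemma disjoint_corootSpan_commonKer (B : InvariantForm g) (hφ : φ ⊆ roots t) :
    Disjoint (corootSpan t φ) (commonKer φ) := by
  rw [Submodule.disjoint_def]
  intro u hu hu'
  have hZ := mem_center_of_weight_eq_zero (weight_eq_zero_of_mem_corootSpan hφ hu' hu)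
  have hcen : ∀ z ∈ center ℂ g, ∀ x y : g, B.form ⁅x, y⁆ z = 0 := by
    intro z hz x y
    rw [← B.invariant, mem_center_iff.1 hz, map_zero]
  have hcor : ∀ z ∈ center ℂ g, ∀ v ∈ corootSpan t (roots t), B.form (v : g) z = 0 := by
    intro z hz v hv
    let P : Submodule ℂ t := LinearMap.ker ((B.form.flip z).comp t.toSubmodule.subtype)
    refine (Submodule.span_le (p := P)).2 ?_ hv
    rintro k ⟨α, _, e, _, f, _, hk⟩
    change B.form (k : g) z = 0
    rw [← hk, hcen z hz]
  have hur : u ∈ corootSpan t (roots t) :=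
    by
    refine Submodule.span_mono ?_ hu
    rintro k ⟨α, hα, h⟩
    exact ⟨α, hφ hα, h⟩
  apply Subtype.ext
  refine B.nondegenerate.1 _ fun y => ?_
  refine root_induction (t := t) (P := LinearMap.ker (B.form (u : g))) ?_ ?_ y
  · intro h hh
    have hmem : (⟨h, hh⟩ : t) ∈ corootSpan t (roots t) ⊔ commonKer (roots t) := by
      rw [corootSpan_sup_commonKer subset_rfl]
      trivial
    obtain ⟨v, hv, w, hw, hvw⟩ := Submodule.mem_sup.1 hmem
    have : h = v + w := congrArg Subtype.val hvw.symm
    change B.form (u : g) h = 0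
    rw [this, map_add, hcor w (mem_center_of_mem_commonKer_roots hw) u hur, add_zero,
      show B.form (u : g) (v : g) = B.form (v : g) u from B.symm.eq _ _, hcor u hZ v hv]
  · intro α hα y hy
    change B.form (u : g) y = 0
    obtain ⟨-, -, -, -, k, -, h1, -⟩ := exists_rootTriple hα
    have h2 := hy k
    rw [h1, one_smul] at h2
    rw [← h2, show B.form (u : g) ⁅(k : g), y⁆ = B.form ⁅(k : g), y⁆ u from B.symm.eq _ _, hcen _ hZ]

/-- `t` is the direct sum of the span of the brackets `[g_α, g_{-α}]`, for `α ∈ φ`, and of the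
common kernel of `φ`. -/
lemma isCompl_commonKer (B : InvariantForm g) (hφ : φ ⊆ roots t) :
    IsCompl (commonKer φ) (corootSpan t φ) :=
  IsCompl.symm ⟨disjoint_corootSpan_commonKer B hφ,
    codisjoint_iff.2 (corootSpan_sup_commonKer hφ)⟩

end Coroots

/-! ### Borel and parabolic subalgebras -/

section Borel

set_option linter.unusedSectionVars false

open LieAlgebra LieModule

/-- The trace form of a representation of a solvable Lie algebra `S` vanishes on `S × [S, S]`. -/
lemma traceForm_lie_eq_zero_of_isSolvable {S : Type*} [LieRing S] [LieAlgebra ℂ S]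
    [IsSolvable S] (n : ℕ) : ∀ (M : Type*) [AddCommGroup M] [Module ℂ M] [LieRingModule S M]
    [LieModule ℂ S M] [FiniteDimensional ℂ M], Module.finrank ℂ M = n →
    ∀ x y z : S, traceForm ℂ S M x ⁅y, z⁆ = 0 := by
  induction n using Nat.strong_induction_on with
  | _ n ih =>
    intro M _ _ _ _ _ hn x y z
    rcases subsingleton_or_nontrivial M with hM | hM
    · rw [traceForm_apply_apply, Subsingleton.elim (toEnd ℂ S M x ∘ₗ toEnd ℂ S M ⁅y, z⁆) 0, map_zero]
    -- Lie's theorem on the dual gives a common eigenfunctional `f`, whose kernel `W` is a proper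
    -- submodule. The eigencharacter kills brackets, so `x ∘ [y, z]` maps `M` into `W`. Its trace
    -- can be computed on `W`, where the induction hypothesis applies.
    obtain ⟨χ, hχ⟩ := exists_nontrivial_weightSpace_of_isSolvable ℂ S (M →ₗ[ℂ] ℂ)
    obtain ⟨⟨f, hf⟩, hf0⟩ := exists_ne (0 : weightSpace (M →ₗ[ℂ] ℂ) χ)
    have hf0 : f ≠ 0 := fun h => hf0 (Subtype.ext h)
    rw [mem_weightSpace] at hf
    have hfm : ∀ (s : S) (m : M), f ⁅s, m⁆ = -(χ s * f m) := by
      intro s m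
      have := LinearMap.congr_fun (hf s) m
      rw [Module.Dual.lie_apply, LinearMap.smul_apply, smul_eq_mul] at this
      rw [← this, neg_neg]
    have hd : ∀ m, f ⁅⁅y, z⁆, m⁆ = 0 := by
      intro m
      rw [lie_lie, map_sub, hfm, hfm, hfm, hfm]
      ring
    let W : LieSubmodule ℂ S M :=
      { LinearMap.ker f with
        lie_mem := fun {s m} hm => by
          change f ⁅s, m⁆ = 0
          rw [hfm, show f m = 0 from hm, mul_zero, neg_zero] }
    have hlt : Module.finrank ℂ W < n := by
      rw [← hn]
      refine Submodule.finrank_lt (s := LinearMap.ker f) fun h => hf0 ?_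
      exact LinearMap.ker_eq_top.1 h
    have hmem : ∀ m, (toEnd ℂ S M x ∘ₗ toEnd ℂ S M ⁅y, z⁆) m ∈ W.toSubmodule := by
      intro m
      change f ⁅x, ⁅⁅y, z⁆, m⁆⁆ = 0
      rw [hfm, hd, mul_zero, neg_zero]
    have h1 := ih _ hlt W rfl x y z
    rw [traceForm_apply_apply] at h1 ⊢
    rw [← LinearMap.trace_restrict_eq_of_forall_mem _ _ hmem]
    exact h1

lemma isSolvable_of_isSolvable_derivedSeries {S : Type*} [LieRing S] [LieAlgebra ℂ S]
    (h : IsSolvable (derivedSeries ℂ S 1)) : IsSolvable S := by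
  obtain ⟨k, hk⟩ := IsSolvable.solvable ℂ (derivedSeries ℂ S 1)
  rw [LieIdeal.derivedSeries_eq_bot_iff] at hk
  refine IsSolvable.mk (R := ℂ) (k := k + 1) ?_
  rw [derivedSeries_def, derivedSeriesOfIdeal_add]
  exact hk

variable {g : Type*} [LieRing g] [LieAlgebra ℂ g] [FiniteDimensional ℂ g]

/-- Cartan's criterion for subalgebras. -/
lemma isSolvable_of_killingForm_lie_eq_zero (c : LieSubalgebra ℂ g)
    (h : ∀ x ∈ c, ∀ y ∈ c, ∀ z ∈ c, killingForm ℂ g x ⁅y, z⁆ = 0) : IsSolvable c := by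
  refine isSolvable_of_isSolvable_derivedSeries ?_
  -- With a vanishing trace form, the derived algebra of `[c, c]` acts on `g` by nilpotent maps. By
  -- Engel's theorem it is a nilpotent Lie algebra, and solvability climbs two derived steps up to
  -- `c`.
  have htf : traceForm ℂ (derivedSeries ℂ c 1) g = 0 := by
    ext x y
    change killingForm ℂ g ((x : c) : g) ((y : c) : g) = 0
    have hy : ((y : derivedSeries ℂ c 1) : c) ∈
        Submodule.span ℂ {w : c | ∃ u v : c, ⁅u, v⁆ = w} := by
      rw [← coe_derivedSeries_one_eq]
      exact y.2
    generalize (y : c) = w at hy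
    induction hy using Submodule.span_induction with
    | mem w hw =>
      obtain ⟨u, v, rfl⟩ := hw
      exact h _ (x : c).2 _ u.2 _ v.2
    | zero => simp
    | add a b _ _ ha hb => rw [AddMemClass.coe_add, map_add, ha, hb, add_zero]
    | smul r a _ ha => rw [SetLike.val_smul, map_smul, ha, smul_zero]
  have hnil := isNilpotent_derivedSeries_of_traceForm_eq_zero htf
  rw [isNilpotent_iff_forall' (R := ℂ)] at hnil
  refine isSolvable_of_isSolvable_derivedSeries ?_
  have : LieRing.IsNilpotent (derivedSeries ℂ (derivedSeries ℂ c 1) 1) := by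
    rw [LieAlgebra.isNilpotent_iff_forall (R := ℂ)]
    intro x
    obtain ⟨n, hn⟩ := hnil x
    refine ⟨n, ?_⟩
    have key : ∀ (n : ℕ) (y : derivedSeries ℂ (derivedSeries ℂ c 1) 1),
        (((((ad ℂ _ x) ^ n) y : derivedSeries ℂ (derivedSeries ℂ c 1) 1) :
          derivedSeries ℂ c 1) : c).1 =
        ((toEnd ℂ (derivedSeries ℂ (derivedSeries ℂ c 1) 1) g x) ^ n) ((y : c) : g) := by
      intro n
      induction n with
      | zero => intro y; rfl
      | succ n ih =>
        intro y
        rw [pow_succ, pow_succ, Module.End.mul_apply, Module.End.mul_apply, ih]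
        rfl
    ext y
    rw [key, hn]
    rfl
  infer_instance

/-- A Borel subalgebra contains its orthogonal with respect to the Killing form. -/
lemma mem_of_isBorel {b : LieSubalgebra ℂ g} (hb : IsBorel b) {x : g}
    (hx : ∀ y ∈ b, killingForm ℂ g x y = 0) : x ∈ b := by
  have _i := hb.1
  by_contra hxb
  -- The orthogonal `P` of `b` is a `b`-module. If it is not inside `b`, its image in `g / b` is
  -- nonzero and Lie's theorem gives an eigenvector there, lifted to `v ∈ P`. Then `c = b + ℂ v` is
  -- a strictly larger subalgebra, and it remains to see that it is solvable.
  let P : LieSubmodule ℂ b g :=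
    { carrier := {x | ∀ y ∈ b, killingForm ℂ g x y = 0}
      add_mem' := fun {u v} hu hv y hy => by
        rw [map_add, LinearMap.add_apply, hu y hy, hv y hy, add_zero]
      zero_mem' := fun y _ => by rw [map_zero, LinearMap.zero_apply]
      smul_mem' := fun c u hu y hy => by
        rw [map_smul, LinearMap.smul_apply, hu y hy, smul_zero]
      lie_mem := fun {s m} hm y hy => by
        change killingForm ℂ g ⁅(s : g), m⁆ y = 0
        rw [← lie_skew, map_neg, LinearMap.neg_apply, traceForm_apply_lie_apply,
          hm _ (b.lie_mem s.2 hy), neg_zero] }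
  let Q : LieSubmodule ℂ b (g ⧸ b.toLieSubmodule) :=
    P.map (LieSubmodule.Quotient.mk' b.toLieSubmodule)
  have hxQ : LieSubmodule.Quotient.mk' b.toLieSubmodule x ∈ Q := ⟨x, hx, rfl⟩
  have : Nontrivial Q := by
    refine nontrivial_of_ne ⟨_, hxQ⟩ 0 fun h => hxb ?_
    exact (LieSubmodule.Quotient.mk_eq_zero').1 (congrArg Subtype.val h)
  obtain ⟨χ, hχ⟩ := exists_nontrivial_weightSpace_of_isSolvable ℂ b Q
  obtain ⟨⟨⟨_, v, hv, rfl⟩, hw⟩, hw0⟩ := exists_ne (0 : weightSpace Q χ)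
  have hvb : v ∉ b := fun h => hw0
    (Subtype.ext (Subtype.ext ((LieSubmodule.Quotient.mk_eq_zero').2 h)))
  rw [mem_weightSpace] at hw
  have hlie : ∀ y : b, ⁅(y : g), v⁆ - χ y • v ∈ b := by
    intro y
    have h1 := congrArg Subtype.val (hw y)
    refine (LieSubmodule.Quotient.mk_eq_zero' (N := b.toLieSubmodule)).1 ?_
    exact sub_eq_zero.2 h1
  let c : LieSubalgebra ℂ g :=
    { b.toSubmodule ⊔ Submodule.span ℂ {v} with
      lie_mem' := by
        intro u w hu hw
        change _ ∈ b.toSubmodule ⊔ Submodule.span ℂ {v}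
        obtain ⟨y, hy, _, hz, rfl⟩ := Submodule.mem_sup.1 hu
        obtain ⟨r, rfl⟩ := Submodule.mem_span_singleton.1 hz
        obtain ⟨y', hy', _, hz', rfl⟩ := Submodule.mem_sup.1 hw
        obtain ⟨r', rfl⟩ := Submodule.mem_span_singleton.1 hz'
        have e : ⁅y + r • v, y' + r' • v⁆ = (⁅y, y'⁆ + r' • (⁅y, v⁆ - χ ⟨y, hy⟩ • v) -
            r • (⁅y', v⁆ - χ ⟨y', hy'⟩ • v)) + (r' * χ ⟨y, hy⟩ - r * χ ⟨y', hy'⟩) • v := by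
          rw [add_lie, lie_add, lie_add, smul_lie, smul_lie, lie_smul, lie_smul, lie_self,
            ← lie_skew v y']
          module
        rw [e]
        refine add_mem (Submodule.mem_sup_left (b.sub_mem (b.add_mem (b.lie_mem hy hy')
          (b.smul_mem _ (hlie ⟨y, hy⟩))) (b.smul_mem _ (hlie ⟨y', hy'⟩)))) ?_
        exact Submodule.mem_sup_right (Submodule.smul_mem _ _ (Submodule.mem_span_singleton_self v)) }
  have hc : IsSolvable c := by
    apply isSolvable_of_killingForm_lie_eq_zero
    have hbbb : ∀ x ∈ b, ∀ y ∈ b, ∀ z ∈ b, killingForm ℂ g x ⁅y, z⁆ = 0 :=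
      fun x hx y hy z hz => traceForm_lie_eq_zero_of_isSolvable (S := b) _ g rfl
        ⟨x, hx⟩ ⟨y, hy⟩ ⟨z, hz⟩
    have hvbb : ∀ y ∈ b, killingForm ℂ g v y = 0 := hv
    have hbbv : ∀ x ∈ b, ∀ y ∈ b, killingForm ℂ g x ⁅y, v⁆ = 0 := fun x hx y hy => by
      rw [← traceForm_apply_lie_apply, traceForm_comm]
      exact hv _ (b.lie_mem hx hy)
    -- By invariance and symmetry this number equals its own negative.
    have hvbv : ∀ y ∈ b, killingForm ℂ g v ⁅y, v⁆ = 0 := fun y _ => by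
      have h1 := traceForm_apply_lie_apply ℂ g g v y v
      rw [← lie_skew, map_neg, LinearMap.neg_apply, traceForm_comm] at h1
      exact self_eq_neg.1 h1.symm
    rintro x hx' y hy' z hz'
    obtain ⟨x, hx, _, h, rfl⟩ := Submodule.mem_sup.1 hx'
    obtain ⟨p, rfl⟩ := Submodule.mem_span_singleton.1 h
    obtain ⟨y, hy, _, h, rfl⟩ := Submodule.mem_sup.1 hy'
    obtain ⟨q, rfl⟩ := Submodule.mem_span_singleton.1 h
    obtain ⟨z, hz, _, h, rfl⟩ := Submodule.mem_sup.1 hz'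
    obtain ⟨r, rfl⟩ := Submodule.mem_span_singleton.1 h
    have e : ⁅y + q • v, z + r • v⁆ = ⁅y, z⁆ + r • ⁅y, v⁆ - q • ⁅z, v⁆ := by
      rw [add_lie, lie_add, lie_add, smul_lie, smul_lie, lie_smul, lie_smul, lie_self,
        ← lie_skew v z]
      module
    rw [e]
    simp only [map_add, map_sub, map_smul, LinearMap.add_apply, LinearMap.smul_apply]
    rw [hbbb x hx y hy z hz, hbbv x hx y hy, hbbv x hx z hz, hvbb _ (b.lie_mem hy hz),
      hvbv y hy, hvbv z hz]
    simp
  have hcb := hb.2 c hc fun y hy => Submodule.mem_sup_left hy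
  apply hvb
  rw [← hcb]
  exact Submodule.mem_sup_right (Submodule.mem_span_singleton_self v)

variable [HasCentralRadical ℂ g] {t : LieSubalgebra ℂ g} [t.IsCartanSubalgebra]

/-- The root space decomposition of a subalgebra that contains the Cartan subalgebra. -/
lemma root_induction_of_le {p : LieSubalgebra ℂ g} (hp : t ≤ p) {P : Submodule ℂ g}
    (ht : t.toSubmodule ≤ P) (hr : ∀ α ∈ roots t, ∀ x ∈ rootSpace t α, x ∈ p → x ∈ P)
    {x : g} (hx : x ∈ p) : x ∈ P := by
  let N : LieSubmodule ℂ t g :=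
    { p.toSubmodule with lie_mem := fun {s m} hm => p.lie_mem (hp s.2) hm }
  have hxN : x ∈ N := hx
  -- A `t`-stable subspace is the sum of its intersections with the weight spaces.
  rw [eq_iSup_inf_genWeightSpace (N := N), ← LieSubmodule.mem_toSubmodule,
    LieSubmodule.iSup_toSubmodule] at hxN
  refine (iSup_le fun χ => ?_ : _ ≤ P) hxN
  rintro y ⟨hyN, hy⟩
  by_cases h0 : χ.IsZero
  · refine ht (mem_cartan_iff.2 ?_)
    rw [← h0.eq]
    exact hy
  · have hne : (χ : Module.Dual ℂ t) ≠ 0 := by simpa using h0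
    have hy' : y ∈ rootSpace t (χ : Module.Dual ℂ t) := (mem_rootSpace_iff hne).2 hy
    by_cases hy0 : y = 0
    · rw [hy0]
      exact zero_mem _
    · exact hr _ (mem_roots_iff.2 ⟨hne, y, hy', hy0⟩) y hy' hyN

/-- A parabolic subalgebra containing `t` contains `g_α` or `g_{-α}`, for every root `α`. -/
lemma rootSpace_le_or_of_isParabolicSubalgebra {p : LieSubalgebra ℂ g}
    (hp : IsParabolicSubalgebra p) (htp : t ≤ p) {α : Module.Dual ℂ t} (hα : α ∈ roots t) :
    rootSpace t α ≤ p.toSubmodule ∨ rootSpace t (-α) ≤ p.toSubmodule := by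
  obtain ⟨b, hb, hbp⟩ := hp
  by_contra! hcon
  obtain ⟨h1, h2⟩ := hcon
  obtain ⟨e, he, hep⟩ := Set.not_subset.1 h1
  -- As `g_α` is a line not inside `p`, it meets `p` in zero. So `g_{-α}`, which pairs only with
  -- `g_α`, is Killing orthogonal to `p`, hence to `b`, and thus lies in `b`.
  have hzero : ∀ x ∈ rootSpace t α, x ∈ p → x = 0 := by
    intro x hx hxp
    by_contra hx0
    obtain ⟨c, rfl⟩ := exists_smul_eq_of_mem_rootSpace hα.1 hx hx0 he
    exact hep (p.smul_mem c hxp)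
  apply h2
  intro f hf
  refine hbp (mem_of_isBorel hb fun y hy => ?_)
  refine root_induction_of_le htp (P := LinearMap.ker (killingForm ℂ g f)) ?_ ?_ (hbp hy)
  · intro h hh
    change killingForm ℂ g f h = 0
    rw [traceForm_comm]
    exact killingForm_cartan_rootSpace (neg_ne_zero.2 hα.1) hh hf
  · intro β hβ x hx hxp
    change killingForm ℂ g f x = 0
    by_cases hβα : β = α
    · subst hβα
      rw [hzero x hx hxp, map_zero]
    · refine killingForm_eq_zero_of_mem_rootSpace ((mem_rootSpace_iff (neg_ne_zero.2 hα.1)).1 hf)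
        ((mem_rootSpace_iff hβ.1).1 hx) fun h => hβα (LinearMap.ext fun s => ?_)
      have := congrFun h s
      simp only [Pi.add_apply, LinearMap.neg_apply, Pi.zero_apply] at this
      linear_combination this

lemma mem_bracketSpan {U V : Submodule ℂ g} {x y : g} (hx : x ∈ U) (hy : y ∈ V) :
    ⁅x, y⁆ ∈ bracketSpan U V := Submodule.subset_span ⟨x, hx, y, hy, rfl⟩

lemma mem_bracketSpan' {U V : Submodule ℂ g} {x y : g} (hx : x ∈ U) (hy : y ∈ V) :
    ⁅y, x⁆ ∈ bracketSpan U V := by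
  rw [← lie_skew]
  exact neg_mem (mem_bracketSpan hx hy)

/-- Some `h ∈ t` has `α(h) ≠ 0`, and `x` is then a multiple of `[h, x]`. -/
lemma mem_bracketSpan_of_mem_rootSpace {U V : Submodule ℂ g} (htU : t.toSubmodule ≤ U)
    {α : Module.Dual ℂ t} (hα : α ≠ 0) {x : g} (hx : x ∈ rootSpace t α) (hxV : x ∈ V) :
    x ∈ bracketSpan U V := by
  obtain ⟨h, hh⟩ : ∃ h, α h ≠ 0 := by
    by_contra! hc
    exact hα (LinearMap.ext hc)
  have h1 : x = (α h)⁻¹ • ⁅(h : g), x⁆ := by rw [hx h, inv_smul_smul₀ hh]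
  rw [h1]
  exact Submodule.smul_mem _ _ (mem_bracketSpan (htU h.2) hxV)

/-- For parabolic subalgebras `t ⊆ p ⊆ q`, `[p, q] = [q, q]`. -/
lemma bracketSpan_eq_of_isParabolicSubalgebra {p q : LieSubalgebra ℂ g}
    (hp : IsParabolicSubalgebra p) (htp : t ≤ p) (hpq : p ≤ q) :
    bracketSpan p.toSubmodule q.toSubmodule = bracketSpan q.toSubmodule q.toSubmodule := by
  refine le_antisymm (Submodule.span_mono ?_) (Submodule.span_le.2 ?_)
  · rintro w ⟨x, hx, y, hy, rfl⟩
    exact ⟨x, hpq hx, y, hy, rfl⟩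
  rintro w ⟨x, hx, y, hy, rfl⟩
  set R := bracketSpan p.toSubmodule q.toSubmodule
  have htq : t ≤ q := htp.trans hpq
  refine root_induction_of_le htq
    (P := R.comap ((LieModule.toEnd ℂ g g : g →ₗ[ℂ] Module.End ℂ g).flip y)) ?_ ?_ hx
  · intro h hh
    exact mem_bracketSpan (htp hh) hy
  intro α hα x hx hxq
  change ⁅x, y⁆ ∈ R
  refine root_induction_of_le htq
    (P := R.comap (LieModule.toEnd ℂ g g x : g →ₗ[ℂ] g)) ?_ ?_ hy
  · intro h hh
    exact mem_bracketSpan' (htp hh) hxq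
  intro β hβ y hy hyq
  change ⁅x, y⁆ ∈ R
  by_cases hαβ : α + β = 0
  · obtain rfl : β = -α := (neg_eq_of_add_eq_zero_right hαβ).symm
    -- One of the two factors lies in `p`. If it is the second, the bracket is reversed at the cost
    -- of a sign.
    rcases rootSpace_le_or_of_isParabolicSubalgebra hp htp hα with h | h
    · exact mem_bracketSpan (h hx) hyq
    · exact mem_bracketSpan' (h hy) hxq
  · exact mem_bracketSpan_of_mem_rootSpace (t := t) htp hαβ (lie_mem_rootSpace hx hy)
      (q.lie_mem hxq hyq)

end Borel

/-! ### The projection onto the Levi centre -/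

section LeviProjection

open LieAlgebra LieModule

set_option linter.unusedSectionVars false

variable {g : Type*} [LieRing g] [LieAlgebra ℂ g] [FiniteDimensional ℂ g]
  [HasCentralRadical ℂ g] {t : LieSubalgebra ℂ g} [t.IsCartanSubalgebra]

variable (t) in
/-- The projection of `g` onto `t` along the sum of the root spaces. -/
def cartanProj : g →ₗ[ℂ] t := t.toSubmodule.projectionOnto _ isCompl_cartan

lemma cartanProj_cartan (h : t) : cartanProj t (h : g) = h :=
  Submodule.projectionOnto_apply_left isCompl_cartan h

lemma cartanProj_rootSpace {α : Module.Dual ℂ t} (hα : α ≠ 0) {x : g} (hx : x ∈ rootSpace t α) :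
    cartanProj t x = 0 := by
  by_cases hx0 : x = 0
  · rw [hx0, map_zero]
  · refine Submodule.projectionOnto_apply_of_mem_right isCompl_cartan ?_
    have hα' : α ∈ roots t := mem_roots_iff.2 ⟨hα, x, hx, hx0⟩
    exact (le_iSup₂ (f := fun α (_ : α ∈ roots t) => rootSpace t α) α hα') hx

/-- The projection of `g` onto the common kernel of `φ`, along the root spaces and the brackets
`[g_α, g_{-α}]`, `α ∈ φ`. -/
def leviProj (B : InvariantForm g) {φ : Set (Module.Dual ℂ t)} (hφ : φ ⊆ roots t) : g →ₗ[ℂ] t :=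
  (commonKer φ).subtype ∘ₗ (commonKer φ).projectionOnto _ (isCompl_commonKer B hφ) ∘ₗ cartanProj t

variable (B : InvariantForm g) {φ ψ ψ₀ : Set (Module.Dual ℂ t)} (hφ : φ ⊆ roots t)

lemma leviProj_mem (x : g) : leviProj B hφ x ∈ commonKer φ := Submodule.coe_mem _

lemma leviProj_rootSpace {α : Module.Dual ℂ t} (hα : α ≠ 0) {x : g} (hx : x ∈ rootSpace t α) :
    leviProj B hφ x = 0 := by
  rw [leviProj, LinearMap.comp_apply, LinearMap.comp_apply, cartanProj_rootSpace hα hx, map_zero,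
    map_zero]

lemma leviProj_commonKer {h : t} (hh : h ∈ commonKer φ) : leviProj B hφ (h : g) = h := by
  rw [leviProj, LinearMap.comp_apply, LinearMap.comp_apply, cartanProj_cartan]
  exact congrArg _ (Submodule.projectionOnto_apply_left (isCompl_commonKer B hφ) ⟨h, hh⟩)

lemma leviProj_corootSpan {h : t} (hh : h ∈ corootSpan t φ) : leviProj B hφ (h : g) = 0 := by
  rw [leviProj, LinearMap.comp_apply, LinearMap.comp_apply, cartanProj_cartan,
    Submodule.projectionOnto_apply_of_mem_right (isCompl_commonKer B hφ) hh, map_zero]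

lemma rootSubspace_le {P : Submodule ℂ g} (ht : t.toSubmodule ≤ P)
    (hr : ∀ α ∈ ψ, rootSpace t α ≤ P) : rootSubspace t ψ ≤ P :=
  sup_le ht (iSup₂_le hr)

lemma cartan_le_rootSubspace : t.toSubmodule ≤ rootSubspace t ψ := le_sup_left

lemma rootSpace_le_rootSubspace {α : Module.Dual ℂ t} (hα : α ∈ ψ) :
    rootSpace t α ≤ rootSubspace t ψ :=
  le_sup_of_le_right (le_iSup₂ (f := fun α (_ : α ∈ ψ) => rootSpace t α) α hα)

/-- The projection onto the common kernel of the Levi factor kills the derived algebra of a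
parabolic subalgebra. -/
lemma leviProj_lie (hψ : ψ ⊆ roots t) (hφ : leviFactor ψ ⊆ roots t) {x y : g}
    (hx : x ∈ rootSubspace t ψ) (hy : y ∈ rootSubspace t ψ) : leviProj B hφ ⁅x, y⁆ = 0 := by
  have hswap : ∀ x y : g, leviProj B hφ ⁅x, y⁆ = 0 → leviProj B hφ ⁅y, x⁆ = 0 := by
    intro x y h
    rw [← lie_skew, map_neg, h, neg_zero]
  have htr : ∀ h ∈ t, ∀ α ∈ ψ, ∀ x ∈ rootSpace t α, leviProj B hφ ⁅h, x⁆ = 0 := by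
    intro h hh α hα x hx
    have h1 : ⁅h, x⁆ = α ⟨h, hh⟩ • x := hx ⟨h, hh⟩
    rw [h1, map_smul, leviProj_rootSpace B hφ (hψ hα).1 hx, smul_zero]
  refine rootSubspace_le (P := (LinearMap.ker (leviProj B hφ)).comap
    ((LieModule.toEnd ℂ g g : g →ₗ[ℂ] Module.End ℂ g).flip y)) ?_ ?_ hx
  · intro h hh
    change leviProj B hφ ⁅h, y⁆ = 0
    refine rootSubspace_le (P := (LinearMap.ker (leviProj B hφ)).comap
      (LieModule.toEnd ℂ g g h : g →ₗ[ℂ] g)) ?_ ?_ hy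
    · intro h' hh'
      change leviProj B hφ ⁅h, h'⁆ = 0
      rw [lie_cartan_eq_zero hh hh', map_zero]
    · intro α hα x hx
      exact htr h hh α hα x hx
  · intro α hα x hx
    change leviProj B hφ ⁅x, y⁆ = 0
    refine rootSubspace_le (P := (LinearMap.ker (leviProj B hφ)).comap
      (LieModule.toEnd ℂ g g x : g →ₗ[ℂ] g)) ?_ ?_ hy
    · intro h hh
      exact hswap _ _ (htr h hh α hα x hx)
    · intro β hβ y hy
      change leviProj B hφ ⁅x, y⁆ = 0
      have hm := lie_mem_rootSpace hx hy
      by_cases hαβ : α + β = 0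
      · obtain rfl : β = -α := (neg_eq_of_add_eq_zero_right hαβ).symm
        rw [hαβ] at hm
        exact leviProj_corootSpan B hφ (h := ⟨_, rootSpace_zero_le hm⟩)
          (Submodule.subset_span ⟨α, ⟨hα, hβ⟩, x, hx, y, hy, rfl⟩)
      · exact leviProj_rootSpace B hφ hαβ hm

lemma IsParabolicSubset.mem_or_neg_mem (h : IsParabolicSubset t ψ) {α : Module.Dual ℂ t}
    (hα : α ∈ roots t) : α ∈ ψ ∨ -α ∈ ψ := by
  rw [← h.2] at hα
  exact hα

/-- Root vectors are brackets with elements of `t`. For `α` in the Levi factor of `ψ`, one of `e ∈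
g_α` and `f ∈ g_{-α}` belongs to the parabolic subalgebra of `ψ₀`, and both belong to that of `ψ`.
So the first factor may come from any parabolic subset; it will be the degree-zero term of a
filtration. -/
lemma sub_leviProj_mem_bracketSpan (hψ₀ : IsParabolicSubset t ψ₀) (hψ : IsParabolicSubset t ψ)
    (hφ : leviFactor ψ ⊆ roots t) {x : g} (hx : x ∈ rootSubspace t ψ) :
    x - leviProj B hφ x ∈ bracketSpan (rootSubspace t ψ₀) (rootSubspace t ψ) := by
  set R := bracketSpan (rootSubspace t ψ₀) (rootSubspace t ψ)
  refine rootSubspace_le (P := R.comap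
    (LinearMap.id - t.toSubmodule.subtype ∘ₗ leviProj B hφ)) ?_ ?_ hx
  · intro h hh
    change h - (leviProj B hφ h : g) ∈ R
    have hmem : (⟨h, hh⟩ : t) ∈ corootSpan t (leviFactor ψ) ⊔ commonKer (leviFactor ψ) := by
      rw [corootSpan_sup_commonKer hφ]
      trivial
    obtain ⟨v, hv, w, hw, hvw⟩ := Submodule.mem_sup.1 hmem
    obtain rfl : h = v + w := congrArg Subtype.val hvw.symm
    rw [map_add, leviProj_corootSpan B hφ hv, leviProj_commonKer B hφ hw, zero_add,
      add_sub_cancel_right]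
    refine (Submodule.span_le (p := R.comap t.toSubmodule.subtype)).2 ?_ hv
    rintro k ⟨α, hα, e, he, f, hf, hk⟩
    change (k : g) ∈ R
    rw [← hk]
    rcases hψ₀.mem_or_neg_mem (hψ.1.1 hα.1) with h | h
    · exact mem_bracketSpan (rootSpace_le_rootSubspace h he) (rootSpace_le_rootSubspace (ψ := ψ) hα.2 hf)
    · exact mem_bracketSpan' (rootSpace_le_rootSubspace h hf) (rootSpace_le_rootSubspace hα.1 he)
  · intro α hα x hx
    change x - (leviProj B hφ x : g) ∈ R
    rw [leviProj_rootSpace B hφ (hψ.1.1 hα).1 hx, ZeroMemClass.coe_zero, sub_zero]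
    exact mem_bracketSpan_of_mem_rootSpace cartan_le_rootSubspace (hψ.1.1 hα).1 hx
      (rootSpace_le_rootSubspace hα hx)

/-- Elements of `bracketSpan U V` are sums of brackets with the elements of a finite spanning
family of `U`. -/
lemma exists_sum_lie_eq {U V : Submodule ℂ g} {ι : Type*} [Fintype ι] (a : ι → g)
    (ha : U ≤ Submodule.span ℂ (Set.range a)) {w : g} (hw : w ∈ bracketSpan U V) :
    ∃ y : ι → g, (∀ j, y j ∈ V) ∧ w = ∑ j, ⁅a j, y j⁆ := by
  induction hw using Submodule.span_induction with
  | mem w hw =>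
    obtain ⟨x, hx, y, hy, rfl⟩ := hw
    obtain ⟨c, rfl⟩ := (Submodule.mem_span_range_iff_exists_fun ℂ).1 (ha hx)
    refine ⟨fun j => c j • y, fun j => V.smul_mem _ hy, ?_⟩
    rw [sum_lie]
    exact Finset.sum_congr rfl fun j _ => by rw [smul_lie, lie_smul]
  | zero => exact ⟨0, fun j => V.zero_mem, by simp⟩
  | add u v _ _ hu hv =>
    obtain ⟨y, hy, rfl⟩ := hu
    obtain ⟨z, hz, rfl⟩ := hv
    exact ⟨y + z, fun j => V.add_mem (hy j) (hz j), by simp [Finset.sum_add_distrib]⟩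
  | smul c u _ hu =>
    obtain ⟨y, hy, rfl⟩ := hu
    exact ⟨c • y, fun j => V.smul_mem c (hy j), by simp [Finset.smul_sum]⟩

namespace ParabolicFiltration

variable (ψ : ParabolicFiltration t)

lemma levi_subset (i : ℕ) : ψ.levi i ⊆ roots t :=
  fun _ h => (ψ.parabolic i).1.1 h.1

/-- The centre of the Levi subalgebra commutes with `t`, hence lies in `t`; an element of `t` acts
on `g_α` by `α`, and `t` is abelian. -/
lemma mem_leviCentre_iff {i : ℕ} {x : g} :
    x ∈ ψ.leviCentre i ↔ ∃ h : x ∈ t, ∀ α ∈ ψ.levi i, α ⟨x, h⟩ = 0 := by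
  rw [mem_leviCentre]
  constructor
  · intro hx
    have hxt : x ∈ t := ψ.leviCentre_le_cartan i (ψ.mem_leviCentre.2 hx)
    refine ⟨hxt, fun α hα => ?_⟩
    obtain ⟨-, y, hy, hy0⟩ := mem_roots_iff.1 (ψ.levi_subset i hα)
    have h1 : ⁅x, y⁆ = α ⟨x, hxt⟩ • y := hy ⟨x, hxt⟩
    rw [← lie_skew, hx.2 y (rootSpace_le_rootSubspace hα hy), neg_zero] at h1
    exact (smul_eq_zero.1 h1.symm).resolve_right hy0
  · rintro ⟨hxt, hx⟩
    refine ⟨ψ.le_leviAt i hxt, fun y hy => ?_⟩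
    refine rootSubspace_le (P := LinearMap.ker
      ((LieModule.toEnd ℂ g g : g →ₗ[ℂ] Module.End ℂ g).flip x)) ?_ ?_ hy
    · intro h hh
      exact lie_cartan_eq_zero hh hxt
    · intro α hα y hy
      change ⁅y, x⁆ = 0
      have h1 : ⁅x, y⁆ = α ⟨x, hxt⟩ • y := hy ⟨x, hxt⟩
      rw [← lie_skew, h1, hx α hα, zero_smul, neg_zero]

lemma lie_leviCentre {i j : ℕ} {x y : g} (hx : x ∈ ψ.leviCentre i) (hy : y ∈ ψ.leviCentre j) :
    ⁅x, y⁆ = 0 :=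
  lie_cartan_eq_zero (ψ.leviCentre_le_cartan i hx) (ψ.leviCentre_le_cartan j hy)

/-- The projection of `g` onto the `i`-th Levi centre. -/
def centreProj (i : ℕ) : g →ₗ[ℂ] g := t.toSubmodule.subtype ∘ₗ leviProj B (ψ.levi_subset i)

lemma centreProj_mem (i : ℕ) (x : g) : ψ.centreProj B i x ∈ ψ.leviCentre i :=
  ψ.mem_leviCentre_iff.2 ⟨Subtype.coe_prop _,
    mem_commonKer.1 (leviProj_mem B (ψ.levi_subset i) x)⟩

lemma centreProj_eq_self {i : ℕ} {x : g} (hx : x ∈ ψ.leviCentre i) : ψ.centreProj B i x = x := by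
  obtain ⟨hxt, h⟩ := ψ.mem_leviCentre_iff.1 hx
  exact congrArg Subtype.val
    (leviProj_commonKer B (ψ.levi_subset i) (h := ⟨x, hxt⟩) (mem_commonKer.2 h))

lemma centreProj_lie {i : ℕ} {x y : g} (hx : x ∈ ψ.parabolicAt i) (hy : y ∈ ψ.parabolicAt i) :
    ψ.centreProj B i ⁅x, y⁆ = 0 :=
  congrArg Subtype.val (leviProj_lie B (ψ.parabolic i).1.1 (ψ.levi_subset i) hx hy)

lemma mem_bracketSpan_of_centreProj_eq_zero {i : ℕ} {x : g} (hx : x ∈ ψ.parabolicAt i)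
    (h : ψ.centreProj B i x = 0) :
    x ∈ bracketSpan (ψ.parabolicAt 0).toSubmodule (ψ.parabolicAt i).toSubmodule := by
  have h1 := sub_leviProj_mem_bracketSpan B (ψ.parabolic 0) (ψ.parabolic i) (ψ.levi_subset i) hx
  change x - ψ.centreProj B i x ∈ _ at h1
  rw [h, sub_zero] at h1
  exact h1

end ParabolicFiltration

end LeviProjection

/-! ### Abelianisation and characters from a retraction -/

section Abelianization

attribute [local instance] LieRing.ofAssociativeRing

variable {S T : Type*} [LieRing S] [LieAlgebra ℂ S] [LieRing T] [LieAlgebra ℂ T]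
  (ι : T →ₗ⁅ℂ⁆ S) (π : S →ₗ[ℂ] T)

/-- If `π` is a retraction of `ι : T → S` whose kernel is the derived algebra of `S`, and `T` is
abelian, then `π` identifies the abelianisation of `S` with `T`. -/
lemma exists_abelianization_equiv (hι : ∀ x, π (ι x) = x) (hT : ∀ x y : T, ⁅x, y⁆ = 0)
    (hπ : ∀ x y : S, π ⁅x, y⁆ = 0)
    (hker : ∀ x, π x = 0 → x ∈ ⁅(⊤ : LieIdeal ℂ S), (⊤ : LieIdeal ℂ S)⁆) :
    ∃ e : Abelianization S ≃ₗ⁅ℂ⁆ T, ∀ x, e (toAb (ι x)) = x := by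
  have hle : ∀ x ∈ ⁅(⊤ : LieIdeal ℂ S), (⊤ : LieIdeal ℂ S)⁆, π x = 0 := by
    intro x hx
    rw [← LieSubmodule.mem_toSubmodule, LieSubmodule.lieIdeal_oper_eq_linear_span'] at hx
    refine (Submodule.span_le (p := LinearMap.ker π)).2 ?_ hx
    rintro w ⟨x, -, y, -, rfl⟩
    exact hπ x y
  let f : Abelianization S →ₗ[ℂ] T :=
    Submodule.liftQ (⁅(⊤ : LieIdeal ℂ S), (⊤ : LieIdeal ℂ S)⁆).toSubmodule π hle
  have hf : ∀ x, f (toAb x) = π x := fun x => rfl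
  have hbij : Function.Bijective f := by
    refine ⟨?_, fun x => ⟨toAb (ι x), hι x⟩⟩
    rw [injective_iff_map_eq_zero]
    intro x hx
    obtain ⟨x, rfl⟩ := LieSubmodule.Quotient.surjective_mk' _ x
    exact (LieSubmodule.Quotient.mk_eq_zero').2 (hker x hx)
  refine ⟨{ LinearEquiv.ofBijective f hbij with map_lie' := ?_ }, hι⟩
  intro x y
  obtain ⟨x, rfl⟩ := LieSubmodule.Quotient.surjective_mk' _ x
  obtain ⟨y, rfl⟩ := LieSubmodule.Quotient.surjective_mk' _ y
  rw [hT]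
  exact hπ x y

/-- The character is `l ∘ π`. It is the only one because `x - ι (π x)` lies in the derived algebra,
where every character vanishes. -/
lemma existsUnique_lieCharacter (hι : ∀ x, π (ι x) = x) (hπ : ∀ x y : S, π ⁅x, y⁆ = 0)
    (hker : ∀ x, π x = 0 → x ∈ ⁅(⊤ : LieIdeal ℂ S), (⊤ : LieIdeal ℂ S)⁆)
    (l : Module.Dual ℂ T) :
    ∃! χ : LieAlgebra.LieCharacter ℂ S, ∀ x, χ (ι x) = l x := by
  refine ⟨{ l ∘ₗ π with map_lie' := ?_ }, fun x => congrArg l (hι x), ?_⟩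
  · intro x y
    change l (π ⁅x, y⁆) = ⁅l (π x), l (π y)⁆
    rw [hπ, map_zero, LieRing.of_associative_ring_bracket, mul_comm, sub_self]
  · intro χ hχ
    ext x
    change χ x = l (π x)
    have h1 : x - ι (π x) ∈ ⁅(⊤ : LieIdeal ℂ S), (⊤ : LieIdeal ℂ S)⁆ :=
      hker _ (by rw [map_sub, hι, sub_self])
    have h2 : χ (x - ι (π x)) = 0 := LieAlgebra.lieCharacter_apply_of_mem_derived χ h1
    rw [map_sub, hχ, sub_eq_zero] at h2
    exact h2

end Abelianization

/-! ### Laurent series without polar part -/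

namespace Laurent

/-- The Laurent series `∑_{i ≥ 0} a_i z^i`. -/
def ofSeq (a : ℕ → ℂ) : Laurent := HahnSeries.ofPowerSeries ℤ ℂ (PowerSeries.mk a)

lemma coeff_ofSeq_of_neg (a : ℕ → ℂ) {n : ℤ} (hn : n < 0) : coeff n (ofSeq a) = 0 := by
  have h := PowerSeries.coeff_coe (PowerSeries.mk a) n
  rw [if_pos hn] at h
  exact h

lemma coeff_ofSeq (a : ℕ → ℂ) (n : ℕ) : coeff n (ofSeq a) = a n := by
  have h := PowerSeries.coeff_coe (PowerSeries.mk a) n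
  rw [if_neg (by omega), PowerSeries.coeff_mk, Int.natAbs_natCast] at h
  exact h

lemma mono_zero : mono 0 = 1 := rfl

lemma coeff_mul_deriv_eq_zero {f h : Laurent} (hf : ∀ n < (0 : ℤ), coeff n f = 0)
    (hh : ∀ n < (0 : ℤ), coeff n h = 0) : coeff (-1) (h * deriv f) = 0 := by
  rw [coeff_mul]
  refine (finsum_congr fun i => ?_).trans finsum_zero
  rw [coeff_deriv]
  rcases lt_trichotomy i 0 with hi | rfl | hi
  · rw [hh i hi, zero_mul]
  -- For `i = 0` the other factor is the coefficient of `z^{-1}` in a derivative, which is zero.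
  · simp
  · rw [hf _ (by omega), mul_zero, mul_zero]

end Laurent

/-! ### Coefficients in the loop algebra -/

section Loop

set_option linter.unusedSectionVars false

variable {g : Type*} [LieRing g] [LieAlgebra ℂ g] [FiniteDimensional ℂ g]

/-- Since `g` is finite-dimensional, an element of the tensor product is a tuple of Laurent series,
one for each basis vector. This is what lets elements be handled through their coefficients in `g`.
-/
lemma loop_eq_sum (u : Loop g) : ∃ f : Fin (Module.finrank ℂ g) → Laurent,
    u = ∑ j, f j ⊗ₜ[ℂ] Module.finBasis ℂ g j ∧
      ∀ j n, Laurent.coeff n (f j) = (Module.finBasis ℂ g).repr (loopCoeff n u) j := by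
  induction u using TensorProduct.induction_on with
  | zero => exact ⟨0, by simp, by simp⟩
  | add a b ha hb =>
    obtain ⟨f, hf, hf'⟩ := ha
    obtain ⟨h, hh, hh'⟩ := hb
    refine ⟨f + h, ?_, fun j n => ?_⟩
    · rw [hf, hh, ← Finset.sum_add_distrib]
      exact Finset.sum_congr rfl fun j _ => by rw [Pi.add_apply, TensorProduct.add_tmul]
    · rw [Pi.add_apply, map_add, map_add, map_add, Finsupp.add_apply, hf', hh']
  | tmul f x =>
    refine ⟨fun j => (Module.finBasis ℂ g).repr x j • f, ?_, fun j n => ?_⟩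
    · conv_lhs => rw [← (Module.finBasis ℂ g).sum_repr x, TensorProduct.tmul_sum]
      exact Finset.sum_congr rfl fun j _ => by rw [TensorProduct.smul_tmul]
    · rw [loopCoeff_tmul, map_smul, map_smul, Finsupp.smul_apply, smul_eq_mul, smul_eq_mul,
        mul_comm]

/-- An element of `g((z))` is determined by its coefficients. -/
lemma loop_ext {u v : Loop g} (h : ∀ n, loopCoeff n u = loopCoeff n v) : u = v := by
  obtain ⟨f, hf, hf'⟩ := loop_eq_sum u
  obtain ⟨f', hh, hh'⟩ := loop_eq_sum v
  rw [hf, hh]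
  refine Finset.sum_congr rfl fun j _ => ?_
  congr 1
  ext n
  rw [hf', hh', h]

/-- The series `∑_{i ≥ 0} Y_i z^i`. -/
def loopOfSeq (Y : ℕ → g) : Loop g :=
  ∑ j, Laurent.ofSeq (fun i => (Module.finBasis ℂ g).repr (Y i) j) ⊗ₜ[ℂ] Module.finBasis ℂ g j

lemma loopCoeff_loopOfSeq_of_neg (Y : ℕ → g) {n : ℤ} (hn : n < 0) :
    loopCoeff n (loopOfSeq Y) = 0 := by
  rw [loopOfSeq, map_sum]
  exact Finset.sum_eq_zero fun j _ => by
    rw [loopCoeff_tmul, Laurent.coeff_ofSeq_of_neg _ hn, zero_smul]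

lemma loopCoeff_loopOfSeq (Y : ℕ → g) (n : ℕ) : loopCoeff n (loopOfSeq Y) = Y n := by
  rw [loopOfSeq, map_sum]
  simp_rw [loopCoeff_tmul, Laurent.coeff_ofSeq]
  exact (Module.finBasis ℂ g).sum_repr (Y n)

/-- Series without polar part are equal if their coefficients are. -/
lemma loop_ext_nat {u v : Loop g} (hu : ∀ n < (0 : ℤ), loopCoeff n u = 0)
    (hv : ∀ n < (0 : ℤ), loopCoeff n v = 0) (h : ∀ n : ℕ, loopCoeff n u = loopCoeff n v) :
    u = v := by
  refine loop_ext fun n => ?_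
  rcases lt_or_ge n 0 with hn | hn
  · rw [hu n hn, hv n hn]
  · obtain ⟨k, rfl⟩ := Int.eq_ofNat_of_zero_le hn
    exact h k

/-- The cocycle vanishes on series without polar part. -/
lemma loopForm_eq_zero (B : InvariantForm g) {u v : Loop g}
    (hu : ∀ n < (0 : ℤ), loopCoeff n u = 0) (hv : ∀ n < (0 : ℤ), loopCoeff n v = 0) :
    loopForm B u v = 0 := by
  obtain ⟨f, hf, hf'⟩ := loop_eq_sum u
  obtain ⟨f', hh, hh'⟩ := loop_eq_sum v
  rw [hf, hh, map_sum]
  refine Finset.sum_eq_zero fun k _ => ?_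
  rw [map_sum, LinearMap.sum_apply]
  refine Finset.sum_eq_zero fun j _ => ?_
  rw [loopForm_tmul, Laurent.coeff_mul_deriv_eq_zero, mul_zero]
  · intro n hn
    rw [hf', hu n hn]
    simp
  · intro n hn
    rw [hh', hv n hn]
    simp

lemma loopCoeff_lie_constant (a : g) (v : Loop g) (n : ℤ) :
    loopCoeff n ⁅(Laurent.mono 0 ⊗ₜ[ℂ] a : Loop g), v⁆ = ⁅a, loopCoeff n v⁆ := by
  induction v using TensorProduct.induction_on with
  | zero => simp
  | add x y hx hy => rw [lie_add, map_add, hx, hy, map_add, lie_add]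
  | tmul f x =>
    rw [LieAlgebra.ExtendScalars.bracket_tmul, Laurent.mono_zero, one_mul, loopCoeff_tmul,
      loopCoeff_tmul, lie_smul]

variable (B : InvariantForm g)

/-- The projection of the affine Lie algebra onto `g((z))`, as a linear map. -/
def loopPartLinear : AffineLieAlgebra B →ₗ[ℂ] Loop g where
  toFun := loopPart
  map_add' _ _ := rfl
  map_smul' _ _ := rfl

/-- The coefficient of `K`. -/
def levelPart : AffineLieAlgebra B →ₗ[ℂ] ℂ where
  toFun x := TrivialLieModule.equiv ℂ (Loop g) ℂ
    ((LieAlgebra.ofProd (affineCocycle B)).symm x).2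
  map_add' _ _ := rfl
  map_smul' _ _ := rfl

/-- The map `(u, c) ↦ u + c K` is linear. -/
def affineMkLinear : Loop g × ℂ →ₗ[ℂ] AffineLieAlgebra B where
  toFun x := affineMk B x.1 x.2
  map_add' _ _ := rfl
  map_smul' _ _ := rfl

variable {B}

@[simp] lemma loopPart_affineMk (u : Loop g) (c : ℂ) : loopPart (affineMk B u c) = u := rfl

@[simp] lemma levelPart_affineMk (u : Loop g) (c : ℂ) : levelPart B (affineMk B u c) = c := rfl

lemma affineMk_eta (x : AffineLieAlgebra B) : affineMk B (loopPart x) (levelPart B x) = x := rfl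

lemma affine_ext {x y : AffineLieAlgebra B} (h : loopPart x = loopPart y)
    (h' : levelPart B x = levelPart B y) : x = y := by
  rw [← affineMk_eta x, ← affineMk_eta y, h, h']

lemma levelPart_lie (x y : AffineLieAlgebra B) :
    levelPart B ⁅x, y⁆ = loopForm B (loopPart x) (loopPart y) := by
  rw [← affineMk_eta x, ← affineMk_eta y, lie_affineMk]
  rfl

end Loop

/-- The restriction of a linear map to Lie subalgebras. -/
def restrictLinear {L : Type*} [LieRing L] [LieAlgebra ℂ L] (f : L →ₗ[ℂ] L)
    (S T : LieSubalgebra ℂ L) (h : ∀ x ∈ S, f x ∈ T) : S →ₗ[ℂ] T where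
  toFun x := ⟨f x, h x x.2⟩
  map_add' x y := Subtype.ext (map_add f (x : L) y)
  map_smul' c x := Subtype.ext (map_smul f c (x : L))

/-! ### The affine singularity algebras -/

namespace ParabolicFiltration

open LieAlgebra

variable {g : Type*} [LieRing g] [LieAlgebra ℂ g] [FiniteDimensional ℂ g]
  [HasCentralRadical ℂ g] {t : LieSubalgebra ℂ g} [t.IsCartanSubalgebra]
  (ψ : ParabolicFiltration t) (B : InvariantForm g)

section AffineRetraction

set_option linter.unusedSectionVars false

/-- The map `Y ↦ ∑_{i ≥ 0} Y_i z^i` is linear. -/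
def loopOfSeqLinear : (ℕ → g) →ₗ[ℂ] Loop g where
  toFun := loopOfSeq
  map_add' Y Y' := loop_ext_nat (fun n hn => loopCoeff_loopOfSeq_of_neg _ hn)
    (fun n hn => by
      rw [map_add, loopCoeff_loopOfSeq_of_neg _ hn, loopCoeff_loopOfSeq_of_neg _ hn, add_zero])
    fun n => by
      rw [map_add, loopCoeff_loopOfSeq, loopCoeff_loopOfSeq, loopCoeff_loopOfSeq, Pi.add_apply]
  map_smul' c Y := loop_ext_nat (fun n hn => loopCoeff_loopOfSeq_of_neg _ hn)
    (fun n hn => by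
      rw [map_smul, loopCoeff_loopOfSeq_of_neg _ hn, smul_zero])
    fun n => by
      rw [map_smul, loopCoeff_loopOfSeq, loopCoeff_loopOfSeq, Pi.smul_apply, RingHom.id_apply]

/-- The projection `∑ X_i z^i + c K ↦ ∑ q_i(X_i) z^i + c K`, where `q_i` is the projection onto the
`i`-th Levi centre. -/
def affineRetract : AffineLieAlgebra B →ₗ[ℂ] AffineLieAlgebra B :=
  affineMkLinear B ∘ₗ
    ((loopOfSeqLinear ∘ₗ LinearMap.pi fun i : ℕ =>
      ψ.centreProj B i ∘ₗ loopCoeff (i : ℤ)) ∘ₗ loopPartLinear B).prod (levelPart B)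

variable {B}

lemma loopCoeff_affineRetract (x : AffineLieAlgebra B) (n : ℕ) :
    loopCoeff n (loopPart (ψ.affineRetract B x)) =
      ψ.centreProj B n (loopCoeff n (loopPart x)) :=
  loopCoeff_loopOfSeq _ n

lemma loopCoeff_affineRetract_of_neg (x : AffineLieAlgebra B) {n : ℤ} (hn : n < 0) :
    loopCoeff n (loopPart (ψ.affineRetract B x)) = 0 :=
  loopCoeff_loopOfSeq_of_neg _ hn

lemma levelPart_affineRetract (x : AffineLieAlgebra B) :
    levelPart B (ψ.affineRetract B x) = levelPart B x := rfl

lemma affineRetract_mem (x : AffineLieAlgebra B) :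
    ψ.affineRetract B x ∈ ψ.affineLeviCentre B :=
  ⟨fun _ hn => ψ.loopCoeff_affineRetract_of_neg x hn, fun i => by
    rw [loopCoeff_affineRetract]
    exact ψ.centreProj_mem B i _⟩

lemma affineRetract_mem_poly {x : AffineLieAlgebra B}
    (hx : x ∈ ψ.affineSingularityAlgebraPoly B) :
    ψ.affineRetract B x ∈ ψ.affineLeviCentrePoly B := by
  obtain ⟨-, N, hN⟩ := hx
  refine ⟨ψ.affineRetract_mem x, N, fun n hn => ?_⟩
  rcases lt_or_ge n 0 with h | h
  · exact ψ.loopCoeff_affineRetract_of_neg x h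
  · obtain ⟨k, rfl⟩ := Int.eq_ofNat_of_zero_le h
    rw [loopCoeff_affineRetract, hN _ hn, map_zero]

lemma affineRetract_eq_self {x : AffineLieAlgebra B} (hx : x ∈ ψ.affineLeviCentre B) :
    ψ.affineRetract B x = x := by
  refine affine_ext (loop_ext_nat (fun _ hn => ψ.loopCoeff_affineRetract_of_neg x hn) hx.1
    fun n => ?_) rfl
  rw [loopCoeff_affineRetract, ψ.centreProj_eq_self B (hx.2 n)]

/-- The coefficient of `z^n` is a sum of brackets from degrees `k + l = n`. By monotonicity both
factors lie in the `n`-th parabolic subalgebra, so the `n`-th projection kills each bracket. The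
coefficient of `K` is a residue of series without polar part, hence zero. -/
lemma affineRetract_lie {x y : AffineLieAlgebra B} (hx : x ∈ ψ.affineSingularityAlgebra B)
    (hy : y ∈ ψ.affineSingularityAlgebra B) : ψ.affineRetract B ⁅x, y⁆ = 0 := by
  refine affine_ext (loop_ext_nat (fun _ hn => ψ.loopCoeff_affineRetract_of_neg _ hn)
    (fun _ _ => map_zero _) fun n => ?_) ?_
  · refine Eq.trans ?_ (map_zero (loopCoeff (n : ℤ))).symm
    rw [loopCoeff_affineRetract, loopPart_lie, loopCoeff_lie]
    refine finsum_induction (fun w => ψ.centreProj B n w = 0) (map_zero _)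
      (fun a b ha hb => by rw [map_add, ha, hb, add_zero]) fun i => ?_
    by_cases hi : i < 0
    · rw [hx.1 i hi, zero_lie, map_zero]
    by_cases hj : (n : ℤ) - i < 0
    · rw [hy.1 _ hj, lie_zero, map_zero]
    obtain ⟨k, rfl⟩ := Int.eq_ofNat_of_zero_le (not_lt.1 hi)
    obtain ⟨l, hl⟩ := Int.eq_ofNat_of_zero_le (not_lt.1 hj)
    rw [hl]
    exact ψ.centreProj_lie B (ψ.parabolicAt_mono (by omega) (hx.2 k))
      (ψ.parabolicAt_mono (by omega) (hy.2 l))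
  · rw [levelPart_affineRetract, levelPart_lie, loopForm_eq_zero B hx.1 hy.1]
    rfl

lemma lie_affineLeviCentre {x y : AffineLieAlgebra B} (hx : x ∈ ψ.affineLeviCentre B)
    (hy : y ∈ ψ.affineLeviCentre B) : ⁅x, y⁆ = 0 := by
  refine affine_ext (loop_ext fun n => ?_) ?_
  · refine Eq.trans ?_ (map_zero (loopCoeff n)).symm
    rw [loopPart_lie, loopCoeff_lie]
    refine (finsum_congr fun i => ?_).trans finsum_zero
    by_cases hi : i < 0
    · rw [hx.1 i hi, zero_lie]
    by_cases hj : n - i < 0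
    · rw [hy.1 _ hj, lie_zero]
    obtain ⟨k, rfl⟩ := Int.eq_ofNat_of_zero_le (not_lt.1 hi)
    obtain ⟨l, hl⟩ := Int.eq_ofNat_of_zero_le (not_lt.1 hj)
    rw [hl]
    exact ψ.lie_leviCentre (hx.2 k) (hy.2 l)
  · rw [levelPart_lie, loopForm_eq_zero B hx.1 hy.1]
    rfl

/-- The elements of a basis of the smallest parabolic subalgebra of the filtration. -/
def parabolicBasis (j : Fin (Module.finrank ℂ (ψ.parabolicAt 0).toSubmodule)) : g :=
  Module.finBasis ℂ (ψ.parabolicAt 0).toSubmodule j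

lemma parabolicBasis_mem (j : Fin (Module.finrank ℂ (ψ.parabolicAt 0).toSubmodule)) :
    ψ.parabolicBasis j ∈ (ψ.parabolicAt 0).toSubmodule := Subtype.coe_prop _

lemma le_span_parabolicBasis :
    (ψ.parabolicAt 0).toSubmodule ≤ Submodule.span ℂ (Set.range ψ.parabolicBasis) := by
  intro x hx
  have h1 := (Module.finBasis ℂ (ψ.parabolicAt 0).toSubmodule).sum_repr ⟨x, hx⟩
  have h2 : _ = x := congrArg Subtype.val h1
  rw [AddSubmonoidClass.coe_finsetSum] at h2
  rw [← h2]
  exact sum_mem fun j _ => Submodule.smul_mem _ _ (Submodule.subset_span ⟨j, rfl⟩)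

/-- An element of the kernel of `affineRetract` is a finite sum of brackets whose first entries are
constant. -/
lemma exists_sum_lie_of_affineRetract_eq_zero {x : AffineLieAlgebra B}
    (hx : x ∈ ψ.affineSingularityAlgebra B) (h : ψ.affineRetract B x = 0) :
    ∃ Y : Fin (Module.finrank ℂ (ψ.parabolicAt 0).toSubmodule) → ℕ → g,
      (∀ j i, Y j i ∈ (ψ.parabolicAt i).toSubmodule) ∧
      (∀ i : ℕ, loopCoeff (i : ℤ) (loopPart x) = 0 → ∀ j, Y j i = 0) ∧
      x = ∑ j, ⁅affineMono B 0 (ψ.parabolicBasis j), affineMk B (loopOfSeq (Y j)) 0⁆ := by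
  have hstep : ∀ i : ℕ, ∃ y : Fin (Module.finrank ℂ (ψ.parabolicAt 0).toSubmodule) → g,
      (∀ j, y j ∈ (ψ.parabolicAt i).toSubmodule) ∧
      (loopCoeff (i : ℤ) (loopPart x) = 0 → ∀ j, y j = 0) ∧
      loopCoeff (i : ℤ) (loopPart x) = ∑ j, ⁅ψ.parabolicBasis j, y j⁆ := by
    intro i
    -- Where the coefficient of `x` vanishes the zero solution is imposed, so that a polynomial `x`
    -- yields polynomial second entries.
    by_cases h0 : loopCoeff (i : ℤ) (loopPart x) = 0
    · exact ⟨0, fun j => zero_mem _, fun _ _ => rfl, by simp [h0]⟩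
    · have h1 : ψ.centreProj B i (loopCoeff i (loopPart x)) = 0 := by
        rw [← loopCoeff_affineRetract, h]
        exact map_zero (loopCoeff (i : ℤ))
      obtain ⟨y, hy, e⟩ := exists_sum_lie_eq ψ.parabolicBasis ψ.le_span_parabolicBasis
        (ψ.mem_bracketSpan_of_centreProj_eq_zero B (hx.2 i) h1)
      exact ⟨y, hy, fun h => absurd h h0, e⟩
  choose Y hY1 hY2 hY3 using hstep
  refine ⟨fun j i => Y i j, fun j i => hY1 i j, fun i hi j => hY2 i hi j, ?_⟩
  -- The first entries do not depend on the degree, so the solutions chosen degree by degree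
  -- assemble into finitely many series. The cocycle adds no multiple of `K`.
  have hsum : ∀ s : Finset (Fin (Module.finrank ℂ (ψ.parabolicAt 0).toSubmodule)),
      ∑ j ∈ s, ⁅affineMono B 0 (ψ.parabolicBasis j), affineMk B (loopOfSeq fun i => Y i j) 0⁆ =
        affineMk B (∑ j ∈ s, ⁅(Laurent.mono 0 ⊗ₜ[ℂ] ψ.parabolicBasis j : Loop g),
          loopOfSeq fun i => Y i j⁆) 0 := by
    intro s
    have e : ∀ j, ⁅affineMono B 0 (ψ.parabolicBasis j), affineMk B (loopOfSeq fun i => Y i j) 0⁆ =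
        affineMkLinear B (⁅(Laurent.mono 0 ⊗ₜ[ℂ] ψ.parabolicBasis j : Loop g),
          loopOfSeq fun i => Y i j⁆, 0) := by
      intro j
      rw [affineMono, lie_affineMk, loopForm_eq_zero B]
      · rfl
      · intro n hn
        rw [loopCoeff_single, if_neg (by omega)]
      · exact fun n hn => loopCoeff_loopOfSeq_of_neg _ hn
    simp_rw [e]
    rw [← map_sum]
    change affineMk B _ _ = _
    rw [Prod.fst_sum, Prod.snd_sum, Finset.sum_const_zero]
  rw [hsum]
  refine affine_ext (loop_ext_nat hx.1 (fun n hn => ?_) fun n => ?_) ?_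
  · rw [loopPart_affineMk, map_sum]
    refine Finset.sum_eq_zero fun j _ => ?_
    rw [loopCoeff_lie_constant, loopCoeff_loopOfSeq_of_neg _ hn, lie_zero]
  · rw [hY3, loopPart_affineMk, map_sum]
    refine Finset.sum_congr rfl fun j _ => ?_
    rw [loopCoeff_lie_constant, loopCoeff_loopOfSeq]
  -- The retraction preserves the level, so an element of its kernel has level zero.
  · rw [← ψ.levelPart_affineRetract x, h]
    rfl

lemma affineMk_loopOfSeq_mem {Y : ℕ → g} (hY : ∀ i, Y i ∈ (ψ.parabolicAt i).toSubmodule) :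
    affineMk B (loopOfSeq Y) 0 ∈ ψ.affineSingularityAlgebra B :=
  ⟨fun _ hn => loopCoeff_loopOfSeq_of_neg _ hn, fun i => by
    rw [loopPart_affineMk, loopCoeff_loopOfSeq]
    exact hY i⟩

variable (B) in
/-- The retraction of the affine singularity algebra onto `affineLeviCentre`. -/
def seriesRetract : ψ.affineSingularityAlgebra B →ₗ[ℂ] ψ.affineLeviCentre B :=
  restrictLinear (ψ.affineRetract B) _ _ fun x _ => ψ.affineRetract_mem x

variable (B) in
/-- The retraction of the polynomial variant onto `affineLeviCentrePoly`. -/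
def polyRetract : ψ.affineSingularityAlgebraPoly B →ₗ[ℂ] ψ.affineLeviCentrePoly B :=
  restrictLinear (ψ.affineRetract B) _ _ fun _ hx => ψ.affineRetract_mem_poly hx

lemma seriesRetract_inclusion (x : ψ.affineLeviCentre B) :
    ψ.seriesRetract B (LieSubalgebra.inclusion (ψ.affineLeviCentre_le B) x) = x :=
  Subtype.ext (ψ.affineRetract_eq_self x.2)

lemma polyRetract_inclusion (x : ψ.affineLeviCentrePoly B) :
    ψ.polyRetract B (LieSubalgebra.inclusion (ψ.affineLeviCentrePoly_le B) x) = x :=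
  Subtype.ext (ψ.affineRetract_eq_self x.2.1)

lemma seriesRetract_lie (x y : ψ.affineSingularityAlgebra B) : ψ.seriesRetract B ⁅x, y⁆ = 0 :=
  Subtype.ext (ψ.affineRetract_lie x.2 y.2)

lemma polyRetract_lie (x y : ψ.affineSingularityAlgebraPoly B) : ψ.polyRetract B ⁅x, y⁆ = 0 :=
  Subtype.ext (ψ.affineRetract_lie x.2.1 y.2.1)

lemma mem_derived_of_seriesRetract_eq_zero (x : ψ.affineSingularityAlgebra B)
    (h : ψ.seriesRetract B x = 0) :
    x ∈ ⁅(⊤ : LieIdeal ℂ (ψ.affineSingularityAlgebra B)), (⊤ : LieIdeal ℂ _)⁆ := by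
  obtain ⟨Y, hY, -, e⟩ := ψ.exists_sum_lie_of_affineRetract_eq_zero x.2 (congrArg Subtype.val h)
  let a : Fin (Module.finrank ℂ (ψ.parabolicAt 0).toSubmodule) → ψ.affineSingularityAlgebra B :=
    fun j => ⟨affineMono B 0 (ψ.parabolicBasis j),
      affineMono_mem_affineSeries (ψ.parabolicBasis_mem j)⟩
  let b : Fin (Module.finrank ℂ (ψ.parabolicAt 0).toSubmodule) → ψ.affineSingularityAlgebra B :=
    fun j => ⟨affineMk B (loopOfSeq (Y j)) 0, ψ.affineMk_loopOfSeq_mem (hY j)⟩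
  have e' : x = ∑ j, ⁅a j, b j⁆ := by
    apply Subtype.ext
    rw [AddSubmonoidClass.coe_finsetSum]
    exact e
  rw [e']
  exact sum_mem fun j _ => LieSubmodule.lie_mem_lie (LieSubmodule.mem_top _)
    (LieSubmodule.mem_top _)

lemma mem_derived_of_polyRetract_eq_zero (x : ψ.affineSingularityAlgebraPoly B)
    (h : ψ.polyRetract B x = 0) :
    x ∈ ⁅(⊤ : LieIdeal ℂ (ψ.affineSingularityAlgebraPoly B)), (⊤ : LieIdeal ℂ _)⁆ := by
  obtain ⟨Y, hY, hY0, e⟩ :=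
    ψ.exists_sum_lie_of_affineRetract_eq_zero x.2.1 (congrArg Subtype.val h)
  obtain ⟨N, hN⟩ := x.2.2
  let a : Fin (Module.finrank ℂ (ψ.parabolicAt 0).toSubmodule) →
      ψ.affineSingularityAlgebraPoly B :=
    fun j => ⟨affineMono B 0 (ψ.parabolicBasis j),
      affineMono_mem_affinePoly (ψ.parabolicBasis_mem j)⟩
  let b : Fin (Module.finrank ℂ (ψ.parabolicAt 0).toSubmodule) →
      ψ.affineSingularityAlgebraPoly B :=
    -- The bound `N` for `x` also bounds the degree of each `Y j`, because `Y j` vanishes wherever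
    -- the coefficient of `x` does.
    fun j => ⟨affineMk B (loopOfSeq (Y j)) 0, ψ.affineMk_loopOfSeq_mem (hY j), N, fun n hn => by
      rw [loopPart_affineMk]
      rcases lt_or_ge n 0 with h | h
      · exact loopCoeff_loopOfSeq_of_neg _ h
      · obtain ⟨k, rfl⟩ := Int.eq_ofNat_of_zero_le h
        rw [loopCoeff_loopOfSeq]
        exact hY0 k (hN _ hn) j⟩
  have e' : x = ∑ j, ⁅a j, b j⁆ := by
    apply Subtype.ext
    rw [AddSubmonoidClass.coe_finsetSum]
    exact e
  rw [e']
  exact sum_mem fun j _ => LieSubmodule.lie_mem_lie (LieSubmodule.mem_top _)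
    (LieSubmodule.mem_top _)

end AffineRetraction

end ParabolicFiltration

/-! ### Coefficients in the truncated current algebra -/

section Truncated

lemma truncate_surjective (r : ℕ) : Function.Surjective (truncate r) :=
  Ideal.Quotient.mkₐ_surjective ℂ _

lemma coeff_eq_zero_of_truncate_eq_zero {r i : ℕ} (hi : i < r) {p : ℂ⟦X⟧}
    (h : truncate r p = 0) : PowerSeries.coeff i p = 0 :=
  PowerSeries.X_pow_dvd_iff.1
    (Ideal.mem_span_singleton.1 (Ideal.Quotient.eq_zero_iff_mem.1 h)) i hi

/-- The coefficient of `ε^i` of an element of `ℂ_r`. -/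
def truncRingCoeff (r : ℕ) (i : Fin r) : TruncatedRing r →ₗ[ℂ] ℂ :=
  Submodule.liftQ (LinearMap.ker (truncate r).toLinearMap) (PowerSeries.coeff (R := ℂ) (i : ℕ))
      (fun _ hp => coeff_eq_zero_of_truncate_eq_zero i.2 hp) ∘ₗ
    ((truncate r).toLinearMap.quotKerEquivOfSurjective (truncate_surjective r)).symm.toLinearMap

lemma truncRingCoeff_truncate (r : ℕ) (i : Fin r) (p : ℂ⟦X⟧) :
    truncRingCoeff r i (truncate r p) = PowerSeries.coeff (i : ℕ) p := by
  have h : ((truncate r).toLinearMap.quotKerEquivOfSurjective (truncate_surjective r)).symm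
      (truncate r p) = Submodule.Quotient.mk p := by
    rw [LinearEquiv.symm_apply_eq]
    rfl
  rw [truncRingCoeff, LinearMap.comp_apply, LinearEquiv.coe_coe, h]
  rfl

lemma truncRingCoeff_eps_pow (r : ℕ) (i : Fin r) (n : ℕ) :
    truncRingCoeff r i (eps r ^ n) = if (i : ℕ) = n then 1 else 0 := by
  rw [eps, ← map_pow, truncRingCoeff_truncate, PowerSeries.coeff_X_pow]

variable {g : Type*} [LieRing g] [LieAlgebra ℂ g]

/-- The coefficient of `ε^i` of an element of `g_r`. -/
def truncCoeff (r : ℕ) (i : Fin r) : TruncatedCurrent g r →ₗ[ℂ] g :=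
  (TensorProduct.lid ℂ g).toLinearMap ∘ₗ (truncRingCoeff r i).rTensor g

lemma truncCoeff_truncMono (r : ℕ) (i : Fin r) (n : ℕ) (x : g) :
    truncCoeff r i (truncMono r n x) = if (i : ℕ) = n then x else 0 := by
  rw [truncCoeff, truncMono, LinearMap.comp_apply, TensorProduct.mk_apply,
    LinearMap.rTensor_tmul, LinearEquiv.coe_coe, TensorProduct.lid_tmul, truncRingCoeff_eps_pow]
  split_ifs <;> simp

lemma truncMono_eq_zero {r n : ℕ} (h : r ≤ n) (x : g) : truncMono r n x = 0 := by
  rw [truncMono, TensorProduct.mk_apply, eps_pow_eq_zero h, TensorProduct.zero_tmul]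

variable {r : ℕ} {V : ℕ → Submodule ℂ g} {hV : IsMultiplicative V}

lemma truncSum_induction {p : TruncatedCurrent g r → Prop}
    (mem : ∀ (i : Fin r) (x : g), x ∈ V i → p (truncMono r i x)) (zero : p 0)
    (add : ∀ x y, p x → p y → p (x + y)) {x : TruncatedCurrent g r} (hx : x ∈ truncSum r V hV) :
    p x := by
  change x ∈ ⨆ i : Fin r, (V i).map (truncMono r (i : ℕ)) at hx
  refine Submodule.iSup_induction _ (motive := p) hx (fun i y hy => ?_) zero add
  obtain ⟨y, hy, rfl⟩ := hy
  exact mem i y hy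

lemma truncCoeff_mem {x : TruncatedCurrent g r} (hx : x ∈ truncSum r V hV) (i : Fin r) :
    truncCoeff r i x ∈ V i := by
  refine truncSum_induction (p := fun x => truncCoeff r i x ∈ V i) (fun j x hx => ?_) ?_
    (fun x y hx hy => ?_) hx
  · rw [truncCoeff_truncMono]
    split_ifs with h
    · rw [h]
      exact hx
    · exact zero_mem _
  · rw [map_zero]
    exact zero_mem _
  · rw [map_add]
    exact add_mem hx hy

lemma sum_truncMono_truncCoeff {x : TruncatedCurrent g r} (hx : x ∈ truncSum r V hV) :
    ∑ i : Fin r, truncMono r i (truncCoeff r i x) = x := by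
  refine truncSum_induction
    (p := fun x => ∑ i : Fin r, truncMono r i (truncCoeff r i x) = x)
    (fun j x _ => ?_) (by simp) (fun x y hx hy => ?_) hx
  · rw [Finset.sum_eq_single j]
    · rw [truncCoeff_truncMono, if_pos rfl]
    · intro i _ hij
      rw [truncCoeff_truncMono, if_neg fun h => hij (Fin.ext h), map_zero]
    · exact fun h => absurd (Finset.mem_univ j) h
  · simp_rw [map_add, Finset.sum_add_distrib, hx, hy]

end Truncated

/-! ### The finite singularity algebra -/

namespace ParabolicFiltration

open LieAlgebra

variable {g : Type*} [LieRing g] [LieAlgebra ℂ g] [FiniteDimensional ℂ g]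
  [HasCentralRadical ℂ g] {t : LieSubalgebra ℂ g} [t.IsCartanSubalgebra]
  (ψ : ParabolicFiltration t) (B : InvariantForm g) (r : ℕ)

section FiniteRetraction

set_option linter.unusedSectionVars false

/-- The projection `∑ X_i ε^i ↦ ∑ q_i(X_i) ε^i`, where `q_i` is the projection onto the `i`-th
Levi centre. -/
def truncRetract : TruncatedCurrent g r →ₗ[ℂ] TruncatedCurrent g r :=
  ∑ i : Fin r, truncMono r i ∘ₗ ψ.centreProj B i ∘ₗ truncCoeff r i

lemma truncRetract_apply (x : TruncatedCurrent g r) :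
    ψ.truncRetract B r x = ∑ i : Fin r, truncMono r i (ψ.centreProj B i (truncCoeff r i x)) := by
  rw [truncRetract, LinearMap.sum_apply]
  rfl

lemma truncRetract_truncMono (n : ℕ) (x : g) :
    ψ.truncRetract B r (truncMono r n x) = truncMono r n (ψ.centreProj B n x) := by
  rw [truncRetract_apply]
  rcases lt_or_ge n r with h | h
  · rw [Finset.sum_eq_single ⟨n, h⟩]
    · rw [truncCoeff_truncMono, if_pos rfl]
    · intro i _ hi
      rw [truncCoeff_truncMono, if_neg fun h => hi (Fin.ext h), map_zero, map_zero]
    · exact fun h => absurd (Finset.mem_univ _) h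
  -- In degrees at least `r` both sides vanish. This case occurs for brackets, whose degree `i + j`
  -- may exceed the truncation.
  · rw [truncMono_eq_zero h, truncMono_eq_zero h]
    simp

lemma truncRetract_mem (x : TruncatedCurrent g r) :
    ψ.truncRetract B r x ∈ ψ.finiteLeviCentre r := by
  rw [truncRetract_apply]
  exact sum_mem fun i _ => truncMono_mem_truncSum i (ψ.centreProj_mem B i _)

lemma truncRetract_eq_self {x : TruncatedCurrent g r} (hx : x ∈ ψ.finiteLeviCentre r) :
    ψ.truncRetract B r x = x := by
  rw [truncRetract_apply]
  refine Eq.trans (Finset.sum_congr rfl fun i _ => ?_) (sum_truncMono_truncCoeff hx)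
  rw [ψ.centreProj_eq_self B (truncCoeff_mem hx i)]

lemma truncRetract_lie {x y : TruncatedCurrent g r} (hx : x ∈ ψ.finiteSingularityAlgebra r)
    (hy : y ∈ ψ.finiteSingularityAlgebra r) : ψ.truncRetract B r ⁅x, y⁆ = 0 := by
  refine truncSum_induction (p := fun x => ψ.truncRetract B r ⁅x, y⁆ = 0) (fun i x hx => ?_)
    (by rw [zero_lie, map_zero]) (fun a b ha hb => by rw [add_lie, map_add, ha, hb, add_zero]) hx
  refine truncSum_induction (p := fun y => ψ.truncRetract B r ⁅truncMono r i x, y⁆ = 0)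
    (fun j y hy => ?_) (by rw [lie_zero, map_zero])
    (fun a b ha hb => by rw [lie_add, map_add, ha, hb, add_zero]) hy
  rw [lie_truncMono, truncRetract_truncMono,
    ψ.centreProj_lie B (ψ.parabolicAt_mono (Nat.le_add_right _ _) hx)
      (ψ.parabolicAt_mono (Nat.le_add_left _ _) hy), map_zero]

lemma lie_finiteLeviCentre {x y : TruncatedCurrent g r} (hx : x ∈ ψ.finiteLeviCentre r)
    (hy : y ∈ ψ.finiteLeviCentre r) : ⁅x, y⁆ = 0 := by
  refine truncSum_induction (p := fun x => ⁅x, y⁆ = 0) (fun i x hx => ?_)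
    (zero_lie y) (fun a b ha hb => by rw [add_lie, ha, hb, add_zero]) hx
  refine truncSum_induction (p := fun y => ⁅truncMono r i x, y⁆ = 0)
    (fun j y hy => ?_) (lie_zero _) (fun a b ha hb => by rw [lie_add, ha, hb, add_zero]) hy
  rw [lie_truncMono, ψ.lie_leviCentre hx hy, map_zero]

/-- The retraction of the finite singularity algebra onto `finiteLeviCentre`. -/
def finiteRetract : ψ.finiteSingularityAlgebra r →ₗ[ℂ] ψ.finiteLeviCentre r :=
  restrictLinear (ψ.truncRetract B r) _ _ fun x _ => ψ.truncRetract_mem B r x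

lemma coe_finiteRetract (x : ψ.finiteSingularityAlgebra r) :
    (ψ.finiteRetract B r x : TruncatedCurrent g r) = ψ.truncRetract B r x := rfl

lemma finiteRetract_inclusion (x : ψ.finiteLeviCentre r) :
    ψ.finiteRetract B r (LieSubalgebra.inclusion (ψ.finiteLeviCentre_le r) x) = x := by
  rw [Subtype.ext_iff, coe_finiteRetract, LieSubalgebra.coe_inclusion]
  exact ψ.truncRetract_eq_self B r x.2

lemma finiteRetract_lie (x y : ψ.finiteSingularityAlgebra r) :
    ψ.finiteRetract B r ⁅x, y⁆ = 0 := by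
  rw [Subtype.ext_iff, coe_finiteRetract, LieSubalgebra.coe_bracket,
    ψ.truncRetract_lie B r x.2 y.2, ZeroMemClass.coe_zero]

/-- A first factor from degree zero leaves the degree alone: `[a, b] ε^i` is the bracket of `a ε^0`
and `b ε^i`, both in the singularity algebra. -/
lemma exists_mem_derived_truncMono (i : Fin r) {x : g}
    (hx : x ∈ bracketSpan (ψ.parabolicAt 0).toSubmodule (ψ.parabolicAt i).toSubmodule) :
    ∃ d : ψ.finiteSingularityAlgebra r,
      d ∈ ⁅(⊤ : LieIdeal ℂ (ψ.finiteSingularityAlgebra r)), (⊤ : LieIdeal ℂ _)⁆ ∧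
        (d : TruncatedCurrent g r) = truncMono r i x := by
  induction hx using Submodule.span_induction with
  | mem w hw =>
    obtain ⟨a, ha, b, hb, rfl⟩ := hw
    refine ⟨⁅(⟨truncMono r 0 a, truncMono_mem_truncSum ⟨0, i.pos⟩ ha⟩ :
        ψ.finiteSingularityAlgebra r), ⟨truncMono r i b, truncMono_mem_truncSum i hb⟩⁆,
      LieSubmodule.lie_mem_lie (LieSubmodule.mem_top _) (LieSubmodule.mem_top _), ?_⟩
    refine (lie_truncMono r 0 i a b).trans ?_
    rw [Nat.zero_add]
  | zero => exact ⟨0, zero_mem _, (map_zero _).symm⟩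
  | add a b _ _ ha hb =>
    obtain ⟨d, hd, e⟩ := ha
    obtain ⟨d', hd', e'⟩ := hb
    refine ⟨d + d', add_mem hd hd', ?_⟩
    rw [map_add, ← e, ← e']
    rfl
  | smul c a _ ha =>
    obtain ⟨d, hd, e⟩ := ha
    refine ⟨c • d, SMulMemClass.smul_mem c hd, ?_⟩
    rw [map_smul, ← e]
    rfl

lemma mem_derived_of_finiteRetract_eq_zero (x : ψ.finiteSingularityAlgebra r)
    (h : ψ.finiteRetract B r x = 0) :
    x ∈ ⁅(⊤ : LieIdeal ℂ (ψ.finiteSingularityAlgebra r)), (⊤ : LieIdeal ℂ _)⁆ := by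
  have h1 : ψ.truncRetract B r x = 0 := congrArg Subtype.val h
  -- The components in different powers of `ε` are independent, so each projection vanishes
  -- separately.
  have h2 : ∀ i : Fin r, ψ.centreProj B i (truncCoeff r i (x : TruncatedCurrent g r)) = 0 := by
    intro i
    have h3 := congrArg (truncCoeff r i) h1
    rw [truncRetract_apply, map_sum, map_zero, Finset.sum_eq_single i] at h3
    · rwa [truncCoeff_truncMono, if_pos rfl] at h3
    · intro j _ hj
      rw [truncCoeff_truncMono, if_neg fun h => hj (Fin.ext h.symm)]
    · exact fun h => absurd (Finset.mem_univ i) h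
  choose d hd e using fun i : Fin r => ψ.exists_mem_derived_truncMono r i
    (ψ.mem_bracketSpan_of_centreProj_eq_zero B (truncCoeff_mem x.2 i) (h2 i))
  have h4 : x = ∑ i, d i := by
    apply Subtype.ext
    rw [AddSubmonoidClass.coe_finsetSum, ← sum_truncMono_truncCoeff x.2]
    exact Finset.sum_congr rfl fun i _ => (e i).symm
  rw [h4]
  exact sum_mem fun i _ => hd i

end FiniteRetraction

end ParabolicFiltration

/-! ### Finite truncations and characters of the finite singularity algebra -/

namespace ParabolicFiltration

open LieAlgebra

variable {g : Type*} [LieRing g] [LieAlgebra ℂ g] [FiniteDimensional ℂ g]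
  [HasCentralRadical ℂ g] {t : LieSubalgebra ℂ g} [t.IsCartanSubalgebra]
  (ψ : ParabolicFiltration t) (B : InvariantForm g) (r : ℕ)

section Characters

set_option linter.unusedSectionVars false

/-- The coefficient of `z^n`, as a linear map on the affine Lie algebra. -/
def affineCoeff (n : ℤ) : AffineLieAlgebra B →ₗ[ℂ] g := loopCoeff n ∘ₗ loopPartLinear B

lemma affineCoeff_apply (n : ℤ) (x : AffineLieAlgebra B) :
    affineCoeff B n x = loopCoeff n (loopPart x) := rfl

lemma affineCoeff_affineMono (n : ℤ) (i : ℕ) (x : g) :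
    affineCoeff B n (affineMono B i x) = if n = i then x else 0 := loopCoeff_single i x n

lemma affineCoeff_affineK (n : ℤ) : affineCoeff B n (affineK B) = 0 := map_zero (loopCoeff n)

lemma levelPart_affineMono (i : ℕ) (x : g) : levelPart B (affineMono B i x) = 0 := rfl

lemma levelPart_affineK : levelPart B (affineK B) = 1 := rfl

/-- The part `∑_{i < r} X_i z^i + c K` of the series `∑ X_i z^i + c K`. -/
def affineHead (x : AffineLieAlgebra B) : AffineLieAlgebra B :=
  ∑ i : Fin r, affineMono B i (affineCoeff B i x) + levelPart B x • affineK B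

lemma affineCoeff_affineHead_of_lt (x : AffineLieAlgebra B) {n : ℕ} (hn : n < r) :
    affineCoeff B n (affineHead B r x) = affineCoeff B n x := by
  rw [affineHead, map_add, map_sum, map_smul, affineCoeff_affineK, smul_zero, add_zero,
    Finset.sum_eq_single ⟨n, hn⟩]
  · rw [affineCoeff_affineMono, if_pos rfl]
  · intro i _ hi
    rw [affineCoeff_affineMono, if_neg fun h => hi (Fin.ext (Int.ofNat_inj.1 h).symm)]
  · exact fun h => absurd (Finset.mem_univ _) h

lemma affineCoeff_affineHead_of_neg (x : AffineLieAlgebra B) {n : ℤ} (hn : n < 0) :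
    affineCoeff B n (affineHead B r x) = 0 := by
  rw [affineHead, map_add, map_sum, map_smul, affineCoeff_affineK, smul_zero, add_zero]
  exact Finset.sum_eq_zero fun i _ => by rw [affineCoeff_affineMono, if_neg (by omega)]

lemma affineCoeff_affineHead_of_ge (x : AffineLieAlgebra B) {n : ℤ} (hn : (r : ℤ) ≤ n) :
    affineCoeff B n (affineHead B r x) = 0 := by
  rw [affineHead, map_add, map_sum, map_smul, affineCoeff_affineK, smul_zero, add_zero]
  exact Finset.sum_eq_zero fun i _ => by rw [affineCoeff_affineMono, if_neg (by omega)]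

lemma levelPart_affineHead (x : AffineLieAlgebra B) :
    levelPart B (affineHead B r x) = levelPart B x := by
  rw [affineHead, map_add, map_sum, map_smul, levelPart_affineK, smul_eq_mul, mul_one]
  exact add_eq_right.2 (Finset.sum_eq_zero fun i _ => levelPart_affineMono B i _)

lemma affineHead_eq_self {x : AffineLieAlgebra B} (hx : ∀ n < (0 : ℤ), affineCoeff B n x = 0)
    (hr : ∀ n : ℤ, r ≤ n → affineCoeff B n x = 0) : affineHead B r x = x := by
  refine affine_ext (loop_ext_nat (fun n hn => affineCoeff_affineHead_of_neg B r x hn) hx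
    fun n => ?_) (levelPart_affineHead B r x)
  rcases lt_or_ge n r with h | h
  · exact affineCoeff_affineHead_of_lt B r x h
  · exact (affineCoeff_affineHead_of_ge B r x (by exact_mod_cast h)).trans
      (hr n (by exact_mod_cast h)).symm

/-- The functional on the Levi centres given by finitely many components and a level. -/
def finiteFunctional (l : ∀ i : Fin r, Module.Dual ℂ (ψ.leviCentre i)) :
    Module.Dual ℂ (ψ.finiteLeviCentre r) :=
  ∑ i : Fin r, l i ∘ₗ
    LinearMap.codRestrict (ψ.leviCentre i)
      (truncCoeff r i ∘ₗ (ψ.finiteLeviCentre r).toSubmodule.subtype)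
      fun x => truncCoeff_mem x.2 i

lemma finiteFunctional_apply (l : ∀ i : Fin r, Module.Dual ℂ (ψ.leviCentre i))
    (x : ψ.finiteLeviCentre r) :
    ψ.finiteFunctional r l x = ∑ i : Fin r, l i ⟨truncCoeff r i x, truncCoeff_mem x.2 i⟩ := by
  rw [finiteFunctional, LinearMap.sum_apply]
  rfl

/-- A functional on a finite direct sum is a tuple of functionals. The form `B` enters only through
the retraction. -/
lemma existsUnique_lieCharacter_finite (B : InvariantForm g)
    (l : ∀ i : Fin r, Module.Dual ℂ (ψ.leviCentre i)) :
    ∃! χ : LieCharacter ℂ (ψ.finiteSingularityAlgebra r),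
      ∀ i x, χ (ψ.finiteCentral r i x) = l i x := by
  obtain ⟨χ, hχ, huniq⟩ := existsUnique_lieCharacter
    (LieSubalgebra.inclusion (ψ.finiteLeviCentre_le r)) (ψ.finiteRetract B r)
    (ψ.finiteRetract_inclusion B r) (ψ.finiteRetract_lie B r)
    (ψ.mem_derived_of_finiteRetract_eq_zero B r) (ψ.finiteFunctional r l)
  refine ⟨χ, fun i x => ?_, fun χ' h => huniq χ' fun x => ?_⟩
  · refine (hχ ⟨truncMono r i x, truncMono_mem_truncSum i x.2⟩).trans ?_
    rw [finiteFunctional_apply, Finset.sum_eq_single i]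
    · congr 1
      apply Subtype.ext
      exact (truncCoeff_truncMono r i i (x : g)).trans (if_pos rfl)
    · intro j _ hj
      refine Eq.trans (congrArg (l j) (Subtype.ext ?_)) (map_zero (l j))
      exact (truncCoeff_truncMono r j i (x : g)).trans (if_neg fun h => hj (Fin.ext h))
    · exact fun h => absurd (Finset.mem_univ i) h
  · have e : LieSubalgebra.inclusion (ψ.finiteLeviCentre_le r) x =
        ∑ i : Fin r, ψ.finiteCentral r i ⟨truncCoeff r i x, truncCoeff_mem x.2 i⟩ := by
      apply Subtype.ext
      rw [AddSubmonoidClass.coe_finsetSum, LieSubalgebra.coe_inclusion]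
      exact (sum_truncMono_truncCoeff x.2).symm
    rw [e, map_sum, finiteFunctional_apply]
    exact Finset.sum_congr rfl fun i _ => h i _

end Characters

end ParabolicFiltration

/-! ### Characters of the affine singularity algebras -/

namespace ParabolicFiltration

open LieAlgebra

variable {g : Type*} [LieRing g] [LieAlgebra ℂ g] [FiniteDimensional ℂ g]
  [HasCentralRadical ℂ g] {t : LieSubalgebra ℂ g} [t.IsCartanSubalgebra]
  (ψ : ParabolicFiltration t) (B : InvariantForm g) (r : ℕ)

section AffineCharacters

set_option linter.unusedSectionVars false

/-- The functional on `affineLeviCentre` given by finitely many components and a level. -/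
def seriesFunctional (l : ∀ i : Fin r, Module.Dual ℂ (ψ.leviCentre i)) (k : ℂ) :
    Module.Dual ℂ (ψ.affineLeviCentre B) :=
  ∑ i : Fin r, l i ∘ₗ
    LinearMap.codRestrict (ψ.leviCentre i)
      (affineCoeff B (i : ℕ) ∘ₗ (ψ.affineLeviCentre B).toSubmodule.subtype)
      (fun x => x.2.2 i) +
    k • levelPart B ∘ₗ (ψ.affineLeviCentre B).toSubmodule.subtype

lemma seriesFunctional_apply (l : ∀ i : Fin r, Module.Dual ℂ (ψ.leviCentre i)) (k : ℂ)
    (x : ψ.affineLeviCentre B) :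
    ψ.seriesFunctional B r l k x =
      ∑ i : Fin r, l i ⟨affineCoeff B (i : ℕ) (x : AffineLieAlgebra B), x.2.2 i⟩ +
        k * levelPart B (x : AffineLieAlgebra B) := by
  rw [seriesFunctional, LinearMap.add_apply, LinearMap.sum_apply]
  rfl

lemma affineHead_inclusion (x : ψ.affineLeviCentre B) :
    affineHead B r (x : AffineLieAlgebra B) =
      ((∑ i : Fin r, ψ.affineCentral B i ⟨affineCoeff B (i : ℕ) (x : AffineLieAlgebra B), x.2.2 i⟩ +
        levelPart B (x : AffineLieAlgebra B) • ψ.centralK B :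
          ψ.affineSingularityAlgebra B) : AffineLieAlgebra B) := by
  rw [AddMemClass.coe_add, AddSubmonoidClass.coe_finsetSum]
  rfl

/-- A functional on a space of power series is not determined by its restrictions to the single
degrees. Vanishing on `z^r g[[z]]` removes the ambiguity, because it leaves only the head of the
series, in degrees below `r`, and the level. -/
lemma existsUnique_lieCharacter_series
    (l : ∀ i : Fin r, Module.Dual ℂ (ψ.leviCentre i)) (k : ℂ) :
    ∃! χ : LieCharacter ℂ (ψ.affineSingularityAlgebra B),
      ψ.VanishesFrom B r χ ∧ (∀ (i : Fin r) x, χ (ψ.affineCentral B i x) = l i x) ∧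
        χ (ψ.centralK B) = k := by
  obtain ⟨χ, hχ, huniq⟩ := existsUnique_lieCharacter
    (LieSubalgebra.inclusion (ψ.affineLeviCentre_le B)) (ψ.seriesRetract B)
    ψ.seriesRetract_inclusion ψ.seriesRetract_lie
    ψ.mem_derived_of_seriesRetract_eq_zero (ψ.seriesFunctional B r l k)
  refine ⟨χ, ⟨fun x u hu hcoeff => ?_, fun i x => ?_, ?_⟩, fun χ' ⟨hv, hl, hk⟩ =>
    huniq χ' fun x => ?_⟩
  -- The character agrees on `x` and on its retract, since they differ by an element of the derived
  -- algebra. The retract has level zero and no coefficients below degree `r`, so the functional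
  -- vanishes on it.
  · have h1 : χ (x - LieSubalgebra.inclusion (ψ.affineLeviCentre_le B) (ψ.seriesRetract B x)) = 0 :=
      lieCharacter_apply_of_mem_derived χ (ψ.mem_derived_of_seriesRetract_eq_zero _
        (by rw [map_sub, seriesRetract_inclusion, sub_self]))
    rw [map_sub, sub_eq_zero] at h1
    rw [h1, hχ, seriesFunctional_apply]
    have h2 : levelPart B (x : AffineLieAlgebra B) = 0 := by rw [hu, levelPart_affineMk]
    have h3 : levelPart B (ψ.seriesRetract B x : AffineLieAlgebra B) = 0 := h2
    rw [h3, mul_zero, add_zero]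
    refine Finset.sum_eq_zero fun i _ =>
      Eq.trans (congrArg (l i) (Subtype.ext ?_)) (map_zero (l i))
    refine (ψ.loopCoeff_affineRetract (x : AffineLieAlgebra B) i).trans ?_
    rw [hu, loopPart_affineMk, hcoeff i (by exact_mod_cast i.2), map_zero]
    rfl
  · refine (hχ ⟨affineMono B i x, affineMono_mem_affineSeries x.2⟩).trans ?_
    rw [seriesFunctional_apply, levelPart_affineMono, mul_zero, add_zero, Finset.sum_eq_single i]
    · congr 1
      apply Subtype.ext
      exact (affineCoeff_affineMono B i i (x : g)).trans (if_pos rfl)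
    · intro j _ hj
      refine Eq.trans (congrArg (l j) (Subtype.ext ?_)) (map_zero (l j))
      exact (affineCoeff_affineMono B j i (x : g)).trans
        (if_neg fun h => hj (Fin.ext (Int.ofNat_inj.1 h)))
    · exact fun h => absurd (Finset.mem_univ i) h
  · refine (hχ ⟨affineK B, affineK_mem_affineSeries⟩).trans ?_
    rw [seriesFunctional_apply, levelPart_affineK, mul_one]
    refine add_eq_right.2 (Finset.sum_eq_zero fun i _ =>
      Eq.trans (congrArg (l i) (Subtype.ext ?_)) (map_zero (l i)))
    exact affineCoeff_affineK B i
  -- Here `y` is the head of `x`, up to degree `r - 1`, including the level. The difference has no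
  -- coefficients below `r` and no level, so `χ'` takes the same value on both.
  · set y := ∑ i : Fin r, ψ.affineCentral B i
        ⟨affineCoeff B (i : ℕ) (x : AffineLieAlgebra B), x.2.2 i⟩ +
      levelPart B (x : AffineLieAlgebra B) • ψ.centralK B with hy
    set x' := LieSubalgebra.inclusion (ψ.affineLeviCentre_le B) x with hx'
    have e : ((x' - y : ψ.affineSingularityAlgebra B) : AffineLieAlgebra B) =
        (x : AffineLieAlgebra B) - affineHead B r (x : AffineLieAlgebra B) := by
      rw [affineHead_inclusion]
      rfl
    have h1 : χ' (x' - y) = 0 := by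
      refine hv _ (loopPart ((x : AffineLieAlgebra B) - affineHead B r x)) ?_ fun n hn => ?_
      · rw [e]
        refine affine_ext rfl ?_
        rw [levelPart_affineMk, map_sub, levelPart_affineHead, sub_self]
      · rw [← affineCoeff_apply, map_sub]
        rcases lt_or_ge n 0 with h | h
        · rw [affineCoeff_affineHead_of_neg B r _ h, sub_zero]
          exact x.2.1 n h
        · obtain ⟨m, rfl⟩ := Int.eq_ofNat_of_zero_le h
          rw [affineCoeff_affineHead_of_lt B r _ (by exact_mod_cast hn), sub_self]
    rw [map_sub, sub_eq_zero] at h1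
    rw [h1, hy, map_add, map_sum, map_smul, hk, seriesFunctional_apply, smul_eq_mul, mul_comm k]
    congr 1
    exact Finset.sum_congr rfl fun i _ => hl i _

lemma finite_support_poly (l : ∀ i : ℕ, Module.Dual ℂ (ψ.leviCentre i))
    (x : ψ.affineLeviCentrePoly B) :
    (Function.support fun i : ℕ =>
      l i ⟨affineCoeff B i (x : AffineLieAlgebra B), x.2.1.2 i⟩).Finite := by
  obtain ⟨N, hN⟩ := x.2.2
  refine (Set.finite_Iio N.toNat).subset fun i hi => ?_
  by_contra hlt
  refine hi (Eq.trans (congrArg (l i) (Subtype.ext ?_)) (map_zero (l i)))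
  exact hN i (Int.toNat_le.1 (not_lt.1 hlt))

/-- The functional on `affineLeviCentrePoly` given by a sequence of components and a level. -/
def polyFunctional (l : ∀ i : ℕ, Module.Dual ℂ (ψ.leviCentre i)) (k : ℂ) :
    Module.Dual ℂ (ψ.affineLeviCentrePoly B) where
  toFun x := ∑ᶠ i : ℕ, l i ⟨affineCoeff B i (x : AffineLieAlgebra B), x.2.1.2 i⟩ +
    k * levelPart B (x : AffineLieAlgebra B)
  map_add' x y := by
    have h := finsum_add_distrib (ψ.finite_support_poly B l x) (ψ.finite_support_poly B l y)
    have h' : levelPart B ((x + y : ψ.affineLeviCentrePoly B) : AffineLieAlgebra B) =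
      levelPart B (x : AffineLieAlgebra B) + levelPart B (y : AffineLieAlgebra B) := rfl
    rw [h', mul_add, add_add_add_comm, ← h]
    congr 1
    exact finsum_congr fun i => (congrArg (l i) (Subtype.ext
      (map_add (affineCoeff B i) (x : AffineLieAlgebra B) y))).trans <| (l i).map_add
      ⟨affineCoeff B i (x : AffineLieAlgebra B), x.2.1.2 i⟩
      ⟨affineCoeff B i (y : AffineLieAlgebra B), y.2.1.2 i⟩
  map_smul' c x := by
    have h' : levelPart B ((c • x : ψ.affineLeviCentrePoly B) : AffineLieAlgebra B) =
      c * levelPart B (x : AffineLieAlgebra B) := rfl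
    rw [h', RingHom.id_apply, smul_add, smul_finsum, smul_eq_mul, mul_left_comm]
    congr 1
    exact finsum_congr fun i => (congrArg (l i) (Subtype.ext
      (map_smul (affineCoeff B i) c (x : AffineLieAlgebra B)))).trans <| (l i).map_smul c
      ⟨affineCoeff B i (x : AffineLieAlgebra B), x.2.1.2 i⟩

lemma polyFunctional_apply (l : ∀ i : ℕ, Module.Dual ℂ (ψ.leviCentre i)) (k : ℂ)
    (x : ψ.affineLeviCentrePoly B) :
    ψ.polyFunctional B l k x =
      ∑ᶠ i : ℕ, l i ⟨affineCoeff B i (x : AffineLieAlgebra B), x.2.1.2 i⟩ +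
        k * levelPart B (x : AffineLieAlgebra B) := rfl

/-- A polynomial has finitely many nonzero coefficients, so any sequence of functionals defines a
functional on the algebraic direct sum, and is recovered from it. -/
lemma existsUnique_lieCharacter_poly (l : ∀ i : ℕ, Module.Dual ℂ (ψ.leviCentre i)) (k : ℂ) :
    ∃! χ : LieCharacter ℂ (ψ.affineSingularityAlgebraPoly B),
      (∀ i x, χ (ψ.affineCentralPoly B i x) = l i x) ∧ χ (ψ.centralKPoly B) = k := by
  obtain ⟨χ, hχ, huniq⟩ := existsUnique_lieCharacter
    (LieSubalgebra.inclusion (ψ.affineLeviCentrePoly_le B)) (ψ.polyRetract B)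
    ψ.polyRetract_inclusion ψ.polyRetract_lie
    ψ.mem_derived_of_polyRetract_eq_zero (ψ.polyFunctional B l k)
  refine ⟨χ, ⟨fun i x => ?_, ?_⟩, fun χ' ⟨hl, hk⟩ => huniq χ' fun x => ?_⟩
  · refine (hχ ⟨affineMono B i x, affineMono_mem_affinePoly x.2⟩).trans ?_
    rw [polyFunctional_apply, levelPart_affineMono, mul_zero, add_zero, finsum_eq_single _ i]
    · congr 1
      apply Subtype.ext
      exact (affineCoeff_affineMono B i i (x : g)).trans (if_pos rfl)
    · intro j hj
      refine Eq.trans (congrArg (l j) (Subtype.ext ?_)) (map_zero (l j))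
      exact (affineCoeff_affineMono B j i (x : g)).trans
        (if_neg fun h => hj (Int.ofNat_inj.1 h))
  · refine (hχ ⟨affineK B, affineK_mem_affinePoly⟩).trans ?_
    rw [polyFunctional_apply, levelPart_affineK, mul_one]
    refine add_eq_right.2 ((finsum_congr fun i =>
      Eq.trans (congrArg (l i) (Subtype.ext ?_)) (map_zero (l i))).trans finsum_zero)
    exact affineCoeff_affineK B i
  · obtain ⟨N, hN⟩ := x.2.2
    -- A polynomial equals its own head once the cut-off passes its degree. The bound `N` is an
    -- integer and may be negative, whence `N.toNat`.
    have e : LieSubalgebra.inclusion (ψ.affineLeviCentrePoly_le B) x =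
        ∑ i : Fin N.toNat, ψ.affineCentralPoly B i
          ⟨affineCoeff B (i : ℕ) (x : AffineLieAlgebra B), x.2.1.2 i⟩ +
        levelPart B (x : AffineLieAlgebra B) • ψ.centralKPoly B := by
      apply Subtype.ext
      rw [LieSubalgebra.coe_inclusion]
      refine (affineHead_eq_self B N.toNat x.2.1.1 fun n hn => hN n (by omega)).symm.trans ?_
      rw [AddMemClass.coe_add, AddSubmonoidClass.coe_finsetSum]
      rfl
    rw [e, map_add, map_sum, map_smul, hk, polyFunctional_apply, smul_eq_mul, mul_comm k]
    congr 1
    rw [finsum_eq_sum_of_support_subset (s := Finset.range N.toNat), ← Fin.sum_univ_eq_sum_range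
      (fun i => l i ⟨affineCoeff B i (x : AffineLieAlgebra B), x.2.1.2 i⟩)]
    · exact Finset.sum_congr rfl fun i _ => hl i _
    · intro i hi
      by_contra hlt
      refine hi (Eq.trans (congrArg (l i) (Subtype.ext ?_)) (map_zero (l i)))
      exact hN i (Int.toNat_le.1 (by simpa using hlt))

end AffineCharacters

end ParabolicFiltration

end SingularityAlgebra

end

theorem mainTheorem11 {g : Type*} [LieRing g] [LieAlgebra ℂ g] [FiniteDimensional ℂ g]
    [LieAlgebra.HasCentralRadical ℂ g] (t : LieSubalgebra ℂ g) [t.IsCartanSubalgebra]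
    (B : SingularityAlgebra.InvariantForm g) :
    (∀ p q : LieSubalgebra ℂ g, SingularityAlgebra.IsParabolicSubalgebra p →
      SingularityAlgebra.IsParabolicSubalgebra q → t ≤ p → p ≤ q →
      SingularityAlgebra.bracketSpan p.toSubmodule q.toSubmodule =
        SingularityAlgebra.bracketSpan q.toSubmodule q.toSubmodule) ∧
    (∀ ψ : SingularityAlgebra.ParabolicFiltration t,
      (∀ i (x : g), x ∈ ψ.leviCentre i ↔ ∃ h : x ∈ t, ∀ α ∈ ψ.levi i, α ⟨x, h⟩ = 0) ∧
      (∃ e : SingularityAlgebra.Abelianization (ψ.affineSingularityAlgebra B) ≃ₗ⁅ℂ⁆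
          ψ.affineLeviCentre B,
        ∀ x, e (SingularityAlgebra.toAb
          (LieSubalgebra.inclusion (ψ.affineLeviCentre_le B) x)) = x) ∧
      (∃ e : SingularityAlgebra.Abelianization (ψ.affineSingularityAlgebraPoly B) ≃ₗ⁅ℂ⁆
          ψ.affineLeviCentrePoly B,
        ∀ x, e (SingularityAlgebra.toAb
          (LieSubalgebra.inclusion (ψ.affineLeviCentrePoly_le B) x)) = x) ∧
      (∀ l : Module.Dual ℂ (ψ.affineLeviCentre B),
        ∃! χ : LieAlgebra.LieCharacter ℂ (ψ.affineSingularityAlgebra B),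
          ∀ x, χ (LieSubalgebra.inclusion (ψ.affineLeviCentre_le B) x) = l x) ∧
      (∀ (l : ∀ i : ℕ, Module.Dual ℂ (ψ.leviCentre i)) (k : ℂ),
        ∃! χ : LieAlgebra.LieCharacter ℂ (ψ.affineSingularityAlgebraPoly B),
          (∀ i x, χ (ψ.affineCentralPoly B i x) = l i x) ∧ χ (ψ.centralKPoly B) = k) ∧
      ∀ r : ℕ, 1 ≤ r → ψ.depth ≤ r →
        (∃ e : SingularityAlgebra.Abelianization (ψ.finiteSingularityAlgebra r) ≃ₗ⁅ℂ⁆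
            ψ.finiteLeviCentre r,
          ∀ x, e (SingularityAlgebra.toAb
            (LieSubalgebra.inclusion (ψ.finiteLeviCentre_le r) x)) = x) ∧
        (∀ l : ∀ i : Fin r, Module.Dual ℂ (ψ.leviCentre i),
          ∃! χ : LieAlgebra.LieCharacter ℂ (ψ.finiteSingularityAlgebra r),
            ∀ i x, χ (ψ.finiteCentral r i x) = l i x) ∧
        (∀ (l : ∀ i : Fin r, Module.Dual ℂ (ψ.leviCentre i)) (k : ℂ),
          ∃! χ : LieAlgebra.LieCharacter ℂ (ψ.affineSingularityAlgebra B),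
            ψ.VanishesFrom B r χ ∧ (∀ (i : Fin r) x, χ (ψ.affineCentral B i x) = l i x) ∧
              χ (ψ.centralK B) = k)) := by
  open SingularityAlgebra ParabolicFiltration in
  refine ⟨fun p q hp _ htp hpq => bracketSpan_eq_of_isParabolicSubalgebra hp htp hpq,
    fun ψ => ⟨fun _ _ => ψ.mem_leviCentre_iff,
      exists_abelianization_equiv _ (ψ.seriesRetract B) ψ.seriesRetract_inclusion
        (fun x y => Subtype.ext (ψ.lie_affineLeviCentre x.2 y.2)) ψ.seriesRetract_lie
        ψ.mem_derived_of_seriesRetract_eq_zero,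
      exists_abelianization_equiv _ (ψ.polyRetract B) ψ.polyRetract_inclusion
        (fun x y => Subtype.ext (ψ.lie_affineLeviCentre x.2.1 y.2.1)) ψ.polyRetract_lie
        ψ.mem_derived_of_polyRetract_eq_zero,
      existsUnique_lieCharacter _ (ψ.seriesRetract B) ψ.seriesRetract_inclusion
        ψ.seriesRetract_lie ψ.mem_derived_of_seriesRetract_eq_zero,
      ψ.existsUnique_lieCharacter_poly B, fun r _ _ =>
      ⟨exists_abelianization_equiv _ (ψ.finiteRetract B r) (ψ.finiteRetract_inclusion B r)
        (fun x y => Subtype.ext (ψ.lie_finiteLeviCentre r x.2 y.2)) (ψ.finiteRetract_lie B r)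
        (ψ.mem_derived_of_finiteRetract_eq_zero B r),
        ψ.existsUnique_lieCharacter_finite r B, ψ.existsUnique_lieCharacter_series B r⟩⟩⟩
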